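/- **Setting.** Fix reals $\delta,\lambda>0$ and a vertex set $V$ of size $n$. Put $g=\lceil\log_{1+\delta}n\rceil$ and $K=4g^2$. A *level data structure* (LDS) stores a simple graph $G$ on $V$ and a level $\ell(v)\in\{0,\dots,K\}$ for each vertex; level $\ell$ lies in group $\lfloor \ell/(4g)\rfloor$. *Invariant 1* at $v$: if $\ell(v)<K$ lies in group $i$, then $v$ has at most $(2+3/\lambda)(1+\delta)^i$ neighbours on levels $\ge\ell(v)$. *Invariant 2* at $v$: if $\ell(v)>0$ and $\ell(v)-1$ lies in group $i$, then $v$ has at least $(1+\delta)^i$ neighbours on levels $\ge\ell(v)-1$. The coreness estimate of $v$ is $(1+\delta)^{\max(\lfloor(\ell(v)+1)/(4g)\rfloor-1,\,0)}$ (quotients by $0$ count as $0$). In the *sequential* LDS, an update inserts or deletes one edge and then, as long as an invariant is violated, moves a vertex that violates Invariant 1 one level up or a vertex that violates Invariant 2 one level down; a read of $v$ returns the coreness estimate of $v$. Initially $G$ is empty and all levels are $0$. **The concurrent structure.** Batches of updates run one after another, concurrently with asynchronous reads by any number of processes; the steps are atomic and interleave arbitrarily, and process failures are allowed. Besides the LDS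 there are a batch number and an array which holds, for each vertex, either UNMARKED or a descriptor: an old level and a parent, where roots have no parent. The marked vertices thereby form disjoint DAGs, each with one root. *Batches.* A batch $\mathcal B$ consists of insertions only or of deletions only; all its updates are invoked and respond with it. It increments the batch number, modifies its edges in $G$ one by one, and performs rounds $\ell=0,\dots,K-1$. In round $\ell$ of an insertion batch, every vertex on level $\ell$ violating Invariant 1 is moved to level $\ell+1$; in round $\ell$ of a deletion batch, every vertex that violates Invariant 2 and whose desire-level is $\ell$ (the closest lower level on which it would satisfy Invariant 2) is moved to level $\ell$. A vertex is marked before its first move. Marking $v$ first collects the roots of the DAGs of all marked vertices $w$ such that $vw\in\mathcal B$, or $w$ is a neighbour of $v$ and (for insertions) $\ell(w)\ge\ell(v)$. It then makes one of these roots the parent of the others, and finally stores for $v$ a descriptor with its current level and that root as its parent (if there is no such $w$, then $v$ becomes the root of a new DAG). Marking procedures exclude each other; moves and reads may interleave with them. After the last round all roots are unmarked, then all other marked vertices, and then the batch returns. *Reads.* A read of $v$ repeats the following: read the batch number ($b_1$), the live level of $v$ ($l_1$), and the descriptor of $v$; follow parents, one array entry per step, until an unmarked vertex or a marked root is found; read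 the live level of $v$ ($l_2$) and the batch number ($b_2$). If $b_1=b_2$ and a marked root was found, it returns the coreness estimate for the old level in the descriptor of $v$. If $b_1=b_2$, an unmarked vertex was found and $l_1=l_2$, it returns the estimate for $l_2$. Otherwise it retries. **Linearization points.** The steps of an execution happen at strictly increasing real times, and edges carry distinct identifiers $id(e)\in\{1,\dots,n(n-1)/2\}$. Consider batches that have reached the unmarking. An update of $e$ in such a batch $\mathcal B$ is *visible* if $\mathcal B$ changes the level of at least one endpoint of $e$, and *invisible* otherwise. - An invisible update is linearized at the step of $\mathcal B$ that modifies $e$. - A visible update is linearized at $T+(T'-T)\cdot\frac{id(e)}{n(n-1)/2+1}$, where $T$ is the time at which the root of its DAG (the DAG containing the endpoints of $e$ that change levels) is unmarked in $\mathcal B$, and $T'$ is the time of the next step in the system (if the execution ends at $T$, any later time). It has no linearization point if this root is never unmarked. - A read that has returned is linearized at its last read of the descriptor of $v$, if it returned the estimate for an old level, and at its last read of $l_2$, if it returned the estimate for the live level. Other operations have no linearization point. **Theorem.** In every finite or infinite execution the following hold. 1. If $e=uv$ is updated in a batch that reaches the unmarking, and the batch changes the levels of both $u$ and $v$, then both are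 marked when the unmarking begins, and $u$ and $v$ are in the same DAG at every moment of the batch, up to the beginning of the unmarking, when both are marked. Every visible update belongs to exactly one DAG. 2. The execution is linearizable with respect to the sequential LDS, by means of the points above. Each operation has at most one point, and every operation that has responded has one; the point falls strictly after the invocation of the operation and, if it has responded, strictly before the response; distinct operations have distinct points. For each step, the operations with points before that step, executed by the sequential LDS in the order of their points, form a legal sequential execution in which every read returns exactly the value that it returned in the concurrent execution. -/

import Mathlib

noncomputable section

namespace CPLDS

/-! ## The level data structure -/

/-- The two constants of the level data structure. -/
structure Params where
  δ : ℝ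
  lam : ℝ
  δ_pos : 0 < δ
  lam_pos : 0 < lam

/-- The number of groups of levels, `⌈log_{1+δ} n⌉`. -/
def Params.numGroups (prm : Params) (n : ℕ) : ℕ := ⌈Real.logb (1 + prm.δ) n⌉₊

/-- The number of levels in a group, `4 ⌈log_{1+δ} n⌉`. -/
def Params.groupSize (prm : Params) (n : ℕ) : ℕ := 4 * prm.numGroups n

/-- The top level `K`; the levels are `0, …, K`. -/
def Params.topLevel (prm : Params) (n : ℕ) : ℕ := prm.numGroups n * prm.groupSize n

/-- The index of the group that contains level `ℓ`. -/
def Params.group (prm : Params) (n ℓ : ℕ) : ℕ := ℓ / prm.groupSize n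

/-- The coreness estimate `(1+δ)^{max(⌊(ℓ+1)/(4⌈log_{1+δ} n⌉)⌋ - 1, 0)}` of a vertex on level `ℓ`
(the truncated subtraction is the maximum with `0`). -/
def Params.estimate (prm : Params) (n ℓ : ℕ) : ℝ :=
  (1 + prm.δ) ^ ((ℓ + 1) / prm.groupSize n - 1)

/-- The number of neighbours of `v` on level `ℓ` or higher. -/
def degAbove {n : ℕ} (G : SimpleGraph (Fin n)) (L : Fin n → ℕ) (v : Fin n) (ℓ : ℕ) : ℕ :=
  {w | G.Adj v w ∧ ℓ ≤ L w}.ncard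

/-- Invariant 1 (degree upper bound) at `v`: below the top level, a vertex on level `ℓ` of group `i`
has at most `(2 + 3/λ)(1+δ)^i` neighbours on levels `≥ ℓ`. -/
def UpperInv {n : ℕ} (prm : Params) (G : SimpleGraph (Fin n)) (L : Fin n → ℕ) (v : Fin n) : Prop :=
  L v < prm.topLevel n →
    (degAbove G L v (L v) : ℝ) ≤ (2 + 3 / prm.lam) * (1 + prm.δ) ^ prm.group n (L v)

/-- The condition of Invariant 2 for `v`, evaluated as if `v` were on level `ℓ`: either `ℓ = 0`, or
`v` has at least `(1+δ)^i` neighbours on levels `≥ ℓ - 1`, where level `ℓ - 1` is in group `i`. -/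
def LowerOK {n : ℕ} (prm : Params) (G : SimpleGraph (Fin n)) (L : Fin n → ℕ) (v : Fin n) (ℓ : ℕ) :
    Prop :=
  0 < ℓ → (1 + prm.δ) ^ prm.group n (ℓ - 1) ≤ (degAbove G L v (ℓ - 1) : ℝ)

/-- Invariant 2 (degree lower bound) at `v`. -/
def LowerInv {n : ℕ} (prm : Params) (G : SimpleGraph (Fin n)) (L : Fin n → ℕ) (v : Fin n) : Prop :=
  LowerOK prm G L v (L v)

/-- `ℓ` is the desire-level of a vertex `v` that violates Invariant 2: the closest level below the
current one on which `v` would satisfy Invariant 2. -/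
def IsDesireLevel {n : ℕ} (prm : Params) (G : SimpleGraph (Fin n)) (L : Fin n → ℕ) (v : Fin n)
    (ℓ : ℕ) : Prop :=
  ℓ < L v ∧ LowerOK prm G L v ℓ ∧ ∀ j, ℓ < j → j ≤ L v → ¬ LowerOK prm G L v j

/-- A batch consists of insertions only or of deletions only. -/
inductive Kind where
  | insertion
  | deletion

/-- Insert the edge `e` into `G`, or delete it from `G`. -/
def applyEdge {n : ℕ} (G : SimpleGraph (Fin n)) : Kind → Sym2 (Fin n) → SimpleGraph (Fin n)
  | .insertion, e => G ⊔ SimpleGraph.fromEdgeSet {e}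
  | .deletion, e => G.deleteEdges {e}

/-! ## The sequential specification

The sequential object is the sequential level data structure. An update changes one edge and then
moves vertices that violate an invariant, one level at a time, until no vertex violates one; a read
of `v` returns the coreness estimate given by the level of `v`. -/

/-- The state of the sequential object. -/
structure SeqState (n : ℕ) where
  G : SimpleGraph (Fin n)
  level : Fin n → ℕ

/-- The empty graph, with all vertices on level `0`. -/
def SeqState.init (n : ℕ) : SeqState n := ⟨⊥, fun _ => 0⟩

/-- One rebalancing move. -/
inductive MoveStep {n : ℕ} (prm : Params) (G : SimpleGraph (Fin n)) :
    (Fin n → ℕ) → (Fin n → ℕ) → Prop where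
  | up (L : Fin n → ℕ) (v : Fin n) (h : ¬ UpperInv prm G L v) :
      MoveStep prm G L (Function.update L v (L v + 1))
  | down (L : Fin n → ℕ) (v : Fin n) (h : ¬ LowerInv prm G L v) :
      MoveStep prm G L (Function.update L v (L v - 1))

/-- `L'` results from `L` by rebalancing until both invariants hold everywhere. -/
def Rebalance {n : ℕ} (prm : Params) (G : SimpleGraph (Fin n)) (L L' : Fin n → ℕ) : Prop :=
  Relation.ReflTransGen (MoveStep prm G) L L' ∧ ∀ v, UpperInv prm G L' v ∧ LowerInv prm G L' v

/-- An operation instance of a concurrent execution: an update of the edge `e`, part of the batch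
that is invoked at step `inv`, or a read of the coreness estimate of `v` by process `p`, invoked at
step `inv` and returning `val`. -/
inductive Op (n : ℕ) (P : Type*) where
  | update (inv : ℕ) (κ : Kind) (e : Sym2 (Fin n))
  | read (inv : ℕ) (p : P) (v : Fin n) (val : ℝ)

/-- The step at which an operation is invoked. -/
def Op.inv {n : ℕ} {P : Type*} : Op n P → ℕ
  | .update i _ _ => i
  | .read i _ _ _ => i

/-- The effect of an operation on the sequential object; for a read, the returned value must be the
one the sequential object returns. -/
inductive SeqStep {n : ℕ} {P : Type*} (prm : Params) : SeqState n → Op n P → SeqState n → Prop where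
  | update (S : SeqState n) (i : ℕ) (κ : Kind) (e : Sym2 (Fin n)) (L' : Fin n → ℕ)
      (h : Rebalance prm (applyEdge S.G κ e) S.level L') :
      SeqStep prm S (.update i κ e) ⟨applyEdge S.G κ e, L'⟩
  | read (S : SeqState n) (i : ℕ) (p : P) (v : Fin n) :
      SeqStep prm S (.read i p v (prm.estimate n (S.level v))) S

/-- Executing the operations of a list one after the other takes `S` to `S'`. -/
inductive SeqRun {n : ℕ} {P : Type*} (prm : Params) :
    SeqState n → List (Op n P) → SeqState n → Prop where
  | nil (S : SeqState n) : SeqRun prm S [] S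
  | cons (S S' S'' : SeqState n) (o : Op n P) (l : List (Op n P))
      (h : SeqStep prm S o S') (hl : SeqRun prm S' l S'') : SeqRun prm S (o :: l) S''

/-! ## Shared memory and process states -/

/-- The descriptor of a marked vertex: its level before the batch, and its parent in its DAG
(`none` for a root). -/
structure Desc (n : ℕ) where
  oldLevel : ℕ
  parent : Option (Fin n)

/-- The descriptor array; `none` means `UNMARKED`. -/
abbrev DescArray (n : ℕ) := Fin n → Option (Desc n)

/-- `b` is the parent of the marked vertex `a`. -/
def ParentOf {n : ℕ} (D : DescArray n) (a b : Fin n) : Prop :=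
  ∃ d, D a = some d ∧ d.parent = some b

/-- `r` is marked and is a root. -/
def IsRoot {n : ℕ} (D : DescArray n) (r : Fin n) : Prop :=
  ∃ d, D r = some d ∧ d.parent = none

/-- `r` is the root of the DAG that contains `v`. -/
def RootOf {n : ℕ} (D : DescArray n) (v r : Fin n) : Prop :=
  Relation.ReflTransGen (ParentOf D) v r ∧ IsRoot D r

/-- A marking procedure in progress: the vertex that is being marked, the roots that still have to
be linked, and the root of the merged DAG (`none` if no DAG is merged, so that the vertex becomes
the root of a new DAG). -/
structure MarkTask (n : ℕ) where
  vertex : Fin n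
  toLink : Finset (Fin n)
  newRoot : Option (Fin n)

/-- The program counter of the update side, with its private data. -/
inductive Phase (n : ℕ) where
  | quiescent
  | invoked (κ : Kind) (B : Finset (Sym2 (Fin n)))
  | editing (κ : Kind) (B todo : Finset (Sym2 (Fin n)))
  | rebalancing (κ : Kind) (B : Finset (Sym2 (Fin n))) (ℓ : ℕ) (task : Option (MarkTask n))
  | unmarkingRoots
  | unmarkingRest

/-- The program counter of a reading process, with its local variables: the vertex `v`, the first
batch number `b₁`, the first live level `l₁`, the descriptor `d` of `v`, the descriptor `cur` that
`check_DAG` is looking at, its result, and the second live level `l₂`. -/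
inductive Reader (n : ℕ) where
  | idle
  | start (v : Fin n)
  | gotB1 (v : Fin n) (b₁ : ℕ)
  | gotL1 (v : Fin n) (b₁ l₁ : ℕ)
  | checking (v : Fin n) (b₁ l₁ : ℕ) (d cur : Option (Desc n))
  | checked (v : Fin n) (b₁ l₁ : ℕ) (d : Option (Desc n)) (marked : Bool)
  | gotL2 (v : Fin n) (b₁ l₁ : ℕ) (d : Option (Desc n)) (marked : Bool) (l₂ : ℕ)
  | returningOld (oldLevel : ℕ)
  | returningLive (liveLevel : ℕ)

/-- A configuration of the system. `P` is the set of reading processes. -/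
structure Config (n : ℕ) (P : Type*) where
  G : SimpleGraph (Fin n)
  level : Fin n → ℕ
  desc : DescArray n
  batchNum : ℕ
  phase : Phase n
  reader : P → Reader n

/-- The initial configuration: empty graph, all vertices unmarked on level `0`, nothing running. -/
def Config.init (n : ℕ) (P : Type*) : Config n P :=
  ⟨⊥, fun _ => 0, fun _ => none, 0, .quiescent, fun _ => .idle⟩

/-- In round `ℓ` of a batch, `v` has to be moved. Insertions: `v` is on level `ℓ` and violates
Invariant 1. Deletions: `v` violates Invariant 2 and its desire-level is `ℓ`. -/
def Config.NeedsMove {n : ℕ} {P : Type*} (prm : Params) (c : Config n P) (ℓ : ℕ) (v : Fin n) :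
    Kind → Prop
  | .insertion => c.level v = ℓ ∧ ¬ UpperInv prm c.G c.level v
  | .deletion => IsDesireLevel prm c.G c.level v ℓ

/-- The level to which a vertex is moved in round `ℓ`. -/
def destination (ℓ : ℕ) : Kind → ℕ
  | .insertion => ℓ + 1
  | .deletion => ℓ

/-- When `v` is marked, its DAG is merged with that of the marked vertex `w`: either `w` is a marked
batch neighbour of `v`, or it is a marked neighbour that can be causally related to the move
of `v`. For insertions these are the marked neighbours that are on the level of `v` or higher; for
deletions they are all the marked neighbours (all of them move to a level below that of `v`). -/
def Config.Related {n : ℕ} {P : Type*} (c : Config n P) (B : Finset (Sym2 (Fin n)))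
    (v w : Fin n) (κ : Kind) : Prop :=
  c.desc w ≠ none ∧
    (s(v, w) ∈ B ∨
      c.G.Adj v w ∧
        match κ with
        | .insertion => c.level v ≤ c.level w
        | .deletion => True)

/-- What happens at a step. Steps of the update side that play no role in the definition of
linearization points are `internal`. -/
inductive Event (n : ℕ) (P : Type*) where
  | batchInv (κ : Kind) (B : Finset (Sym2 (Fin n)))
  | batchResp
  | modify (e : Sym2 (Fin n))
  | beginUnmark
  | unmarkRoot (r : Fin n)
  | internal
  | readInv (p : P) (v : Fin n)
  | readB1 (p : P)
  | readL1 (p : P)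
  | readDesc (p : P)
  | checkDAG (p : P)
  | readL2 (p : P)
  | readB2 (p : P)
  | returnOld (p : P) (val : ℝ)
  | returnLive (p : P) (val : ℝ)

/-! ## The algorithm -/

/-- The atomic steps of the update side.

A batch increments the batch number, modifies its edges in `G` in any order, and runs through the
rounds `ℓ = 0, …, K - 1`. In round `ℓ` each vertex that has to be moved is first marked, if it is
not yet marked, and is later moved; marking procedures exclude each other, but moves may happen
between the steps of a marking procedure. Marking `v` collects the roots of the DAGs of all related
marked vertices (`roots_to_merge`), makes one of them the parent of the others, and then publishes
the descriptor of `v`, whose parent is that root. After the last round all the roots are unmarked,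
then all the remaining vertices, and the batch returns. -/
inductive UpdateStep {n : ℕ} {P : Type*} (prm : Params) :
    Config n P → Event n P → Config n P → Prop where
  | invoke (c : Config n P) (κ : Kind) (B : Finset (Sym2 (Fin n)))
      (hph : c.phase = .quiescent) (hB : ∀ e ∈ B, ¬ e.IsDiag) :
      UpdateStep prm c (.batchInv κ B) { c with phase := .invoked κ B }
  | tick (c : Config n P) (κ : Kind) (B : Finset (Sym2 (Fin n)))
      (hph : c.phase = .invoked κ B) :
      UpdateStep prm c .internal
        { c with batchNum := c.batchNum + 1, phase := .editing κ B B }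
  | modify (c : Config n P) (κ : Kind) (B todo : Finset (Sym2 (Fin n))) (e : Sym2 (Fin n))
      (hph : c.phase = .editing κ B todo) (he : e ∈ todo) :
      UpdateStep prm c (.modify e)
        { c with G := applyEdge c.G κ e, phase := .editing κ B (todo.erase e) }
  | editsDone (c : Config n P) (κ : Kind) (B : Finset (Sym2 (Fin n)))
      (hph : c.phase = .editing κ B ∅) :
      UpdateStep prm c .internal { c with phase := .rebalancing κ B 0 none }
  | markNewDAG (c : Config n P) (κ : Kind) (B : Finset (Sym2 (Fin n))) (ℓ : ℕ) (v : Fin n)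
      (hph : c.phase = .rebalancing κ B ℓ none)
      (hv : c.NeedsMove prm ℓ v κ) (hunm : c.desc v = none)
      (hR : ∀ w, ¬ c.Related B v w κ) :
      UpdateStep prm c .internal
        { c with phase := .rebalancing κ B ℓ (some ⟨v, ∅, none⟩) }
  | markMerge (c : Config n P) (κ : Kind) (B : Finset (Sym2 (Fin n))) (ℓ : ℕ) (v : Fin n)
      (hph : c.phase = .rebalancing κ B ℓ none)
      (hv : c.NeedsMove prm ℓ v κ) (hunm : c.desc v = none)
      (rootsToMerge : Finset (Fin n))
      (hR : ∀ r, r ∈ rootsToMerge ↔ ∃ w, c.Related B v w κ ∧ RootOf c.desc w r)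
      (newRoot : Fin n) (hr : newRoot ∈ rootsToMerge) :
      UpdateStep prm c .internal
        { c with phase :=
            .rebalancing κ B ℓ (some ⟨v, rootsToMerge.erase newRoot, some newRoot⟩) }
  | link (c : Config n P) (κ : Kind) (B : Finset (Sym2 (Fin n))) (ℓ : ℕ)
      (v newRoot x : Fin n) (todo : Finset (Fin n)) (d : Desc n)
      (hph : c.phase = .rebalancing κ B ℓ (some ⟨v, todo, some newRoot⟩))
      (hx : x ∈ todo) (hd : c.desc x = some d) :
      UpdateStep prm c .internal
        { c with
          desc := Function.update c.desc x (some ⟨d.oldLevel, some newRoot⟩)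
          phase := .rebalancing κ B ℓ (some ⟨v, todo.erase x, some newRoot⟩) }
  | publish (c : Config n P) (κ : Kind) (B : Finset (Sym2 (Fin n))) (ℓ : ℕ)
      (v : Fin n) (newRoot : Option (Fin n))
      (hph : c.phase = .rebalancing κ B ℓ (some ⟨v, ∅, newRoot⟩)) :
      UpdateStep prm c .internal
        { c with
          desc := Function.update c.desc v (some ⟨c.level v, newRoot⟩)
          phase := .rebalancing κ B ℓ none }
  | move (c : Config n P) (κ : Kind) (B : Finset (Sym2 (Fin n))) (ℓ : ℕ)
      (task : Option (MarkTask n)) (v : Fin n)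
      (hph : c.phase = .rebalancing κ B ℓ task)
      (hv : c.NeedsMove prm ℓ v κ) (hmarked : c.desc v ≠ none) :
      UpdateStep prm c .internal
        { c with level := Function.update c.level v (destination ℓ κ) }
  | nextRound (c : Config n P) (κ : Kind) (B : Finset (Sym2 (Fin n))) (ℓ : ℕ)
      (hph : c.phase = .rebalancing κ B ℓ none) (hℓ : ℓ < prm.topLevel n)
      (hdone : ∀ v, ¬ c.NeedsMove prm ℓ v κ) :
      UpdateStep prm c .internal { c with phase := .rebalancing κ B (ℓ + 1) none }
  | beginUnmark (c : Config n P) (κ : Kind) (B : Finset (Sym2 (Fin n)))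
      (hph : c.phase = .rebalancing κ B (prm.topLevel n) none) :
      UpdateStep prm c .beginUnmark { c with phase := .unmarkingRoots }
  | unmarkRoot (c : Config n P) (r : Fin n)
      (hph : c.phase = .unmarkingRoots) (hr : IsRoot c.desc r) :
      UpdateStep prm c (.unmarkRoot r) { c with desc := Function.update c.desc r none }
  | rootsDone (c : Config n P)
      (hph : c.phase = .unmarkingRoots) (hr : ∀ r, ¬ IsRoot c.desc r) :
      UpdateStep prm c .internal { c with phase := .unmarkingRest }
  | unmarkOther (c : Config n P) (v : Fin n)
      (hph : c.phase = .unmarkingRest) (hv : c.desc v ≠ none) :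
      UpdateStep prm c .internal { c with desc := Function.update c.desc v none }
  | respond (c : Config n P)
      (hph : c.phase = .unmarkingRest) (hv : ∀ v, c.desc v = none) :
      UpdateStep prm c .batchResp { c with phase := .quiescent }

/-- The atomic steps of process `p` executing a read of the coreness estimate of `v`:
```
repeat
  b₁ := batch_number
  l₁ := LDS.get_level(v)
  d  := desc_array[v]
  status := check_DAG(d)
  l₂ := LDS.get_level(v)
  b₂ := batch_number
  if b₁ = b₂ then
    if status = MARKED then return estimate(d.old_level)
    else if l₁ = l₂ then return estimate(l₂)
```
where `check_DAG` follows the parents, reading one entry of the descriptor array per step, until it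
meets an unmarked vertex (result `UNMARKED`) or a marked root (result `MARKED`).
`ReadStep prm p c s a s'` says that in configuration `c` the process can go from local state `s`
to `s'`, with event `a`; such a step does not change the shared memory. -/
inductive ReadStep {n : ℕ} {P : Type*} (prm : Params) (p : P) (c : Config n P) :
    Reader n → Event n P → Reader n → Prop where
  | invoke (v : Fin n) : ReadStep prm p c .idle (.readInv p v) (.start v)
  | readB1 (v : Fin n) : ReadStep prm p c (.start v) (.readB1 p) (.gotB1 v c.batchNum)
  | readL1 (v : Fin n) (b₁ : ℕ) :
      ReadStep prm p c (.gotB1 v b₁) (.readL1 p) (.gotL1 v b₁ (c.level v))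
  | readDesc (v : Fin n) (b₁ l₁ : ℕ) :
      ReadStep prm p c (.gotL1 v b₁ l₁) (.readDesc p) (.checking v b₁ l₁ (c.desc v) (c.desc v))
  | checkUnmarked (v : Fin n) (b₁ l₁ : ℕ) (d : Option (Desc n)) :
      ReadStep prm p c (.checking v b₁ l₁ d none) (.checkDAG p) (.checked v b₁ l₁ d false)
  | checkMarked (v : Fin n) (b₁ l₁ : ℕ) (d : Option (Desc n)) (old : ℕ) :
      ReadStep prm p c (.checking v b₁ l₁ d (some ⟨old, none⟩)) (.checkDAG p)
        (.checked v b₁ l₁ d true)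
  | checkParent (v : Fin n) (b₁ l₁ : ℕ) (d : Option (Desc n)) (old : ℕ) (q : Fin n) :
      ReadStep prm p c (.checking v b₁ l₁ d (some ⟨old, some q⟩)) (.checkDAG p)
        (.checking v b₁ l₁ d (c.desc q))
  | readL2 (v : Fin n) (b₁ l₁ : ℕ) (d : Option (Desc n)) (m : Bool) :
      ReadStep prm p c (.checked v b₁ l₁ d m) (.readL2 p) (.gotL2 v b₁ l₁ d m (c.level v))
  | retryBatch (v : Fin n) (b₁ l₁ : ℕ) (d : Option (Desc n)) (m : Bool) (l₂ : ℕ)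
      (h : b₁ ≠ c.batchNum) :
      ReadStep prm p c (.gotL2 v b₁ l₁ d m l₂) (.readB2 p) (.start v)
  | acceptOld (v : Fin n) (b₁ l₁ : ℕ) (d : Desc n) (l₂ : ℕ) (h : b₁ = c.batchNum) :
      ReadStep prm p c (.gotL2 v b₁ l₁ (some d) true l₂) (.readB2 p) (.returningOld d.oldLevel)
  | acceptLive (v : Fin n) (b₁ l₁ : ℕ) (d : Option (Desc n)) (l₂ : ℕ) (h : b₁ = c.batchNum)
      (hl : l₁ = l₂) :
      ReadStep prm p c (.gotL2 v b₁ l₁ d false l₂) (.readB2 p) (.returningLive l₂)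
  | retryLevel (v : Fin n) (b₁ l₁ : ℕ) (d : Option (Desc n)) (l₂ : ℕ) (h : b₁ = c.batchNum)
      (hl : l₁ ≠ l₂) :
      ReadStep prm p c (.gotL2 v b₁ l₁ d false l₂) (.readB2 p) (.start v)
  | returnOld (l : ℕ) :
      ReadStep prm p c (.returningOld l) (.returnOld p (prm.estimate n l)) .idle
  | returnLive (l : ℕ) :
      ReadStep prm p c (.returningLive l) (.returnLive p (prm.estimate n l)) .idle

/-- One atomic step of the system, by the update side or by a reading process. -/
inductive Step {n : ℕ} {P : Type*} [DecidableEq P] (prm : Params) :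
    Config n P → Event n P → Config n P → Prop where
  | update (c c' : Config n P) (a : Event n P) (h : UpdateStep prm c a c') : Step prm c a c'
  | read (c : Config n P) (p : P) (a : Event n P) (s' : Reader n)
      (h : ReadStep prm p c (c.reader p) a s') :
      Step prm c a { c with reader := Function.update c.reader p s' }

/-! ## Executions and linearizability -/

/-- A finite or infinite execution, under an arbitrary interleaving of the processes. Step `i`
leads from `cfg i` to `cfg (i+1)` and happens at time `time i`; `ev i = none` means that the
execution has ended before step `i` (and `cfg (i+1)` is then meaningless). -/
structure Execution (n : ℕ) (P : Type*) [DecidableEq P] (prm : Params) where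
  cfg : ℕ → Config n P
  ev : ℕ → Option (Event n P)
  time : ℕ → ℝ
  init : cfg 0 = Config.init n P
  step : ∀ i a, ev i = some a → Step prm (cfg i) a (cfg (i + 1))
  ended : ∀ i, ev i = none → ev (i + 1) = none
  time_mono : StrictMono time

section Exec

variable {n : ℕ} {P : Type*} [DecidableEq P] {prm : Params}

/-- `j` is the first step after `i` whose event satisfies `Q`. -/
def Execution.FirstAfter (x : Execution n P prm) (Q : Event n P → Prop) (i j : ℕ) : Prop :=
  i < j ∧ (∃ a, x.ev j = some a ∧ Q a) ∧
    ∀ k, i < k → k < j → ∀ a, x.ev k = some a → ¬ Q a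

/-- `m` is the last step strictly between `i` and `j` whose event is `a`. -/
def Execution.LastBetween (x : Execution n P prm) (a : Event n P) (i j m : ℕ) : Prop :=
  i < m ∧ m < j ∧ x.ev m = some a ∧ ∀ k, m < k → k < j → x.ev k ≠ some a

/-- The event is the return of a read by process `p`. -/
def Event.IsReturnOf (p : P) (a : Event n P) : Prop :=
  ∃ val, a = .returnOld p val ∨ a = .returnLive p val

/-- The operation `o` of the execution is invoked at step `o.inv` and responds at step `j`. All
updates of a batch are invoked and respond with the batch. -/
def Execution.RespondsAt (x : Execution n P prm) : Op n P → ℕ → Prop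
  | .update i κ e, j =>
      (∃ B, x.ev i = some (.batchInv κ B) ∧ e ∈ B) ∧ x.FirstAfter (fun a => a = .batchResp) i j
  | .read i p v val, j =>
      x.ev i = some (.readInv p v) ∧ x.FirstAfter (Event.IsReturnOf p) i j ∧
        (x.ev j = some (.returnOld p val) ∨ x.ev j = some (.returnLive p val))

/-- `o` is an operation of the execution: an update that has been invoked, or a read that has been
invoked and has returned. -/
def Execution.HasOp (x : Execution n P prm) : Op n P → Prop
  | .update i κ e => ∃ B, x.ev i = some (.batchInv κ B) ∧ e ∈ B
  | .read i p v val => ∃ j, x.RespondsAt (.read i p v val) j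

/-- The execution is linearizable, with linearization points given by `LP` (where `LP o τ` means
that the linearization point of `o` is at time `τ`): linearization points are unique and belong to
operations of the execution; every operation that has responded has one; it falls between invocation
and response; distinct operations have distinct points; and the operations whose points precede any
given step, executed sequentially in the order of their points, return the same values. Operations
that have not responded may or may not have a linearization point. -/
structure Execution.LinearizedBy (x : Execution n P prm) (LP : Op n P → ℝ → Prop) : Prop where
  unique : ∀ o τ τ', LP o τ → LP o τ' → τ = τ'
  hasOp : ∀ o τ, LP o τ → x.HasOp o
  total : ∀ o j, x.RespondsAt o j → ∃ τ, LP o τ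
  after_inv : ∀ o τ, LP o τ → x.time o.inv < τ
  before_resp : ∀ o τ j, LP o τ → x.RespondsAt o j → τ < x.time j
  distinct : ∀ o o' τ, LP o τ → LP o' τ → o = o'
  legal : ∀ N : ℕ, ∃ l : List (Op n P),
    (∀ o, o ∈ l ↔ ∃ τ, LP o τ ∧ τ < x.time N) ∧
    l.Pairwise (fun o o' => ∀ τ τ', LP o τ → LP o' τ' → τ < τ') ∧
    ∃ S, SeqRun prm (SeqState.init n) l S

/-! ## The linearization points -/

/-- In the batch invoked at step `i`, unmarking begins at step `s`. The marking and the level changes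
of the batch are then complete. -/
def Execution.SettlesAt (x : Execution n P prm) (i s : ℕ) : Prop :=
  x.FirstAfter (fun a => a = .beginUnmark) i s

/-- The level of `v` is changed by the batch that is invoked at step `i` and settles at step `s`. -/
def Execution.Changes (x : Execution n P prm) (i s : ℕ) (v : Fin n) : Prop :=
  (x.cfg i).level v ≠ (x.cfg s).level v

/-- The update of `e` in the batch is visible: the batch changes the level of an endpoint of `e`.
Otherwise the update is invisible. -/
def Execution.Visible (x : Execution n P prm) (i s : ℕ) (e : Sym2 (Fin n)) : Prop :=
  ∃ v ∈ e, x.Changes i s v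

/-- `r` is the root of the DAG of a visible update of `e`, i.e. the DAG that contains the endpoints
of `e` that change levels. -/
def Execution.IsRootOfDAG (x : Execution n P prm) (i s : ℕ) (e : Sym2 (Fin n)) (r : Fin n) : Prop :=
  ∃ v ∈ e, x.Changes i s v ∧ RootOf (x.cfg s).desc v r

/-- The linearization points, for edge identifiers `eid`. An update in a batch that never reaches
the unmarking has none, and neither has a visible update whose root is never unmarked, nor a read
that never returns. -/
inductive Execution.LinPoint (x : Execution n P prm) (eid : Sym2 (Fin n) → ℕ) :
    Op n P → ℝ → Prop where
  | invisible (i s m : ℕ) (κ : Kind) (e : Sym2 (Fin n))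
      (hop : x.HasOp (.update i κ e)) (hs : x.SettlesAt i s) (hvis : ¬ x.Visible i s e)
      (him : i < m) (hms : m < s) (hm : x.ev m = some (.modify e)) :
      x.LinPoint eid (.update i κ e) (x.time m)
  | visible (i s t : ℕ) (κ : Kind) (e : Sym2 (Fin n)) (r : Fin n)
      (hop : x.HasOp (.update i κ e)) (hs : x.SettlesAt i s) (hvis : x.Visible i s e)
      (hr : x.IsRootOfDAG i s e r) (ht : x.FirstAfter (fun a => a = .unmarkRoot r) s t) :
      x.LinPoint eid (.update i κ e)
        (x.time t + (x.time (t + 1) - x.time t) * (eid e / ((n : ℝ) * (n - 1) / 2 + 1)))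
  | readOld (i j m : ℕ) (p : P) (v : Fin n) (val : ℝ)
      (hop : x.RespondsAt (.read i p v val) j) (hj : x.ev j = some (.returnOld p val))
      (hm : x.LastBetween (.readDesc p) i j m) :
      x.LinPoint eid (.read i p v val) (x.time m)
  | readLive (i j m : ℕ) (p : P) (v : Fin n) (val : ℝ)
      (hop : x.RespondsAt (.read i p v val) j) (hj : x.ev j = some (.returnLive p val))
      (hm : x.LastBetween (.readL2 p) i j m) :
      x.LinPoint eid (.read i p v val) (x.time m)

/-- For every update of an edge whose two endpoints change levels in the batch, both endpoints are
marked when unmarking begins, and, from the first moment of the batch when both are marked until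
unmarking begins, they are in the same DAG. -/
def Execution.SameDAG (x : Execution n P prm) : Prop :=
  ∀ (i s : ℕ) (κ : Kind) (u v : Fin n), x.HasOp (.update i κ s(u, v)) → x.SettlesAt i s →
    x.Changes i s u → x.Changes i s v →
    ((x.cfg s).desc u ≠ none ∧ (x.cfg s).desc v ≠ none) ∧
    ∀ t, i < t → t ≤ s → (x.cfg t).desc u ≠ none → (x.cfg t).desc v ≠ none →
      ∃ r, RootOf (x.cfg t).desc u r ∧ RootOf (x.cfg t).desc v r

/-- Every visible update belongs to exactly one DAG. -/
def Execution.UniqueDAG (x : Execution n P prm) : Prop :=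
  ∀ (i s : ℕ) (κ : Kind) (e : Sym2 (Fin n)), x.HasOp (.update i κ e) → x.SettlesAt i s →
    x.Visible i s e → ∃! r, x.IsRootOfDAG i s e r

end Exec

end CPLDS

end

/-!
Levels that a batch leaves stable are extremal: starting from stable levels, the moves in the
direction of the batch (up for insertions, down for deletions) reach the same levels in any order.
The updates of a batch may therefore be processed sequentially, one edge at a time, in any order.

Moreover the DAGs of a batch do not interact. Let `F` be a set of its edges and `X` a union of its
DAGs such that a visible update lies in `F` exactly if its DAG lies in `X`. The sequential object,
after the updates in `F`, has the new levels on `X` and the old levels elsewhere: along an edge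
between two DAGs, or with an unmarked endpoint, no vertex has ever depended on a move of the other.

Take for `X` the DAGs whose root has been unmarked. A read that finds a marked root has read a
descriptor of a DAG that is not yet in `X`, so the old level is right at that moment. A read that
finds an unmarked vertex during the batch knows that, unless the DAG of its vertex is in `X`, `l₁`
is the old level; so if `l₁ = l₂`, the live level is right at the second read of the level.
-/

namespace CPLDS

/-! ## Rebalancing in one direction -/

namespace Kind

/-- The order in which a batch of kind `κ` moves graphs and levels: the given order for insertions,
the reverse one for deletions. It lets both kinds of batches be treated at once. -/
protected def LE {α : Type*} [LE α] : Kind → α → α → Prop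
  | .insertion, a, b => a ≤ b
  | .deletion, a, b => b ≤ a

end Kind

notation:50 a " ≤[" κ "] " b:51 => Kind.LE κ a b

namespace Kind

section Order

variable {κ : Kind} {α : Type*}

lemma le_refl [Preorder α] (κ : Kind) (a : α) : a ≤[κ] a := by
  cases κ <;> exact _root_.le_refl a

lemma LE.trans [Preorder α] {a b c : α} (hab : a ≤[κ] b) (hbc : b ≤[κ] c) : a ≤[κ] c := by
  cases κ
  · exact _root_.le_trans hab hbc
  · exact _root_.le_trans hbc hab

lemma LE.antisymm [PartialOrder α] {a b : α} (hab : a ≤[κ] b) (hba : b ≤[κ] a) : a = b := by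
  cases κ
  · exact _root_.le_antisymm hab hba
  · exact _root_.le_antisymm hba hab

end Order

lemma le_pi_iff {κ : Kind} {ι : Type*} {L L' : ι → ℕ} : L ≤[κ] L' ↔ ∀ v, L v ≤[κ] L' v := by
  cases κ <;> exact Iff.rfl

/-- The level adjacent to `ℓ` in the direction in which updates of kind `κ` move vertices. -/
def next : Kind → ℕ → ℕ
  | .insertion, ℓ => ℓ + 1
  | .deletion, ℓ => ℓ - 1

lemma le_next (κ : Kind) (ℓ : ℕ) : ℓ ≤[κ] κ.next ℓ := by
  cases κ
  · exact Nat.le_succ ℓ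
  · exact Nat.sub_le ℓ 1

lemma next_le {κ : Kind} {ℓ m : ℕ} (h : ℓ ≤[κ] m) (hne : ℓ ≠ m) : κ.next ℓ ≤[κ] m := by
  cases κ <;> simp only [Kind.LE, next] at * <;> omega

end Kind

section Levels

variable {n : ℕ} {prm : Params} {G G' : SimpleGraph (Fin n)} {L L' L'' M : Fin n → ℕ} {v : Fin n}
  {κ : Kind}

section DegAbove

variable {ℓ ℓ' : ℕ}

lemma degAbove_mono (h : ∀ w, G.Adj v w → ℓ ≤ L w → G'.Adj v w ∧ ℓ' ≤ L' w) :
    degAbove G L v ℓ ≤ degAbove G' L' v ℓ' :=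
  Set.ncard_le_ncard (fun w hw => h w hw.1 hw.2) (Set.toFinite _)

lemma degAbove_update_self {k : ℕ} :
    degAbove G (Function.update L v k) v ℓ = degAbove G L v ℓ := by
  refine congrArg Set.ncard (Set.ext fun w => and_congr_right fun hw => ?_)
  rw [Function.update_of_ne hw.ne']

lemma Params.one_le_one_add_δ (prm : Params) : 1 ≤ 1 + prm.δ :=
  le_add_of_nonneg_right prm.δ_pos.le

lemma Params.pow_group_mono (prm : Params) (h : ℓ ≤ ℓ') :
    (1 + prm.δ) ^ prm.group n ℓ ≤ (1 + prm.δ) ^ prm.group n ℓ' :=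
  pow_le_pow_right₀ prm.one_le_one_add_δ (Nat.div_le_div_right h)

lemma Params.pow_le_upper_bound (prm : Params) (i : ℕ) :
    (1 + prm.δ) ^ i ≤ (2 + 3 / prm.lam) * (1 + prm.δ) ^ i := by
  have hlam : 0 < 3 / prm.lam := div_pos three_pos prm.lam_pos
  have hpow : 0 < (1 + prm.δ) ^ i := zero_lt_one.trans_le (one_le_pow₀ prm.one_le_one_add_δ)
  exact le_mul_of_one_le_left hpow.le (by linarith)

lemma LowerOK.mono (h : ∀ w, G.Adj v w → ℓ - 1 ≤ L w → G'.Adj v w ∧ ℓ - 1 ≤ L' w)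
    (hl : LowerOK prm G L v ℓ) : LowerOK prm G' L' v ℓ := fun hpos =>
  (hl hpos).trans (Nat.cast_le.2 (degAbove_mono h))

lemma LowerOK.of_le (hle : ℓ ≤ ℓ') (hl : LowerOK prm G L v ℓ') : LowerOK prm G L v ℓ := fun hpos =>
  (prm.pow_group_mono (Nat.sub_le_sub_right hle 1)).trans ((hl (hpos.trans_le hle)).trans
    (Nat.cast_le.2 (degAbove_mono fun _ hw h => ⟨hw, (Nat.sub_le_sub_right hle 1).trans h⟩)))

lemma UpperInv.mono (hv : L v = L' v)
    (h : ∀ w, G.Adj v w → L v ≤ L w → G'.Adj v w ∧ L v ≤ L' w) (hu : UpperInv prm G' L' v) :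
    UpperInv prm G L v := by
  unfold UpperInv at *
  rw [← hv] at hu
  exact fun hlt => (Nat.cast_le.2 (degAbove_mono h)).trans (hu hlt)

lemma lt_topLevel_of_not_upperInv (h : ¬ UpperInv prm G L v) : L v < prm.topLevel n :=
  (Classical.not_imp.1 h).1

lemma pos_of_not_lowerInv (h : ¬ LowerInv prm G L v) : 0 < L v :=
  (Classical.not_imp.1 h).1

lemma lowerInv_update_succ_of_not_upperInv (h : ¬ UpperInv prm G L v) :
    LowerInv prm G (Function.update L v (L v + 1)) v := by
  have hdeg := (not_le.1 (Classical.not_imp.1 h).2).le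
  intro _
  simp only [Function.update_self, degAbove_update_self, Nat.add_sub_cancel]
  exact (prm.pow_le_upper_bound _).trans hdeg

lemma upperInv_update_pred_of_not_lowerInv (h : ¬ LowerInv prm G L v) :
    UpperInv prm G (Function.update L v (L v - 1)) v := by
  have hdeg := (not_le.1 (Classical.not_imp.1 h).2).le
  intro _
  simp only [Function.update_self, degAbove_update_self]
  exact hdeg.trans (prm.pow_le_upper_bound _)

end DegAbove

/-- The graph obtained from `G` by the updates of all edges of `F`. -/
def applyEdges (G : SimpleGraph (Fin n)) (κ : Kind) (F : Set (Sym2 (Fin n))) :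
    SimpleGraph (Fin n) :=
  match κ with
  | .insertion => G ⊔ SimpleGraph.fromEdgeSet F
  | .deletion => G.deleteEdges F

section ApplyEdges

variable {F F' : Set (Sym2 (Fin n))} {a b : Fin n}

lemma applyEdges_insertion_adj :
    (applyEdges G .insertion F).Adj a b ↔ G.Adj a b ∨ (s(a, b) ∈ F ∧ a ≠ b) := by
  simp [applyEdges]

lemma applyEdges_deletion_adj :
    (applyEdges G .deletion F).Adj a b ↔ G.Adj a b ∧ s(a, b) ∉ F := by
  simp [applyEdges]

lemma applyEdges_empty (G : SimpleGraph (Fin n)) (κ : Kind) : applyEdges G κ ∅ = G := by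
  cases κ <;> simp [applyEdges]

lemma applyEdge_applyEdges (G : SimpleGraph (Fin n)) (κ : Kind) (F : Set (Sym2 (Fin n)))
    (e : Sym2 (Fin n)) : applyEdge (applyEdges G κ F) κ e = applyEdges G κ (insert e F) := by
  cases κ <;> ext a b <;>
    simp only [applyEdge, SimpleGraph.sup_adj, SimpleGraph.fromEdgeSet_adj,
      SimpleGraph.deleteEdges_adj, applyEdges_insertion_adj, applyEdges_deletion_adj,
      Set.mem_insert_iff, Set.mem_singleton_iff] <;>
    tauto

lemma applyEdges_le_of_subset (G : SimpleGraph (Fin n)) (κ : Kind) (h : F ⊆ F') :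
    applyEdges G κ F ≤[κ] applyEdges G κ F' := by
  cases κ <;> intro a b hab <;>
    simp only [applyEdges_insertion_adj, applyEdges_deletion_adj] at *
  · exact hab.imp_right (And.imp_left (@h _))
  · exact hab.imp_right (mt (@h _))

lemma le_applyEdges (G : SimpleGraph (Fin n)) (κ : Kind) (F : Set (Sym2 (Fin n))) :
    G ≤[κ] applyEdges G κ F := by
  simpa only [applyEdges_empty] using applyEdges_le_of_subset G κ (Set.empty_subset F)

end ApplyEdges

namespace Kind

/-- The invariant that updates of kind `κ` can violate: Invariant 1 for insertions, Invariant 2 for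
deletions. -/
def Inv (κ : Kind) (prm : Params) (G : SimpleGraph (Fin n)) (L : Fin n → ℕ) (v : Fin n) : Prop :=
  match κ with
  | .insertion => UpperInv prm G L v
  | .deletion => LowerInv prm G L v

/-- The invariant that updates of kind `κ` and the moves they cause preserve. -/
def DualInv (κ : Kind) (prm : Params) (G : SimpleGraph (Fin n)) (L : Fin n → ℕ) (v : Fin n) :
    Prop :=
  match κ with
  | .insertion => LowerInv prm G L v
  | .deletion => UpperInv prm G L v

lemma Inv.anti (hG : G ≤[κ] G') (hL : L ≤[κ] L') (hv : L v = L' v) (h : κ.Inv prm G' L' v) :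
    κ.Inv prm G L v := by
  cases κ
  · exact UpperInv.mono hv (fun w hw hl => ⟨hG hw, hl.trans (hL w)⟩) h
  · unfold Inv LowerInv at *
    rw [hv]
    exact LowerOK.mono (fun w hw hl => ⟨hG hw, hl.trans (hL w)⟩) h

lemma DualInv.mono (hG : G ≤[κ] G') (hL : L ≤[κ] L') (hv : L v = L' v)
    (h : κ.DualInv prm G L v) : κ.DualInv prm G' L' v := by
  cases κ
  · unfold DualInv LowerInv at *
    rw [← hv]
    exact LowerOK.mono (fun w hw hl => ⟨hG hw, hl.trans (hL w)⟩) h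
  · exact UpperInv.mono hv.symm (fun w hw hl => ⟨hG hw, hl.trans (hL w)⟩) h

/-- A rebalancing move in the direction of `κ`. -/
def Move (κ : Kind) (prm : Params) (G : SimpleGraph (Fin n)) (L L' : Fin n → ℕ) : Prop :=
  ∃ v, ¬ κ.Inv prm G L v ∧ L' = Function.update L v (κ.next (L v))

/-- `L'` results from `L` by moves in the direction of `κ` and admits no further such move. -/
def Settles (κ : Kind) (prm : Params) (G : SimpleGraph (Fin n)) (L L' : Fin n → ℕ) : Prop :=
  Relation.ReflTransGen (κ.Move prm G) L L' ∧ ∀ v, κ.Inv prm G L' v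

lemma Move.le (h : κ.Move prm G L L') : L ≤[κ] L' := by
  obtain ⟨v, -, rfl⟩ := h
  refine le_pi_iff.2 fun w => ?_
  obtain rfl | hw := eq_or_ne w v
  · simpa using κ.le_next (L w)
  · simpa [hw] using κ.le_refl (L w)

lemma Move.moveStep (h : κ.Move prm G L L') : MoveStep prm G L L' := by
  obtain ⟨v, hv, rfl⟩ := h
  cases κ
  · exact .up L v hv
  · exact .down L v hv

lemma Move.mono (hG : G ≤[κ] G') (h : κ.Move prm G L L') : κ.Move prm G' L L' := by
  obtain ⟨v, hv, rfl⟩ := h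
  exact ⟨v, fun h' => hv (h'.anti hG (κ.le_refl L) rfl), rfl⟩

lemma le_of_moves (h : Relation.ReflTransGen (κ.Move prm G) L L') : L ≤[κ] L' := by
  induction h with
  | refl => exact κ.le_refl L
  | tail _ hmove ih => exact ih.trans hmove.le

lemma Move.dualInv (h : κ.Move prm G L L') (hdual : ∀ v, κ.DualInv prm G L v) (w : Fin n) :
    κ.DualInv prm G L' w := by
  have hle := h.le
  obtain ⟨v, hv, rfl⟩ := h
  obtain rfl | hw := eq_or_ne w v
  · cases κ
    · exact lowerInv_update_succ_of_not_upperInv hv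
    · exact upperInv_update_pred_of_not_lowerInv hv
  · exact (hdual w).mono (κ.le_refl G) hle (by simp [hw])

lemma dualInv_of_moves (h : Relation.ReflTransGen (κ.Move prm G) L L')
    (hdual : ∀ v, κ.DualInv prm G L v) : ∀ v, κ.DualInv prm G L' v := by
  induction h with
  | refl => exact hdual
  | tail _ hmove ih => exact hmove.dualInv ih

lemma le_of_moves_of_inv (h : Relation.ReflTransGen (κ.Move prm G) L L') (hM : L ≤[κ] M)
    (hinv : ∀ v, κ.Inv prm G M v) : L' ≤[κ] M := by
  induction h with
  | refl => exact hM
  | @tail L₁ L₂ _ hmove ih =>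
    obtain ⟨v, hv, rfl⟩ := hmove
    have hne : L₁ v ≠ M v := fun he => hv ((hinv v).anti (κ.le_refl G) ih he)
    refine le_pi_iff.2 fun w => ?_
    obtain rfl | hw := eq_or_ne w v
    · simpa using next_le (le_pi_iff.1 ih w) hne
    · simpa [hw] using le_pi_iff.1 ih w

lemma Settles.unique (h : κ.Settles prm G L L') (h' : κ.Settles prm G L L'') : L' = L'' :=
  (le_of_moves_of_inv h.1 (le_of_moves h'.1) h'.2).antisymm
    (le_of_moves_of_inv h'.1 (le_of_moves h.1) h.2)

lemma Settles.trans (hG : G ≤[κ] G') (h : κ.Settles prm G L L') (h' : κ.Settles prm G' L' L'') :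
    κ.Settles prm G' L L'' :=
  ⟨(Relation.ReflTransGen.mono (fun _ _ => Move.mono hG) _ _ h.1).trans h'.1, h'.2⟩

/-- The number of moves in the direction of `κ` that a vertex on level `ℓ ≤ K` can still make. -/
def movesLeft (κ : Kind) (K ℓ : ℕ) : ℕ :=
  match κ with
  | .insertion => K - ℓ
  | .deletion => ℓ

lemma movesLeft_next_lt (h : ¬ κ.Inv prm G L v) :
    κ.movesLeft (prm.topLevel n) (κ.next (L v)) < κ.movesLeft (prm.topLevel n) (L v) := by
  cases κ
  · exact Nat.sub_succ_lt_self _ _ (lt_topLevel_of_not_upperInv h)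
  · exact Nat.sub_lt (pos_of_not_lowerInv h) one_pos

lemma Move.sum_movesLeft_lt (h : κ.Move prm G L L') :
    ∑ v, κ.movesLeft (prm.topLevel n) (L' v) < ∑ v, κ.movesLeft (prm.topLevel n) (L v) := by
  obtain ⟨v, hv, rfl⟩ := h
  refine Finset.sum_lt_sum (fun w _ => ?_) ⟨v, Finset.mem_univ v, ?_⟩
  · obtain rfl | hw := eq_or_ne w v
    · simpa using (movesLeft_next_lt hv).le
    · simp [hw]
  · simpa using movesLeft_next_lt hv

lemma exists_settles (κ : Kind) (prm : Params) (G : SimpleGraph (Fin n)) (L : Fin n → ℕ) :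
    ∃ L', κ.Settles prm G L L' := by
  induction hm : ∑ v, κ.movesLeft (prm.topLevel n) (L v) using Nat.strong_induction_on
    generalizing L with
  | _ m ih =>
    by_cases hinv : ∀ v, κ.Inv prm G L v
    · exact ⟨L, .refl, hinv⟩
    · obtain ⟨v, hv⟩ := not_forall.1 hinv
      have hmove : κ.Move prm G L (Function.update L v (κ.next (L v))) := ⟨v, hv, rfl⟩
      obtain ⟨L', hsteps, hinv'⟩ := ih _ (hm ▸ hmove.sum_movesLeft_lt) _ rfl
      exact ⟨L', .head hmove hsteps, hinv'⟩

end Kind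

/-- Both invariants hold everywhere. -/
def Stable (prm : Params) (G : SimpleGraph (Fin n)) (L : Fin n → ℕ) : Prop :=
  ∀ v, UpperInv prm G L v ∧ LowerInv prm G L v

lemma stable_iff (κ : Kind) :
    Stable prm G L ↔ (∀ v, κ.Inv prm G L v) ∧ ∀ v, κ.DualInv prm G L v := by
  cases κ
  · exact forall_and
  · simp only [Stable, Kind.Inv, Kind.DualInv, forall_and, and_comm]

lemma Kind.Settles.stable {F : Set (Sym2 (Fin n))} (hG : Stable prm G L)
    (h : κ.Settles prm (applyEdges G κ F) L L') : Stable prm (applyEdges G κ F) L' :=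
  (stable_iff κ).2 ⟨h.2, dualInv_of_moves h.1 fun v =>
    (((stable_iff κ).1 hG).2 v).mono (le_applyEdges G κ F) (κ.le_refl L) rfl⟩

lemma Kind.Settles.exists_rebalance {F : Set (Sym2 (Fin n))} (hG : Stable prm G L)
    (h : κ.Settles prm (applyEdges G κ F) L L') (e : Sym2 (Fin n)) :
    ∃ L'', Rebalance prm (applyEdge (applyEdges G κ F) κ e) L' L'' ∧
      κ.Settles prm (applyEdges G κ (insert e F)) L L'' := by
  obtain ⟨L'', hL''⟩ := κ.exists_settles prm (applyEdges G κ (insert e F)) L'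
  have hsettles := h.trans (applyEdges_le_of_subset G κ (Set.subset_insert e F)) hL''
  refine ⟨L'', ?_, hsettles⟩
  rw [applyEdge_applyEdges]
  exact ⟨Relation.ReflTransGen.mono (fun _ _ => Move.moveStep) _ _ hL''.1, hsettles.stable hG⟩

lemma moves_update_of_not_lowerOK {ℓ : ℕ} (hℓ : ℓ ≤ L v)
    (h : ∀ j, ℓ < j → j ≤ L v → ¬ LowerOK prm G L v j) :
    Relation.ReflTransGen (Kind.deletion.Move prm G) L (Function.update L v ℓ) := by
  induction hℓ using Nat.decreasingInduction with
  | self => rw [Function.update_eq_self]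
  | of_succ ℓ hlt ih =>
    refine (ih fun j hj => h j (by omega)).tail ⟨v, fun hinv => ?_, by simp [Kind.next]⟩
    refine h (ℓ + 1) ℓ.lt_succ_self hlt fun _ => ?_
    simpa [degAbove_update_self] using hinv (by simp)

end Levels

/-! ## The DAGs of marked vertices -/

section DAG

variable {n : ℕ} {D D' : DescArray n} {u v w r x : Fin n} {X : Set (Fin n)}

/-- `X` is a union of DAGs and of unmarked vertices that are no one's parent. -/
def Closed (D : DescArray n) (X : Set (Fin n)) : Prop :=
  ∀ a b, ParentOf D a b → (a ∈ X ↔ b ∈ X)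

/-- `u` and `v` lie in the same DAG, in a form that does not presuppose that roots exist. -/
abbrev Connected (D : DescArray n) : Fin n → Fin n → Prop := Relation.EqvGen (ParentOf D)

lemma Closed.anti (hD : ∀ a b, ParentOf D a b → ParentOf D' a b) (hX : Closed D' X) :
    Closed D X :=
  fun a b hab => hX a b (hD a b hab)

lemma Closed.mem_iff (hX : Closed D X) (h : Connected D u v) : u ∈ X ↔ v ∈ X := by
  induction h with
  | rel _ _ h => exact hX _ _ h
  | refl => rfl
  | symm _ _ _ ih => exact ih.symm
  | trans _ _ _ _ _ ih ih' => exact ih.trans ih'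

lemma ParentOf.unique (h : ParentOf D u v) (h' : ParentOf D u w) : v = w := by
  obtain ⟨d, hd, hp⟩ := h
  obtain ⟨d', hd', hp'⟩ := h'
  obtain rfl : d = d' := Option.some_injective _ (hd.symm.trans hd')
  exact Option.some_injective _ (hp.symm.trans hp')

lemma ParentOf.ne_none (h : ParentOf D u v) : D u ≠ none := by
  obtain ⟨d, hd, -⟩ := h
  simp [hd]

lemma IsRoot.ne_none (h : IsRoot D u) : D u ≠ none := by
  obtain ⟨d, hd, -⟩ := h
  simp [hd]

lemma IsRoot.not_parentOf (h : IsRoot D u) : ¬ ParentOf D u v := by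
  rintro ⟨d, hd, hp⟩
  obtain ⟨d', hd', hp'⟩ := h
  obtain rfl : d = d' := Option.some_injective _ (hd.symm.trans hd')
  simp [hp] at hp'

lemma IsRoot.rootOf (h : IsRoot D u) : RootOf D u u := ⟨.refl, h⟩

lemma RootOf.of_parentOf (h : ParentOf D u v) (hr : RootOf D v r) : RootOf D u r :=
  ⟨.head h hr.1, hr.2⟩

lemma RootOf.parent (h : ParentOf D u v) (hr : RootOf D u r) : RootOf D v r := by
  obtain ⟨hpath, hroot⟩ := hr
  rcases hpath.cases_head with rfl | ⟨w, huw, hwr⟩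
  · exact (hroot.not_parentOf h).elim
  · exact h.unique huw ▸ ⟨hwr, hroot⟩

lemma RootOf.ne_none (h : RootOf D u r) : D u ≠ none := by
  rcases h.1.cases_head with rfl | ⟨w, huw, -⟩
  · exact h.2.ne_none
  · exact huw.ne_none

lemma RootOf.eq_of_isRoot (h : RootOf D u r) (hu : IsRoot D u) : u = r := by
  rcases h.1.cases_head with rfl | ⟨w, huw, -⟩
  · rfl
  · exact (hu.not_parentOf huw).elim

lemma closed_setOf_rootOf (D : DescArray n) (Q : Fin n → Prop) :
    Closed D {v | ∃ r, RootOf D v r ∧ Q r} :=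
  fun _ _ hab => ⟨fun ⟨r, hr, hQ⟩ => ⟨r, hr.parent hab, hQ⟩,
    fun ⟨r, hr, hQ⟩ => ⟨r, hr.of_parentOf hab, hQ⟩⟩

lemma RootOf.connected (h : RootOf D u r) : Connected D u r := by
  obtain ⟨hpath, -⟩ := h
  induction hpath with
  | refl => exact .refl _
  | tail _ h ih => exact ih.trans _ _ _ (.rel _ _ h)

lemma RootOf.of_connected (h : Connected D u v) (hr : RootOf D u r) : RootOf D v r := by
  obtain ⟨_, hr', rfl⟩ :=
    ((closed_setOf_rootOf D (· = r)).mem_iff h).1 ⟨r, hr, rfl⟩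
  exact hr'

lemma RootOf.unique {r' : Fin n} (h : RootOf D u r) (h' : RootOf D u r') : r = r' :=
  (h'.of_connected h.connected).eq_of_isRoot h.2

lemma ParentOf.update (hx : ∀ y, ¬ ParentOf D x y) (d : Option (Desc n)) {a b : Fin n}
    (h : ParentOf D a b) : ParentOf (Function.update D x d) a b := by
  have hne : a ≠ x := by
    rintro rfl
    exact hx b h
  obtain ⟨e, he, hp⟩ := h
  exact ⟨e, by rwa [Function.update_of_ne hne], hp⟩

lemma IsRoot.update_of_ne {d : Option (Desc n)} (h : IsRoot D r) (hne : r ≠ x) :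
    IsRoot (Function.update D x d) r := by
  obtain ⟨e, he, hp⟩ := h
  exact ⟨e, by rwa [Function.update_of_ne hne], hp⟩

/-- Every marked vertex lies in a DAG that has a root, i.e. parents never lead to an unmarked
vertex or around a cycle. -/
def AllRooted (D : DescArray n) : Prop :=
  ∀ v, D v ≠ none → ∃ r, RootOf D v r

lemma AllRooted.update {d : Desc n} (h : AllRooted D) (hx : ∀ y, ¬ ParentOf D x y)
    (hd : ∀ r, d.parent = some r → IsRoot D r ∧ r ≠ x) :
    AllRooted (Function.update D x (some d)) := by
  set D' := Function.update D x (some d) with hD'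
  have hDx : D' x = some d := Function.update_self ..
  have hroot_x : ∃ r, RootOf D' x r := by
    cases hp : d.parent with
    | none => exact ⟨x, .refl, d, hDx, hp⟩
    | some r =>
      obtain ⟨hr, hne⟩ := hd r hp
      exact ⟨r, .single ⟨d, hDx, hp⟩, hr.update_of_ne hne⟩
  intro w hw
  by_cases hwx : w = x
  · exact hwx ▸ hroot_x
  obtain ⟨r, hpath, hr⟩ := h w (by rwa [hD', Function.update_of_ne hwx] at hw)
  have hpath' := Relation.ReflTransGen.mono (fun _ _ hab => hab.update hx (some d)) _ _ hpath
  by_cases hrx : r = x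
  · obtain ⟨r', hr', hroot⟩ := hroot_x
    subst hrx
    exact ⟨r', hpath'.trans hr', hroot⟩
  · exact ⟨r, hpath', hr.update_of_ne hrx⟩

end DAG

/-! ## The invariants of the rounds of a batch -/

section NeedsMove

variable {n : ℕ} {prm : Params} {κ : Kind} {G : SimpleGraph (Fin n)} {L : Fin n → ℕ} {ℓ : ℕ}
  {v w : Fin n}

/-- `Config.NeedsMove` as a condition on the graph and the levels: in round `ℓ` the vertex `v` has
to be moved. -/
def NeedsMove (prm : Params) (G : SimpleGraph (Fin n)) (L : Fin n → ℕ) (ℓ : ℕ) (v : Fin n) :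
    Kind → Prop
  | .insertion => L v = ℓ ∧ ¬ UpperInv prm G L v
  | .deletion => IsDesireLevel prm G L v ℓ

/-- The part of the invariant towards which the batch rebalances that the rounds before `ℓ` have
established at `v`. -/
def SettledUpTo (prm : Params) (G : SimpleGraph (Fin n)) (L : Fin n → ℕ) (ℓ : ℕ) (v : Fin n) :
    Kind → Prop
  | .insertion => L v < ℓ → UpperInv prm G L v
  | .deletion => LowerOK prm G L v (min ℓ (L v))

lemma settledUpTo_zero (prm : Params) (κ : Kind) (G : SimpleGraph (Fin n)) (L : Fin n → ℕ)
    (v : Fin n) : SettledUpTo prm G L 0 v κ := by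
  cases κ
  · exact fun h => absurd h (Nat.not_lt_zero _)
  · exact fun h => absurd h (by simp)

lemma SettledUpTo.succ (h : SettledUpTo prm G L ℓ v κ) (hv : ¬ NeedsMove prm G L ℓ v κ) :
    SettledUpTo prm G L (ℓ + 1) v κ := by
  cases κ with
  | insertion =>
    intro hlt
    rcases Nat.lt_succ_iff_lt_or_eq.1 hlt with hlt | heq
    · exact h hlt
    · by_contra hinv
      exact hv ⟨heq, hinv⟩
  | deletion =>
    simp only [SettledUpTo] at h ⊢
    by_cases hle : L v ≤ ℓ
    · rwa [min_eq_right (by omega)] at h ⊢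
    · rw [min_eq_left (by omega)] at h ⊢
      by_contra hfail
      exact hv ⟨by omega, h, fun j hj _ hok => hfail (hok.of_le hj)⟩

lemma SettledUpTo.inv (h : SettledUpTo prm G L (prm.topLevel n) v κ)
    (hle : L v ≤ prm.topLevel n) : κ.Inv prm G L v := by
  cases κ with
  | insertion => exact fun hlt => h hlt hlt
  | deletion =>
    simp only [SettledUpTo, min_eq_right hle] at h
    exact h

lemma NeedsMove.level_eq (h : NeedsMove prm G L ℓ v .insertion) : L v = ℓ := h.1

lemma NeedsMove.le_update (h : NeedsMove prm G L ℓ v κ) :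
    L ≤[κ] Function.update L v (destination ℓ κ) := by
  cases κ with
  | insertion => exact le_update_self_iff.2 (h.level_eq ▸ Nat.le_succ _)
  | deletion => exact update_le_self_iff.2 h.1.le

lemma NeedsMove.destination_ne {L₀ : Fin n → ℕ} (h : NeedsMove prm G L ℓ v κ)
    (hL : L₀ ≤[κ] L) : destination ℓ κ ≠ L₀ v := by
  cases κ with
  | insertion =>
    have hle : L₀ v ≤ L v := hL v
    have := h.level_eq
    simp only [destination]
    omega
  | deletion =>
    have hle : L v ≤ L₀ v := hL v
    exact (h.1.trans_le hle).ne

lemma NeedsMove.destination_le (h : NeedsMove prm G L ℓ v κ) (hle : L v ≤ prm.topLevel n) :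
    destination ℓ κ ≤ prm.topLevel n := by
  cases κ with
  | insertion => exact h.level_eq ▸ lt_topLevel_of_not_upperInv h.2
  | deletion => exact h.1.le.trans hle

lemma SettledUpTo.update (h : SettledUpTo prm G L ℓ w κ) (hv : NeedsMove prm G L ℓ v κ) :
    SettledUpTo prm G (Function.update L v (destination ℓ κ)) ℓ w κ := by
  cases κ with
  | insertion =>
    obtain rfl := hv.level_eq
    intro hlt
    have hwv : w ≠ v := by
      rintro rfl
      simp [destination] at hlt
    rw [Function.update_of_ne hwv] at hlt
    refine UpperInv.mono (Function.update_of_ne hwv ..) (fun x hx hl => ⟨hx, ?_⟩) (h hlt)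
    rw [Function.update_of_ne hwv] at hl ⊢
    by_cases hxv : x = v
    · exact hxv ▸ hlt.le
    · rwa [Function.update_of_ne hxv] at hl
  | deletion =>
    have hok : ∀ j ≤ ℓ, LowerOK prm G L w j →
        LowerOK prm G (Function.update L v (destination ℓ .deletion)) w j := by
      intro j hj hok
      refine hok.mono fun x hx hl => ⟨hx, ?_⟩
      by_cases hxv : x = v
      · simp only [hxv, Function.update_self, destination]
        omega
      · rwa [Function.update_of_ne hxv]
    simp only [SettledUpTo] at h ⊢
    by_cases hwv : w = v
    · subst hwv
      rw [Function.update_self, destination, min_self]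
      exact hok ℓ le_rfl hv.2.1
    · rw [Function.update_of_ne hwv]
      exact hok _ (min_le_left _ _) h

end NeedsMove

section Rounds

variable {n : ℕ} {prm : Params} {κ : Kind} {B : Set (Sym2 (Fin n))} {G G₀ : SimpleGraph (Fin n)}
  {L₀ L : Fin n → ℕ} {D : DescArray n} {ℓ : ℕ} {u v w : Fin n}

/-- `Config.Related` as a condition on the graph, the levels and the descriptors: when `v` is
marked, its DAG has to be merged with that of `w`. -/
def Related (κ : Kind) (B : Set (Sym2 (Fin n))) (G : SimpleGraph (Fin n)) (L : Fin n → ℕ)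
    (D : DescArray n) (v w : Fin n) : Prop :=
  D w ≠ none ∧ (s(v, w) ∈ B ∨ G.Adj v w ∧ (κ = .insertion → L v ≤ L w))

/-- In an insertion batch, `u` has finished its moves before round `ℓ` below the old level of `v`:
then Invariant 1 at `v` never counted `u`, and Invariant 1 at `u` counted `v` throughout, so that
neither caused a move of the other. -/
def StaysBelow (L₀ L : Fin n → ℕ) (ℓ : ℕ) (u v : Fin n) : Prop :=
  L u < ℓ ∧ L u < L₀ v

/-- The pairs of vertices that, once both are marked, have to be in the same DAG. -/
def Interacts (κ : Kind) (B : Set (Sym2 (Fin n))) (G : SimpleGraph (Fin n)) (L₀ L : Fin n → ℕ)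
    (ℓ : ℕ) (u v : Fin n) : Prop :=
  s(u, v) ∈ B ∨ G.Adj u v ∧ ¬ (κ = .insertion ∧ (StaysBelow L₀ L ℓ u v ∨ StaysBelow L₀ L ℓ v u))

lemma Interacts.symm (h : Interacts κ B G L₀ L ℓ u v) : Interacts κ B G L₀ L ℓ v u := by
  rwa [Interacts, Sym2.eq_swap, G.adj_comm, or_comm (a := StaysBelow L₀ L ℓ v u)]

lemma Interacts.of_succ (h : Interacts κ B G L₀ L (ℓ + 1) u v) : Interacts κ B G L₀ L ℓ u v :=
  h.imp_right fun ⟨hadj, hno⟩ => ⟨hadj, fun ⟨hκ, h⟩ =>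
    hno ⟨hκ, h.imp (And.imp_left Nat.lt_succ_of_lt) (And.imp_left Nat.lt_succ_of_lt)⟩⟩

lemma Interacts.of_update (hx : NeedsMove prm G L ℓ w κ)
    (h : Interacts κ B G L₀ (Function.update L w (destination ℓ κ)) ℓ u v) :
    Interacts κ B G L₀ L ℓ u v := by
  refine h.imp_right fun ⟨hadj, hno⟩ => ⟨hadj, ?_⟩
  rintro ⟨rfl, hstay⟩
  have hlow : ∀ a b, StaysBelow L₀ L ℓ a b →
      StaysBelow L₀ (Function.update L w (destination ℓ .insertion)) ℓ a b := fun a b hab => by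
    have haw : a ≠ w := by
      rintro rfl
      exact hab.1.ne hx.level_eq
    rwa [StaysBelow, Function.update_of_ne haw]
  exact hno ⟨rfl, hstay.imp (hlow u v) (hlow v u)⟩

/-- What the descriptors say in round `ℓ` of a batch of kind `κ` with edges `B` that started with
the levels `L₀`. -/
structure MarkingInv (κ : Kind) (B : Set (Sym2 (Fin n))) (G : SimpleGraph (Fin n))
    (L₀ L : Fin n → ℕ) (D : DescArray n) (ℓ : ℕ) : Prop where
  unmarked : ∀ v, D v = none → L v = L₀ v
  old : ∀ v d, D v = some d → d.oldLevel = L₀ v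
  rooted : AllRooted D
  joined : ∀ u v, D u ≠ none → D v ≠ none → Interacts κ B G L₀ L ℓ u v → Connected D u v

lemma MarkingInv.marked (h : MarkingInv κ B G L₀ L D ℓ) (hv : L v ≠ L₀ v) : D v ≠ none :=
  fun hn => hv (h.unmarked v hn)

lemma MarkingInv.not_interacts (h : MarkingInv κ B G L₀ L D ℓ) {X : Set (Fin n)} (hX : Closed D X)
    (hu : D u ≠ none) (hv : D v ≠ none) (hne : ¬ (u ∈ X ↔ v ∈ X)) :
    ¬ Interacts κ B G L₀ L ℓ u v :=
  fun hint => hne (hX.mem_iff (h.joined u v hu hv hint))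

lemma MarkingInv.start (κ : Kind) (B : Set (Sym2 (Fin n))) (G : SimpleGraph (Fin n))
    (L₀ : Fin n → ℕ) : MarkingInv κ B G L₀ L₀ (fun _ => none) 0 where
  unmarked _ _ := rfl
  old _ _ h := nomatch h
  rooted _ h := absurd rfl h
  joined _ _ h := absurd rfl h

lemma MarkingInv.succ (h : MarkingInv κ B G L₀ L D ℓ) : MarkingInv κ B G L₀ L D (ℓ + 1) :=
  { h with joined := fun u v hu hv hint => h.joined u v hu hv hint.of_succ }

lemma MarkingInv.move (h : MarkingInv κ B G L₀ L D ℓ) (hv : NeedsMove prm G L ℓ v κ)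
    (hD : D v ≠ none) : MarkingInv κ B G L₀ (Function.update L v (destination ℓ κ)) D ℓ where
  unmarked w hw := by
    have hwv : w ≠ v := by
      rintro rfl
      exact hD hw
    rw [Function.update_of_ne hwv, h.unmarked w hw]
  old := h.old
  rooted := h.rooted
  joined u w hu hw hint := h.joined u w hu hw (hint.of_update hv)

lemma MarkingInv.update (h : MarkingInv κ B G L₀ L D ℓ) {x : Fin n} {d : Desc n}
    (hx : ∀ y, ¬ ParentOf D x y) (hd : ∀ r, d.parent = some r → IsRoot D r ∧ r ≠ x)
    (hold : d.oldLevel = L₀ x)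
    (hjoin : ∀ w, D w ≠ none → Interacts κ B G L₀ L ℓ x w →
      Connected (Function.update D x (some d)) x w) :
    MarkingInv κ B G L₀ L (Function.update D x (some d)) ℓ where
  unmarked w hw := by
    refine h.unmarked w ?_
    rcases eq_or_ne w x with rfl | hwx
    · simp at hw
    · rwa [Function.update_of_ne hwx] at hw
  old w e he := by
    rcases eq_or_ne w x with rfl | hwx
    · rw [Function.update_self, Option.some_inj] at he
      exact he ▸ hold
    · exact h.old w e (by rwa [Function.update_of_ne hwx] at he)
  rooted := h.rooted.update hx hd
  joined u w hu hw hint := by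
    rcases eq_or_ne u x with rfl | hux <;> rcases eq_or_ne w u with rfl | hwu
    · exact .refl _
    · exact hjoin w (by rwa [Function.update_of_ne hwu] at hw) hint
    · exact .refl _
    · rw [Function.update_of_ne hux] at hu
      rcases eq_or_ne w x with rfl | hwx
      · exact (hjoin u hu hint.symm).symm
      · rw [Function.update_of_ne hwx] at hw
        exact (h.joined u w hu hw hint).mono fun _ _ hab => hab.update hx _

/-- The invariant of a marking procedure in round `ℓ`: the DAGs related to the vertex are those
below the new root and the roots that still have to be linked. -/
structure TaskInv (κ : Kind) (B : Set (Sym2 (Fin n))) (G : SimpleGraph (Fin n)) (L : Fin n → ℕ)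
    (D : DescArray n) (ℓ : ℕ) (T : MarkTask n) : Prop where
  unmarked : D T.vertex = none
  level : κ = .insertion → L T.vertex = ℓ
  toLink_isRoot : ∀ x ∈ T.toLink, IsRoot D x
  newRoot_isRoot : ∀ r, T.newRoot = some r → IsRoot D r ∧ r ∉ T.toLink
  cover : ∀ w, Related κ B G L D T.vertex w →
    ∃ r, (T.newRoot = some r ∨ r ∈ T.toLink) ∧ Connected D w r

lemma NeedsMove.taskInv_newDAG (hv : NeedsMove prm G L ℓ v κ) (hD : D v = none)
    (hR : ∀ w, ¬ Related κ B G L D v w) : TaskInv κ B G L D ℓ ⟨v, ∅, none⟩ where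
  unmarked := hD
  level := by rintro rfl; exact hv.level_eq
  toLink_isRoot _ h := absurd h (Finset.notMem_empty _)
  newRoot_isRoot _ h := nomatch h
  cover w hw := (hR w hw).elim

lemma NeedsMove.taskInv_merge (hv : NeedsMove prm G L ℓ v κ) (hD : D v = none)
    (hrooted : AllRooted D) {R : Finset (Fin n)}
    (hR : ∀ r, r ∈ R ↔ ∃ w, Related κ B G L D v w ∧ RootOf D w r) {r₀ : Fin n} (hr₀ : r₀ ∈ R) :
    TaskInv κ B G L D ℓ ⟨v, R.erase r₀, some r₀⟩ := by
  have hroot : ∀ r ∈ R, IsRoot D r := fun r hr => by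
    obtain ⟨w, -, hw⟩ := (hR r).1 hr
    exact hw.2
  refine ⟨hD, by rintro rfl; exact hv.level_eq, fun x hx => hroot x (Finset.mem_of_mem_erase hx),
    ?_, fun w hw => ?_⟩
  · rintro _ ⟨⟩
    exact ⟨hroot _ hr₀, Finset.notMem_erase _ _⟩
  · obtain ⟨r, hr⟩ := hrooted w hw.1
    refine ⟨r, ?_, hr.connected⟩
    rcases eq_or_ne r r₀ with rfl | hne
    · exact .inl rfl
    · exact .inr (Finset.mem_erase.2 ⟨hne, (hR r).2 ⟨w, hw, hr⟩⟩)

lemma TaskInv.move {T : MarkTask n} (h : TaskInv κ B G L D ℓ T) (hv : NeedsMove prm G L ℓ v κ)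
    (hD : D v ≠ none) : TaskInv κ B G (Function.update L v (destination ℓ κ)) D ℓ T := by
  have hne : T.vertex ≠ v := fun heq => hD (heq ▸ h.unmarked)
  refine { h with level := fun hκ => by rw [Function.update_of_ne hne, h.level hκ],
                  cover := fun w hw => h.cover w (hw.imp_right (Or.imp_right ?_)) }
  rintro ⟨hadj, hle⟩
  refine ⟨hadj, ?_⟩
  rintro rfl
  have hle := hle rfl
  rcases eq_or_ne w v with rfl | hwv
  · exact (h.level rfl).trans_le hv.level_eq.ge
  · rwa [Function.update_of_ne hne, Function.update_of_ne hwv] at hle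

lemma TaskInv.link {r₀ x : Fin n} {R : Finset (Fin n)} {d : Desc n}
    (h : TaskInv κ B G L D ℓ ⟨v, R, some r₀⟩) (hx : x ∈ R) (hd : d.parent = some r₀) :
    TaskInv κ B G L (Function.update D x (some d)) ℓ ⟨v, R.erase x, some r₀⟩ := by
  have hxroot := h.toLink_isRoot x hx
  obtain ⟨hr₀, hr₀R⟩ := h.newRoot_isRoot r₀ rfl
  have hxv : v ≠ x := fun heq => hxroot.ne_none (heq ▸ h.unmarked)
  have hxr₀ : Connected (Function.update D x (some d)) x r₀ :=
    .rel _ _ ⟨d, Function.update_self .., hd⟩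
  refine ⟨(Function.update_of_ne hxv ..).trans h.unmarked, h.level, fun y hy => ?_, ?_, ?_⟩
  · exact (h.toLink_isRoot y (Finset.mem_of_mem_erase hy)).update_of_ne (Finset.ne_of_mem_erase hy)
  · rintro _ ⟨⟩
    exact ⟨hr₀.update_of_ne fun heq => hr₀R (heq ▸ hx), fun hr => hr₀R (Finset.mem_of_mem_erase hr)⟩
  · rintro w ⟨hw, hrel⟩
    have hwD : D w ≠ none := by
      rcases eq_or_ne w x with rfl | hwx
      · exact hxroot.ne_none
      · rwa [Function.update_of_ne hwx] at hw
    obtain ⟨r, hr, hwr⟩ := h.cover w ⟨hwD, hrel⟩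
    have hwr := hwr.mono fun _ _ hab => hab.update (fun _ => hxroot.not_parentOf) (some d)
    rcases hr with hr | hr
    · exact ⟨r, .inl hr, hwr⟩
    · rcases eq_or_ne r x with rfl | hrx
      · exact ⟨r₀, .inl rfl, hwr.trans _ _ _ hxr₀⟩
      · exact ⟨r, .inr (Finset.mem_erase.2 ⟨hrx, hr⟩), hwr⟩

lemma MarkingInv.link (h : MarkingInv κ B G L₀ L D ℓ) {r₀ x : Fin n} {R : Finset (Fin n)}
    {d : Desc n} (hT : TaskInv κ B G L D ℓ ⟨v, R, some r₀⟩) (hx : x ∈ R) (hd : D x = some d) :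
    MarkingInv κ B G L₀ L (Function.update D x (some ⟨d.oldLevel, some r₀⟩)) ℓ := by
  have hxroot := hT.toLink_isRoot x hx
  obtain ⟨hr₀, hr₀R⟩ := hT.newRoot_isRoot r₀ rfl
  refine h.update (fun _ => hxroot.not_parentOf) ?_ (h.old x d hd) fun w hw hint => ?_
  · rintro _ ⟨⟩
    exact ⟨hr₀, fun heq => hr₀R (heq ▸ hx)⟩
  · exact (h.joined x w hxroot.ne_none hw hint).mono
      fun _ _ hab => hab.update (fun _ => hxroot.not_parentOf) _

lemma MarkingInv.publish (h : MarkingInv κ B G L₀ L D ℓ) {r₀ : Option (Fin n)}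
    (hT : TaskInv κ B G L D ℓ ⟨v, ∅, r₀⟩) :
    MarkingInv κ B G L₀ L (Function.update D v (some ⟨L v, r₀⟩)) ℓ := by
  have hv : D v = none := hT.unmarked
  have hpar : ∀ y, ¬ ParentOf D v y := fun y hy => hy.ne_none hv
  have hroot : ∀ r, r₀ = some r → IsRoot D r := fun r hr => (hT.newRoot_isRoot r hr).1
  have hold := h.unmarked v hv
  refine h.update hpar (fun r hr => ⟨hroot r hr, fun heq => (hroot r hr).ne_none (heq ▸ hv)⟩) hold
    fun w hw hint => ?_
  have hrel : Related κ B G L D v w := by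
    refine ⟨hw, hint.imp_right fun ⟨hadj, hno⟩ => ⟨hadj, fun hκ => ?_⟩⟩
    have hvℓ : L v = ℓ := hT.level hκ
    by_contra hlt
    exact hno ⟨hκ, .inr ⟨by omega, by omega⟩⟩
  obtain ⟨r, hr, hwr⟩ := hT.cover w hrel
  obtain rfl : r₀ = some r := by simpa using hr
  exact .trans _ _ _ (.rel _ _ ⟨_, Function.update_self .., rfl⟩)
    (hwr.mono fun _ _ hab => hab.update hpar _).symm

lemma piecewise_update_of_mem {X : Set (Fin n)} [∀ i, Decidable (i ∈ X)] {k : ℕ} (hv : v ∈ X) :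
    X.piecewise (Function.update L v k) L₀ = Function.update (X.piecewise L L₀) v k := by
  funext w
  rcases eq_or_ne w v with rfl | hwv
  · simp [hv]
  · by_cases hw : w ∈ X <;> simp [hw, hwv]

lemma piecewise_update_of_notMem {X : Set (Fin n)} [∀ i, Decidable (i ∈ X)] {k : ℕ} (hv : v ∉ X) :
    X.piecewise (Function.update L v k) L₀ = X.piecewise L L₀ := by
  funext w
  by_cases hw : w ∈ X
  · have hwv : w ≠ v := fun heq => hv (heq ▸ hw)
    simp [hw, hwv]
  · simp [hw]

lemma piecewise_eq_of_eq {X : Set (Fin n)} [∀ i, Decidable (i ∈ X)] (h : L v = L₀ v) :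
    X.piecewise L L₀ v = L v := by
  by_cases hv : v ∈ X <;> simp [hv, h]

lemma piecewise_le {X : Set (Fin n)} [∀ i, Decidable (i ∈ X)] (h : L₀ ≤[κ] L) :
    X.piecewise L L₀ ≤[κ] L := by
  refine Kind.le_pi_iff.2 fun w => ?_
  by_cases hw : w ∈ X
  · simpa [hw] using κ.le_refl _
  · simpa [hw] using Kind.le_pi_iff.1 h w

/-- Going from `L₀` to `L` only on `X` is possible by legal rebalancing moves as soon as the batch
edges at the changed vertices of `X` are updated, whatever other batch edges are updated. -/
def ReachableOn (prm : Params) (κ : Kind) (B : Set (Sym2 (Fin n))) (G₀ : SimpleGraph (Fin n))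
    (L₀ L : Fin n → ℕ) (X : Set (Fin n)) [∀ i, Decidable (i ∈ X)] : Prop :=
  ∀ F ⊆ B, (∀ e ∈ B, ∀ v ∈ e, v ∈ X → L v ≠ L₀ v → e ∈ F) →
    Relation.ReflTransGen (κ.Move prm (applyEdges G₀ κ F)) L₀ (X.piecewise L L₀)

lemma MarkingInv.piecewise_eq_of_adj (h : MarkingInv κ B (applyEdges G₀ κ B) L₀ L D ℓ)
    {X : Set (Fin n)} [∀ i, Decidable (i ∈ X)] (hX : Closed D X)
    (hv : NeedsMove prm (applyEdges G₀ κ B) L ℓ v κ) (hD : D v ≠ none) (hvX : v ∈ X)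
    (hadj : (applyEdges G₀ κ B).Adj v w) (hle : κ = .insertion → L v ≤ L w) :
    X.piecewise L L₀ w = L w := by
  by_cases hwX : w ∈ X
  · exact Set.piecewise_eq_of_mem X L L₀ hwX
  refine piecewise_eq_of_eq (of_not_not fun hne => ?_)
  refine h.not_interacts hX hD (h.marked hne) (by simp [hvX, hwX]) (.inr ⟨hadj, ?_⟩)
  rintro ⟨rfl, hstay | hstay⟩
  · exact hstay.1.ne hv.level_eq
  · exact (hstay.1.trans_le (hv.level_eq.ge.trans (hle rfl))).false

lemma MarkingInv.moves_piecewise (h : MarkingInv κ B (applyEdges G₀ κ B) L₀ L D ℓ)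
    {X : Set (Fin n)} [∀ i, Decidable (i ∈ X)] (hX : Closed D X)
    (hv : NeedsMove prm (applyEdges G₀ κ B) L ℓ v κ) (hD : D v ≠ none) (hvX : v ∈ X)
    {F : Set (Sym2 (Fin n))} (hF : ∀ w, s(v, w) ∈ B → s(v, w) ∈ F) :
    Relation.ReflTransGen (κ.Move prm (applyEdges G₀ κ F)) (X.piecewise L L₀)
      (Function.update (X.piecewise L L₀) v (destination ℓ κ)) := by
  have hpv : X.piecewise L L₀ v = L v := Set.piecewise_eq_of_mem X L L₀ hvX
  cases κ with
  | insertion =>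
    have hvℓ := hv.level_eq
    refine .single ⟨v, fun hinv => hv.2 (UpperInv.mono hpv.symm (fun w hadj hl => ?_) hinv), ?_⟩
    · rw [h.piecewise_eq_of_adj hX hv hD hvX hadj fun _ => hl]
      rw [applyEdges_insertion_adj] at hadj ⊢
      exact ⟨hadj.imp_right (And.imp_left (hF w)), hl⟩
    · rw [hpv, hvℓ]
      rfl
  | deletion =>
    refine moves_update_of_not_lowerOK (hpv ▸ hv.1.le) fun j hj hjv hok => ?_
    refine hv.2.2 j hj (hpv ▸ hjv) (hok.mono fun w hadj hl => ?_)
    have hadj' : (applyEdges G₀ .deletion B).Adj v w := by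
      rw [applyEdges_deletion_adj] at hadj ⊢
      exact hadj.imp_right fun hw hB => hw (hF w hB)
    exact ⟨hadj', h.piecewise_eq_of_adj hX hv hD hvX hadj' (by simp) ▸ hl⟩

lemma ReachableOn.move {X : Set (Fin n)} [∀ i, Decidable (i ∈ X)]
    (h : ReachableOn prm κ B G₀ L₀ L X) (hX : Closed D X)
    (hM : MarkingInv κ B (applyEdges G₀ κ B) L₀ L D ℓ) (hL : L₀ ≤[κ] L)
    (hv : NeedsMove prm (applyEdges G₀ κ B) L ℓ v κ) (hD : D v ≠ none) :
    ReachableOn prm κ B G₀ L₀ (Function.update L v (destination ℓ κ)) X := by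
  intro F hF hXF
  have hreach : Relation.ReflTransGen (κ.Move prm (applyEdges G₀ κ F)) L₀ (X.piecewise L L₀) := by
    refine h F hF fun e he w hw hwX hne => hXF e he w hw hwX ?_
    rcases eq_or_ne w v with rfl | hwv
    · rw [Function.update_self]
      exact hv.destination_ne hL
    · rwa [Function.update_of_ne hwv]
  by_cases hvX : v ∈ X
  · rw [piecewise_update_of_mem hvX]
    refine hreach.trans (hM.moves_piecewise hX hv hD hvX fun w hw => ?_)
    refine hXF _ hw v (Sym2.mem_mk_left v w) hvX ?_
    rw [Function.update_self]
    exact hv.destination_ne hL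
  · rwa [piecewise_update_of_notMem hvX]

open Classical in
/-- The invariant of round `ℓ` of a batch that started with the graph `G₀` and the levels `L₀`. -/
structure RoundInv (prm : Params) (κ : Kind) (B : Set (Sym2 (Fin n))) (G₀ : SimpleGraph (Fin n))
    (L₀ L : Fin n → ℕ) (D : DescArray n) (ℓ : ℕ) : Prop where
  marking : MarkingInv κ B (applyEdges G₀ κ B) L₀ L D ℓ
  le_topLevel : ∀ v, L v ≤ prm.topLevel n
  le : L₀ ≤[κ] L
  settled : ∀ v, SettledUpTo prm (applyEdges G₀ κ B) L ℓ v κ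
  reachable : ∀ X, Closed D X → ReachableOn prm κ B G₀ L₀ L X

open Classical in
lemma RoundInv.start (κ : Kind) (B : Set (Sym2 (Fin n))) (G₀ : SimpleGraph (Fin n))
    (hL₀ : ∀ v, L₀ v ≤ prm.topLevel n) :
    RoundInv prm κ B G₀ L₀ L₀ (fun _ => none) 0 where
  marking := .start ..
  le_topLevel := hL₀
  le := κ.le_refl L₀
  settled := settledUpTo_zero prm κ _ L₀
  reachable X _ F _ _ := by rw [Set.piecewise_same]

lemma RoundInv.succ (h : RoundInv prm κ B G₀ L₀ L D ℓ)
    (hdone : ∀ v, ¬ NeedsMove prm (applyEdges G₀ κ B) L ℓ v κ) :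
    RoundInv prm κ B G₀ L₀ L D (ℓ + 1) :=
  { h with
    marking := h.marking.succ
    settled := fun v => (h.settled v).succ (hdone v) }

open Classical in
lemma RoundInv.move (h : RoundInv prm κ B G₀ L₀ L D ℓ)
    (hv : NeedsMove prm (applyEdges G₀ κ B) L ℓ v κ) (hD : D v ≠ none) :
    RoundInv prm κ B G₀ L₀ (Function.update L v (destination ℓ κ)) D ℓ where
  marking := h.marking.move hv hD
  le_topLevel w := by
    rcases eq_or_ne w v with rfl | hwv
    · rw [Function.update_self]
      exact hv.destination_le (h.le_topLevel w)
    · rw [Function.update_of_ne hwv]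
      exact h.le_topLevel w
  le := h.le.trans hv.le_update
  settled w := (h.settled w).update hv
  reachable X hX := (h.reachable X hX).move hX h.marking h.le hv hD

lemma RoundInv.link (h : RoundInv prm κ B G₀ L₀ L D ℓ) {r₀ x : Fin n} {R : Finset (Fin n)}
    {d : Desc n} (hT : TaskInv κ B (applyEdges G₀ κ B) L D ℓ ⟨v, R, some r₀⟩) (hx : x ∈ R)
    (hd : D x = some d) :
    RoundInv prm κ B G₀ L₀ L (Function.update D x (some ⟨d.oldLevel, some r₀⟩)) ℓ :=
  { h with
    marking := h.marking.link hT hx hd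
    reachable := fun X hX => h.reachable X
      (hX.anti fun _ _ hab => hab.update (fun _ => (hT.toLink_isRoot x hx).not_parentOf) _) }

lemma RoundInv.publish (h : RoundInv prm κ B G₀ L₀ L D ℓ) {r₀ : Option (Fin n)}
    (hT : TaskInv κ B (applyEdges G₀ κ B) L D ℓ ⟨v, ∅, r₀⟩) :
    RoundInv prm κ B G₀ L₀ L (Function.update D v (some ⟨L v, r₀⟩)) ℓ :=
  { h with
    marking := h.marking.publish hT
    reachable := fun X hX => h.reachable X
      (hX.anti fun _ _ hab => hab.update (fun _ hy => hy.ne_none hT.unmarked) _) }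

lemma MarkingInv.inv_piecewise_of_notMem (h : MarkingInv κ B (applyEdges G₀ κ B) L₀ L D ℓ)
    (hL : L₀ ≤[κ] L) (h₀ : κ.Inv prm G₀ L₀ v) {X : Set (Fin n)} [∀ i, Decidable (i ∈ X)]
    (hX : Closed D X) {F : Set (Sym2 (Fin n))} (hvX : v ∉ X) (hv : L v ≠ L₀ v)
    (hvF : ∀ w, s(v, w) ∉ F) : κ.Inv prm (applyEdges G₀ κ F) (X.piecewise L L₀) v := by
  have hpv : X.piecewise L L₀ v = L₀ v := Set.piecewise_eq_of_notMem X L L₀ hvX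
  have hno : ∀ w, w ∈ X → L w ≠ L₀ w → ¬ Interacts κ B (applyEdges G₀ κ B) L₀ L ℓ v w :=
    fun w hwX hw => h.not_interacts hX (h.marked hv) (h.marked hw) (by simp [hvX, hwX])
  cases κ with
  | insertion =>
    refine UpperInv.mono hpv (fun w hadj hl => ?_) h₀
    rw [hpv] at hl ⊢
    have hadj₀ : G₀.Adj v w := by
      rw [applyEdges_insertion_adj] at hadj
      exact hadj.resolve_right fun hw => hvF w hw.1
    refine ⟨hadj₀, ?_⟩
    by_cases hwX : w ∈ X
    · rw [Set.piecewise_eq_of_mem X L L₀ hwX] at hl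
      by_contra hlt
      refine hno w hwX (by omega) (.inr ⟨applyEdges_insertion_adj.2 (.inl hadj₀), ?_⟩)
      have hle : L₀ v ≤ L v := hL v
      rintro ⟨-, hstay | hstay⟩
      · exact hlt (hle.trans hstay.2.le)
      · exact (hl.trans_lt hstay.2).false
    · rwa [Set.piecewise_eq_of_notMem X L L₀ hwX] at hl
  | deletion =>
    unfold Kind.Inv LowerInv at *
    rw [hpv]
    refine h₀.mono fun w hadj hl => ⟨applyEdges_deletion_adj.2 ⟨hadj, hvF w⟩, ?_⟩
    have hpw : X.piecewise L L₀ w = L₀ w := by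
      by_cases hwX : w ∈ X
      · by_contra hne
        rw [Set.piecewise_eq_of_mem X L L₀ hwX] at hne
        by_cases hB : s(v, w) ∈ B
        · exact hno w hwX hne (.inl hB)
        · exact hno w hwX hne (.inr ⟨applyEdges_deletion_adj.2 ⟨hadj, hB⟩, by simp⟩)
      · exact Set.piecewise_eq_of_notMem X L L₀ hwX
    rwa [hpw]

lemma RoundInv.settles_piecewise (h : RoundInv prm κ B G₀ L₀ L D (prm.topLevel n))
    (h₀ : Stable prm G₀ L₀) {X : Set (Fin n)} [∀ i, Decidable (i ∈ X)] (hX : Closed D X)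
    {F : Set (Sym2 (Fin n))} (hF : F ⊆ B)
    (hXF : ∀ e ∈ B, ∀ v ∈ e, L v ≠ L₀ v → (v ∈ X ↔ e ∈ F)) :
    κ.Settles prm (applyEdges G₀ κ F) L₀ (X.piecewise L L₀) := by
  refine ⟨?_, fun v => ?_⟩
  · convert h.reachable X hX F hF fun e he v hv hvX hne => (hXF e he v hv hne).1 hvX
  by_cases hv : X.piecewise L L₀ v = L v
  · exact ((h.settled v).inv (h.le_topLevel v)).anti (applyEdges_le_of_subset G₀ κ hF)
      (piecewise_le h.le) hv
  · have hvX : v ∉ X := fun hvX => hv (Set.piecewise_eq_of_mem X L L₀ hvX)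
    have hne : L v ≠ L₀ v := fun heq => hv (piecewise_eq_of_eq heq)
    exact h.marking.inv_piecewise_of_notMem h.le (((stable_iff κ).1 h₀).1 v) hX hvX hne fun w hw =>
      hvX ((hXF _ (hF hw) v (Sym2.mem_mk_left v w) hne).2 hw)

lemma RoundInv.settles (h : RoundInv prm κ B G₀ L₀ L D (prm.topLevel n)) (h₀ : Stable prm G₀ L₀) :
    κ.Settles prm (applyEdges G₀ κ B) L₀ L := by
  simpa using h.settles_piecewise h₀ (X := Set.univ) (fun _ _ _ => Iff.rfl) subset_rfl
    fun e he _ _ _ => by simpa using he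

end Rounds

/-! ## Histories of batches -/

section Unmarking

variable {n : ℕ} {D D' : DescArray n} {U : Set (Fin n)} {r v : Fin n}

/-- `D'` results from the descriptors `D` of a finished batch by an unmarking in progress that has
unmarked the roots of `U`: no other vertex is unmarked before the root of its DAG. -/
structure Unmarking (D D' : DescArray n) (U : Set (Fin n)) : Prop where
  desc : ∀ v, D' v = D v ∨ D' v = none ∧ ∃ r, RootOf D v r ∧ D' r = none
  mem_of_root : ∀ r, IsRoot D r → D' r = none → r ∈ U
  eq_none : ∀ r ∈ U, D' r = none

lemma Unmarking.refl (D : DescArray n) : Unmarking D D ∅ where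
  desc _ := .inl rfl
  mem_of_root _ hr hn := (hr.ne_none hn).elim
  eq_none _ hr := hr.elim

lemma Unmarking.eq_of_ne_none (h : Unmarking D D' U) (hv : D' v ≠ none) : D' v = D v :=
  (h.desc v).resolve_right fun hn => hv hn.1

lemma Unmarking.isRoot (h : Unmarking D D' U) (hr : IsRoot D' r) : IsRoot D r := by
  rwa [IsRoot, ← h.eq_of_ne_none hr.ne_none]

lemma update_none_eq_none (v : Fin n) (hr : D r = none) : Function.update D v none r = none := by
  rcases eq_or_ne r v with rfl | hrv
  · exact Function.update_self ..
  · rwa [Function.update_of_ne hrv]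

lemma Unmarking.desc_update (h : Unmarking D D' U)
    (hv : ∃ r, RootOf D v r ∧ Function.update D' v none r = none) (w : Fin n) :
    Function.update D' v none w = D w ∨
      Function.update D' v none w = none ∧
        ∃ r, RootOf D w r ∧ Function.update D' v none r = none := by
  rcases eq_or_ne w v with rfl | hwv
  · exact .inr ⟨Function.update_self .., hv⟩
  · rw [Function.update_of_ne hwv]
    exact (h.desc w).imp_right fun ⟨hw, r, hr, hn⟩ => ⟨hw, r, hr, update_none_eq_none v hn⟩

lemma Unmarking.unmarkRoot (h : Unmarking D D' U) (hr : IsRoot D r) :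
    Unmarking D (Function.update D' r none) (insert r U) where
  desc := h.desc_update ⟨r, hr.rootOf, Function.update_self ..⟩
  mem_of_root q hq hn := by
    rcases eq_or_ne q r with rfl | hqr
    · exact Set.mem_insert ..
    · exact .inr (h.mem_of_root q hq (by rwa [Function.update_of_ne hqr] at hn))
  eq_none q hq := by
    rcases hq with rfl | hq
    · exact Function.update_self ..
    · exact update_none_eq_none r (h.eq_none q hq)

lemma Unmarking.unmarkOther (h : Unmarking D D' U) (hroots : ∀ r, IsRoot D r → D' r = none)
    (hD : AllRooted D) (hv : D' v ≠ none) : Unmarking D (Function.update D' v none) U where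
  desc := by
    obtain ⟨r, hr⟩ := hD v (h.eq_of_ne_none hv ▸ hv)
    exact h.desc_update ⟨r, hr, update_none_eq_none v (hroots r hr.2)⟩
  mem_of_root q hq _ := h.mem_of_root q hq (hroots q hq)
  eq_none q hq := update_none_eq_none v (h.eq_none q hq)

end Unmarking

section Steps

variable {n : ℕ} {P : Type*} {prm : Params} {κ : Kind} {B : Finset (Sym2 (Fin n))}
  {c c' : Config n P} {a : Event n P} {v w : Fin n} {ℓ ℓ' : ℕ} {T T' : Option (MarkTask n)}

lemma Config.needsMove_iff : c.NeedsMove prm ℓ v κ ↔ CPLDS.NeedsMove prm c.G c.level ℓ v κ := by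
  cases κ <;> rfl

lemma Config.related_iff : c.Related B v w κ ↔ CPLDS.Related κ B c.G c.level c.desc v w := by
  cases κ <;> simp [Config.Related, CPLDS.Related]

/-- The invariant of a configuration in round `ℓ` of a batch of kind `κ` with edges `B` that started
with the graph `G₀` and the levels `L₀`. -/
structure Config.RebalancingInv (prm : Params) (c : Config n P) (κ : Kind)
    (B : Finset (Sym2 (Fin n))) (G₀ : SimpleGraph (Fin n)) (L₀ : Fin n → ℕ) (ℓ : ℕ)
    (task : Option (MarkTask n)) : Prop where
  graph : c.G = applyEdges G₀ κ B
  round : RoundInv prm κ B G₀ L₀ c.level c.desc ℓ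
  task : ∀ T, task = some T → TaskInv κ B (applyEdges G₀ κ B) c.level c.desc ℓ T

lemma UpdateStep.rebalancingInv {G₀ : SimpleGraph (Fin n)} {L₀ : Fin n → ℕ}
    (hs : UpdateStep prm c a c') (hp : c.phase = .rebalancing κ B ℓ T)
    (hp' : c'.phase = .rebalancing κ B ℓ' T') (h : c.RebalancingInv prm κ B G₀ L₀ ℓ T) :
    c'.RebalancingInv prm κ B G₀ L₀ ℓ' T' := by
  cases hs with
  | markNewDAG κ B ℓ v hph hv hunm hR =>
    cases hph.symm.trans hp
    cases hp'
    rw [Config.needsMove_iff, h.graph] at hv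
    simp only [Config.related_iff, h.graph] at hR
    exact ⟨h.graph, h.round, by rintro _ ⟨⟩; exact hv.taskInv_newDAG hunm hR⟩
  | markMerge κ B ℓ v hph hv hunm R hR r₀ hr₀ =>
    cases hph.symm.trans hp
    cases hp'
    rw [Config.needsMove_iff, h.graph] at hv
    simp only [Config.related_iff, h.graph] at hR
    refine ⟨h.graph, h.round, ?_⟩
    rintro _ ⟨⟩
    exact hv.taskInv_merge hunm h.round.marking.rooted hR hr₀
  | link κ B ℓ v r₀ y todo d hph hy hd =>
    cases hph.symm.trans hp
    cases hp'
    have hT := h.task _ rfl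
    exact ⟨h.graph, h.round.link hT hy hd, by rintro _ ⟨⟩; exact hT.link hy rfl⟩
  | publish κ B ℓ v r₀ hph =>
    cases hph.symm.trans hp
    cases hp'
    exact ⟨h.graph, h.round.publish (h.task _ rfl), nofun⟩
  | move κ B ℓ task v hph hv hm =>
    cases hph.symm.trans hp
    cases hph.symm.trans hp'
    rw [Config.needsMove_iff, h.graph] at hv
    exact ⟨h.graph, h.round.move hv hm, fun T hT => (h.task T hT).move hv hm⟩
  | nextRound κ B ℓ hph hℓ hdone =>
    cases hph.symm.trans hp
    cases hp'
    simp only [Config.needsMove_iff, h.graph] at hdone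
    exact ⟨h.graph, h.round.succ hdone, nofun⟩
  | unmarkRoot _ hph | unmarkOther _ hph => cases hph.symm.trans hp'
  | editsDone _ _ hph => cases hph.symm.trans hp
  | _ => cases hp'

/-- The moves of the last batch are complete. -/
def Phase.IsSettled : Phase n → Prop
  | .quiescent | .unmarkingRoots | .unmarkingRest => True
  | _ => False

/-- The event neither begins nor ends a batch nor modifies an edge. -/
def Event.Continues : Event n P → Prop
  | .batchInv _ _ | .batchResp | .modify _ => False
  | _ => True

/-- The event is a step of a reader or an internal step of the update side. -/
def Event.Silent : Event n P → Prop
  | .batchInv _ _ | .batchResp | .modify _ | .beginUnmark | .unmarkRoot _ => False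
  | _ => True

lemma Event.Continues.ne_batchInv (h : a.Continues) (κ : Kind) (B : Finset (Sym2 (Fin n))) :
    a ≠ .batchInv κ B := by
  rintro rfl
  exact h

lemma Event.Continues.ne_batchResp (h : a.Continues) : a ≠ .batchResp := by
  rintro rfl
  exact h

lemma Event.Continues.ne_modify (h : a.Continues) (e : Sym2 (Fin n)) : a ≠ .modify e := by
  rintro rfl
  exact h

lemma Event.Silent.continues (h : a.Silent) : a.Continues := by
  cases a <;> trivial

lemma Event.Silent.ne_beginUnmark (h : a.Silent) : a ≠ .beginUnmark := by
  rintro rfl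
  exact h

lemma Event.Silent.ne_unmarkRoot (h : a.Silent) (r : Fin n) : a ≠ .unmarkRoot r := by
  rintro rfl
  exact h

lemma ReadStep.silent {p : P} {s s' : Reader n} (h : ReadStep prm p c s a s') : a.Silent := by
  cases h <;> trivial

end Steps

section LastBefore

variable {Q : ℕ → Prop} {i N : ℕ}

open Classical in
/-- The last index before `N` at which `Q` holds (`0` if there is none). -/
noncomputable def lastBefore (Q : ℕ → Prop) (N : ℕ) : ℕ := Nat.findGreatest (fun k => k < N ∧ Q k) N

open Classical in
lemma lastBefore_eq (hi : i < N) (hQ : Q i) (h : ∀ k, i < k → k < N → ¬ Q k) :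
    lastBefore Q N = i :=
  Nat.findGreatest_eq_iff.2 ⟨hi.le, fun _ => ⟨hi, hQ⟩, fun k hk _ hkQ => h k hk hkQ.1 hkQ.2⟩

lemma lastBefore_succ (h : Q N) : lastBefore Q (N + 1) = N :=
  lastBefore_eq (Nat.lt_succ_self N) h fun k _ _ => by omega

open Classical in
lemma not_of_lastBefore_lt {k : ℕ} (hk : lastBefore Q N < k) (hkN : k < N) : ¬ Q k :=
  fun hQ => Nat.findGreatest_is_greatest hk hkN.le ⟨hkN, hQ⟩

open Classical in
lemma lastBefore_succ_of_not (h : ¬ Q N) : lastBefore Q (N + 1) = lastBefore Q N := by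
  refine Nat.findGreatest_eq_iff.2 ⟨(Nat.findGreatest_le N).trans (Nat.le_succ N), fun hne => ?_,
    fun k hk _ hkQ => ?_⟩
  · have hlast := Nat.findGreatest_of_ne_zero rfl hne
    exact ⟨hlast.1.trans (Nat.lt_succ_self N), hlast.2⟩
  · rcases Nat.lt_succ_iff_lt_or_eq.1 hkQ.1 with hkN | rfl
    · exact not_of_lastBefore_lt hk hkN hkQ.2
    · exact h hkQ.2

end LastBefore

namespace Execution

variable {n : ℕ} {P : Type*} [DecidableEq P] {prm : Params}

/-- The step at which the last batch before step `N` is invoked. -/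
noncomputable def batch (x : Execution n P prm) (N : ℕ) : ℕ :=
  lastBefore (fun k => ∃ κ B, x.ev k = some (.batchInv κ B)) N

/-- The graph before the last batch. -/
noncomputable def startGraph (x : Execution n P prm) (N : ℕ) : SimpleGraph (Fin n) :=
  (x.cfg (x.batch N)).G

/-- The levels before the last batch. -/
noncomputable def startLevel (x : Execution n P prm) (N : ℕ) : Fin n → ℕ :=
  (x.cfg (x.batch N)).level

open Classical in
/-- The descriptor array, in which the descriptors erased by the unmarking of the last batch are
retained. -/
noncomputable def full (x : Execution n P prm) : ℕ → DescArray n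
  | 0 => (x.cfg 0).desc
  | N + 1 => if (x.cfg (N + 1)).phase.IsSettled then x.full N else (x.cfg (N + 1)).desc

/-- The vertices of the DAGs of the last batch whose roots have been unmarked. -/
def applied (x : Execution n P prm) (N : ℕ) : Set (Fin n) :=
  {v | ∃ r, RootOf (x.full N) v r ∧ (x.cfg N).desc r = none}

open Classical in
/-- The levels of the sequential object that corresponds to the configuration before step `N`. -/
noncomputable def absLevel (x : Execution n P prm) (N : ℕ) : Fin n → ℕ :=
  (x.applied N).piecewise (x.cfg N).level (x.startLevel N)

/-- The execution has not ended before step `N`. -/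
def Alive (x : Execution n P prm) (N : ℕ) : Prop := ∀ k < N, x.ev k ≠ none

/-- The steps strictly between `i` and `N` whose event is `a`. -/
def occurrences (x : Execution n P prm) (a : Event n P) (i N : ℕ) : Set ℕ :=
  {k | i < k ∧ k < N ∧ x.ev k = some a}

variable {x : Execution n P prm} {i s N : ℕ} {κ : Kind} {B todo : Finset (Sym2 (Fin n))}
  {a b : Event n P}

lemma Alive.mono {M : ℕ} (h : x.Alive N) (hM : M ≤ N) : x.Alive M := fun k hk => h k (by omega)

lemma ev_eq_none_of_le {k : ℕ} (hk : x.ev k = none) (hkN : k ≤ N) : x.ev N = none := by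
  induction N, hkN using Nat.le_induction with
  | base => exact hk
  | succ N _ ih => exact x.ended N ih

lemma alive_succ_of_ev (h : x.ev N = some a) : x.Alive (N + 1) := fun k hk hn => by
  rw [ev_eq_none_of_le hn (Nat.le_of_lt_succ hk)] at h
  cases h

lemma step_cases (ha : x.ev N = some a) : UpdateStep prm (x.cfg N) a (x.cfg (N + 1)) ∨
    ∃ p s', ReadStep prm p (x.cfg N) ((x.cfg N).reader p) a s' ∧
      x.cfg (N + 1) = { x.cfg N with reader := Function.update (x.cfg N).reader p s' } := by
  have hs := x.step N a ha
  generalize hc' : x.cfg (N + 1) = c' at hs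
  cases hs with
  | update _ _ h => exact .inl h
  | read p a s' h => exact .inr ⟨p, s', h, rfl⟩

lemma batch_succ (ha : x.ev N = some a) (h : ∀ κ B, a ≠ .batchInv κ B) :
    x.batch (N + 1) = x.batch N := by
  refine lastBefore_succ_of_not ?_
  rintro ⟨κ, B, hinv⟩
  exact h κ B (Option.some_inj.1 (ha.symm.trans hinv))

lemma batch_succ_of_batchInv (ha : x.ev N = some (.batchInv κ B)) : x.batch (N + 1) = N :=
  lastBefore_succ ⟨κ, B, ha⟩

lemma startLevel_of_batch {M : ℕ} (h : x.batch M = x.batch N) :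
    x.startLevel M = x.startLevel N := by rw [startLevel, startLevel, h]

lemma startGraph_of_batch {M : ℕ} (h : x.batch M = x.batch N) :
    x.startGraph M = x.startGraph N := by rw [startGraph, startGraph, h]

lemma occurrences_succ (ha : x.ev N = some a) (hi : i < N) :
    x.occurrences a i (N + 1) = insert N (x.occurrences a i N) := by
  ext k
  simp only [occurrences, Set.mem_ofPred_eq, Set.mem_insert_iff]
  constructor
  · rintro ⟨hik, hkN, hk⟩
    exact (Nat.lt_succ_iff_lt_or_eq.1 hkN).symm.imp_right fun hkN => ⟨hik, hkN, hk⟩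
  · rintro (rfl | ⟨hik, hkN, hk⟩)
    · exact ⟨hi, Nat.lt_succ_self k, ha⟩
    · exact ⟨hik, hkN.trans (Nat.lt_succ_self N), hk⟩

lemma occurrences_succ_of_ne (ha : x.ev N = some a) (hab : a ≠ b) :
    x.occurrences b i (N + 1) = x.occurrences b i N := by
  ext k
  refine ⟨fun ⟨hik, hkN, hk⟩ => ⟨hik, ?_, hk⟩, fun ⟨hik, hkN, hk⟩ =>
    ⟨hik, hkN.trans (Nat.lt_succ_self N), hk⟩⟩
  refine lt_of_le_of_ne (Nat.le_of_lt_succ hkN) ?_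
  rintro rfl
  exact hab (Option.some_inj.1 (ha.symm.trans hk))

lemma occurrences_self (x : Execution n P prm) (a : Event n P) (i : ℕ) :
    x.occurrences a i (i + 1) = ∅ :=
  Set.eq_empty_iff_forall_notMem.2 fun _ ⟨hik, hki, _⟩ => by omega

/-- The history of the batch that is running before step `N`, in which the edges of `todo` have not
been modified yet. -/
structure BatchHist (x : Execution n P prm) (N : ℕ) (κ : Kind) (B todo : Finset (Sym2 (Fin n))) :
    Prop where
  inv : x.ev (x.batch N) = some (.batchInv κ B)
  lt : x.batch N < N
  diag : ∀ e ∈ B, ¬ e.IsDiag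
  todo_subset : todo ⊆ B
  stable : Stable prm (x.startGraph N) (x.startLevel N)
  level_le : ∀ v, x.startLevel N v ≤ prm.topLevel n
  noResp : x.occurrences .batchResp (x.batch N) N = ∅
  modified : ∀ e, (x.occurrences (.modify e) (x.batch N) N).Nonempty ↔ e ∈ B \ todo
  modified_once : ∀ e, (x.occurrences (.modify e) (x.batch N) N).Subsingleton
  graph : (x.cfg N).G = applyEdges (x.startGraph N) κ ↑(B \ todo)

/-- The history of a batch before the unmarking. -/
structure PreHist (x : Execution n P prm) (N : ℕ) (κ : Kind) (B todo : Finset (Sym2 (Fin n))) :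
    Prop extends BatchHist x N κ B todo where
  noUnmark : x.occurrences .beginUnmark (x.batch N) N = ∅

/-- The history of a batch whose unmarking begins at step `s`. -/
structure PostHist (x : Execution n P prm) (N : ℕ) (κ : Kind) (B : Finset (Sym2 (Fin n)))
    (s : ℕ) : Prop extends BatchHist x N κ B ∅ where
  settles : x.SettlesAt (x.batch N) s
  settles_lt : s < N
  full : x.full N = (x.cfg s).desc
  level : (x.cfg N).level = (x.cfg s).level
  round : RoundInv prm κ B (x.startGraph N) (x.startLevel N) (x.cfg N).level (x.full N)
    (prm.topLevel n)
  unmarking : Unmarking (x.full N) (x.cfg N).desc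
    {r | (x.occurrences (.unmarkRoot r) s N).Nonempty}

/-- The state between two batches. -/
structure Calm (x : Execution n P prm) (N : ℕ) : Prop where
  desc : (x.cfg N).desc = fun _ => none
  stable : Stable prm (x.cfg N).G (x.cfg N).level
  level_le : ∀ v, (x.cfg N).level v ≤ prm.topLevel n
  unmarked : ∀ v, x.full N v = none → (x.cfg N).level v = x.startLevel N v
  rooted : AllRooted (x.full N)

/-- The running batch has neither moved nor marked a vertex. -/
def Untouched (x : Execution n P prm) (N : ℕ) : Prop :=
  (x.cfg N).level = x.startLevel N ∧ (x.cfg N).desc = fun _ => none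

/-- The invariant of the update side, for each phase. -/
def PhaseInvAt (x : Execution n P prm) (N : ℕ) : Phase n → Prop
  | .quiescent => x.Calm N
  | .invoked κ B => x.PreHist N κ B B ∧ x.Untouched N
  | .editing κ B todo => x.PreHist N κ B todo ∧ x.Untouched N
  | .rebalancing κ B ℓ task => x.PreHist N κ B ∅ ∧
      (x.cfg N).RebalancingInv prm κ B (x.startGraph N) (x.startLevel N) ℓ task
  | .unmarkingRoots => ∃ κ B s, x.PostHist N κ B s
  | .unmarkingRest => ∃ κ B s, x.PostHist N κ B s ∧
      ∀ r, IsRoot (x.full N) r → (x.cfg N).desc r = none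

/-- The invariant of the update side. -/
def PhaseInv (x : Execution n P prm) (N : ℕ) : Prop := x.PhaseInvAt N (x.cfg N).phase

lemma full_succ_of_isSettled (h : (x.cfg (N + 1)).phase.IsSettled) : x.full (N + 1) = x.full N :=
  if_pos h

lemma full_eq_desc (h : ¬ (x.cfg N).phase.IsSettled) : x.full N = (x.cfg N).desc := by
  cases N with
  | zero => rfl
  | succ N => exact if_neg h

lemma applied_eq_empty (h : x.full N = (x.cfg N).desc) : x.applied N = ∅ := by
  rw [Set.eq_empty_iff_forall_notMem]
  rintro v ⟨r, hr, hd⟩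
  rw [h] at hr
  exact hr.2.ne_none hd

lemma BatchHist.start (h : x.Calm N) (ha : x.ev N = some (.batchInv κ B))
    (hB : ∀ e ∈ B, ¬ e.IsDiag) (hG : (x.cfg (N + 1)).G = (x.cfg N).G) :
    x.BatchHist (N + 1) κ B B := by
  have hb := batch_succ_of_batchInv ha
  constructor <;> try simp only [startGraph, startLevel, hb, occurrences_self]
  · exact ha
  · exact Nat.lt_succ_self N
  · exact hB
  · exact subset_rfl
  · exact h.stable
  · exact h.level_le
  · simp
  · simp
  · rw [hG, Finset.sdiff_self, Finset.coe_empty, applyEdges_empty]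

lemma BatchHist.succ (h : x.BatchHist N κ B todo) (ha : x.ev N = some a) (hcont : a.Continues)
    (hG : (x.cfg (N + 1)).G = (x.cfg N).G) : x.BatchHist (N + 1) κ B todo := by
  have hb := batch_succ ha hcont.ne_batchInv
  constructor <;> try simp only [startGraph_of_batch hb, startLevel_of_batch hb, hb,
    occurrences_succ_of_ne ha (hcont.ne_modify _), occurrences_succ_of_ne ha hcont.ne_batchResp]
  · exact h.inv
  · exact h.lt.trans (Nat.lt_succ_self N)
  · exact h.diag
  · exact h.todo_subset
  · exact h.stable
  · exact h.level_le
  · exact h.noResp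
  · exact h.modified
  · exact h.modified_once
  · exact hG.trans h.graph

lemma BatchHist.modify (h : x.BatchHist N κ B todo) {e : Sym2 (Fin n)}
    (ha : x.ev N = some (.modify e)) (he : e ∈ todo)
    (hG : (x.cfg (N + 1)).G = applyEdge (x.cfg N).G κ e) :
    x.BatchHist (N + 1) κ B (todo.erase e) := by
  have hb := batch_succ ha nofun
  have hocc : ∀ e' ≠ e, x.occurrences (.modify e') (x.batch N) (N + 1) =
      x.occurrences (.modify e') (x.batch N) N :=
    fun e' hne => occurrences_succ_of_ne ha (by simpa using hne.symm)
  have hnone : x.occurrences (.modify e) (x.batch N) N = ∅ :=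
    Set.not_nonempty_iff_eq_empty.1 fun hne => (Finset.mem_sdiff.1 ((h.modified e).1 hne)).2 he
  have hocc_self : x.occurrences (.modify e) (x.batch N) (N + 1) = {N} := by
    rw [occurrences_succ ha h.lt, hnone, insert_empty_eq]
  have hsdiff : B \ todo.erase e = insert e (B \ todo) := Finset.sdiff_erase (h.todo_subset he)
  constructor <;> try simp only [startGraph_of_batch hb, startLevel_of_batch hb, hb, hsdiff]
  · exact h.inv
  · exact h.lt.trans (Nat.lt_succ_self N)
  · exact h.diag
  · exact (Finset.erase_subset e todo).trans h.todo_subset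
  · exact h.stable
  · exact h.level_le
  · exact (occurrences_succ_of_ne (b := .batchResp) ha nofun).trans h.noResp
  · intro e'
    rcases eq_or_ne e' e with rfl | hne
    · simp [hocc_self]
    · rw [hocc e' hne, h.modified e', Finset.mem_insert, or_iff_right hne]
  · intro e'
    rcases eq_or_ne e' e with rfl | hne
    · simp [hocc_self]
    · exact hocc e' hne ▸ h.modified_once e'
  · rw [hG, h.graph, applyEdge_applyEdges, Finset.coe_insert]

lemma BatchHist.graph_eq (h : x.BatchHist N κ B ∅) :
    (x.cfg N).G = applyEdges (x.startGraph N) κ B := by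
  rw [h.graph, Finset.sdiff_empty]

lemma PreHist.succ (h : x.PreHist N κ B todo) (ha : x.ev N = some a) (hsil : a.Silent)
    (hG : (x.cfg (N + 1)).G = (x.cfg N).G) : x.PreHist (N + 1) κ B todo where
  toBatchHist := h.toBatchHist.succ ha hsil.continues hG
  noUnmark := by
    rw [batch_succ ha hsil.continues.ne_batchInv, occurrences_succ_of_ne ha hsil.ne_beginUnmark,
      h.noUnmark]

lemma PreHist.modify (h : x.PreHist N κ B todo) {e : Sym2 (Fin n)}
    (ha : x.ev N = some (.modify e)) (he : e ∈ todo)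
    (hG : (x.cfg (N + 1)).G = applyEdge (x.cfg N).G κ e) :
    x.PreHist (N + 1) κ B (todo.erase e) where
  toBatchHist := h.toBatchHist.modify ha he hG
  noUnmark := by
    rw [batch_succ ha nofun, occurrences_succ_of_ne (b := .beginUnmark) ha nofun, h.noUnmark]

lemma PreHist.settle (h : x.PreHist N κ B ∅) (ha : x.ev N = some .beginUnmark)
    (hp : ¬ (x.cfg N).phase.IsSettled) {T : Option (MarkTask n)}
    (hreb : (x.cfg N).RebalancingInv prm κ B (x.startGraph N) (x.startLevel N) (prm.topLevel n) T)
    (hc : x.cfg (N + 1) = { x.cfg N with phase := .unmarkingRoots }) :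
    x.PostHist (N + 1) κ B N := by
  have hb := batch_succ ha nofun
  have hf : x.full (N + 1) = (x.cfg N).desc :=
    (full_succ_of_isSettled (by rw [hc]; trivial)).trans (full_eq_desc hp)
  refine ⟨h.toBatchHist.succ ha trivial (by rw [hc]), ?_, Nat.lt_succ_self N, hf, by rw [hc], ?_,
    ?_⟩
  · rw [hb]
    refine ⟨h.lt, ⟨_, ha, rfl⟩, ?_⟩
    rintro k hk hkN _ hev rfl
    exact h.noUnmark.le ⟨hk, hkN, hev⟩
  · rw [startGraph_of_batch hb, startLevel_of_batch hb, hf, hc]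
    exact hreb.round
  · rw [hf, hc]
    simpa only [occurrences_self, Set.not_nonempty_empty, Set.ofPred_false] using Unmarking.refl _

lemma PostHist.succ (h : x.PostHist N κ B s) (ha : x.ev N = some a) (hcont : a.Continues)
    (hG : (x.cfg (N + 1)).G = (x.cfg N).G) (hL : (x.cfg (N + 1)).level = (x.cfg N).level)
    (hp : (x.cfg (N + 1)).phase.IsSettled)
    (hu : Unmarking (x.full N) (x.cfg (N + 1)).desc
      {r | (x.occurrences (.unmarkRoot r) s (N + 1)).Nonempty}) : x.PostHist (N + 1) κ B s := by
  have hb := batch_succ ha hcont.ne_batchInv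
  have hf := full_succ_of_isSettled hp
  refine ⟨h.toBatchHist.succ ha hcont hG, hb ▸ h.settles, h.settles_lt.trans (Nat.lt_succ_self N),
    hf.trans h.full, hL.trans h.level, ?_, hf ▸ hu⟩
  rw [hf, hL, startGraph_of_batch hb, startLevel_of_batch hb]
  exact h.round

lemma PostHist.succ_silent (h : x.PostHist N κ B s) (ha : x.ev N = some a) (hsil : a.Silent)
    (hG : (x.cfg (N + 1)).G = (x.cfg N).G) (hL : (x.cfg (N + 1)).level = (x.cfg N).level)
    (hp : (x.cfg (N + 1)).phase.IsSettled)
    (hu : Unmarking (x.full N) (x.cfg (N + 1)).desc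
      {r | (x.occurrences (.unmarkRoot r) s N).Nonempty}) : x.PostHist (N + 1) κ B s :=
  h.succ ha hsil.continues hG hL hp
    (by simpa only [occurrences_succ_of_ne ha (hsil.ne_unmarkRoot _)] using hu)

lemma PostHist.unmarkRoot (h : x.PostHist N κ B s) {r : Fin n}
    (ha : x.ev N = some (.unmarkRoot r)) (hr : IsRoot (x.cfg N).desc r)
    (hp : (x.cfg N).phase = .unmarkingRoots)
    (hc : x.cfg (N + 1) = { x.cfg N with desc := Function.update (x.cfg N).desc r none }) :
    x.PostHist (N + 1) κ B s := by
  refine h.succ ha trivial (by rw [hc]) (by rw [hc]) (by rw [hc, hp]; trivial) ?_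
  have hU : {q | (x.occurrences (.unmarkRoot q) s (N + 1)).Nonempty} =
      insert r {q | (x.occurrences (.unmarkRoot q) s N).Nonempty} := by
    ext q
    rcases eq_or_ne q r with rfl | hqr
    · simp [occurrences_succ ha h.settles_lt]
    · have hne : Event.unmarkRoot (P := P) r ≠ .unmarkRoot q := by simpa using hqr.symm
      simp [occurrences_succ_of_ne ha hne, hqr]
  rw [hU, hc]
  exact h.unmarking.unmarkRoot (h.unmarking.isRoot hr)

lemma PostHist.calm (h : x.PostHist N κ B s) (ha : x.ev N = some .batchResp)
    (hD : ∀ v, (x.cfg N).desc v = none)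
    (hc : x.cfg (N + 1) = { x.cfg N with phase := .quiescent }) : x.Calm (N + 1) := by
  have hb := batch_succ ha nofun
  have hf : x.full (N + 1) = x.full N := full_succ_of_isSettled (by rw [hc]; trivial)
  refine ⟨by rw [hc]; exact funext hD, ?_, by rw [hc]; exact h.round.le_topLevel, ?_, ?_⟩
  · rw [hc, h.graph_eq]
    exact (h.round.settles h.stable).stable h.stable
  · rw [hf, hc, startLevel_of_batch hb]
    exact h.round.marking.unmarked
  · rw [hf]
    exact h.round.marking.rooted

lemma Untouched.succ (h : x.Untouched N) (ha : x.ev N = some a)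
    (hinv : ∀ κ B, a ≠ .batchInv κ B) (hL : (x.cfg (N + 1)).level = (x.cfg N).level)
    (hD : (x.cfg (N + 1)).desc = (x.cfg N).desc) : x.Untouched (N + 1) :=
  ⟨by rw [hL, h.1, startLevel_of_batch (batch_succ ha hinv)], hD.trans h.2⟩

lemma Untouched.rebalancingInv (h : x.Untouched N) (hist : x.BatchHist N κ B ∅) :
    (x.cfg N).RebalancingInv prm κ B (x.startGraph N) (x.startLevel N) 0 none := by
  refine ⟨hist.graph_eq, ?_, nofun⟩
  rw [h.1, h.2]
  exact .start κ _ _ hist.level_le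

lemma PhaseInv.read (h : x.PhaseInv N) (ha : x.ev N = some a) (hsil : a.Silent) {f : P → Reader n}
    (hc : x.cfg (N + 1) = { x.cfg N with reader := f }) : x.PhaseInv (N + 1) := by
  have hG : (x.cfg (N + 1)).G = (x.cfg N).G := by rw [hc]
  have hL : (x.cfg (N + 1)).level = (x.cfg N).level := by rw [hc]
  have hD : (x.cfg (N + 1)).desc = (x.cfg N).desc := by rw [hc]
  have hp : (x.cfg (N + 1)).phase = (x.cfg N).phase := by rw [hc]
  have hb := batch_succ ha hsil.continues.ne_batchInv
  have hpost : ∀ {κ B s}, x.PostHist N κ B s → (x.cfg (N + 1)).phase.IsSettled →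
      x.PostHist (N + 1) κ B s :=
    fun h hk => h.succ_silent ha hsil hG hL hk (hD ▸ h.unmarking)
  have huntouched : x.Untouched N → x.Untouched (N + 1) :=
    fun h => h.succ ha hsil.continues.ne_batchInv hL hD
  unfold PhaseInv at *
  rw [hp]
  generalize (x.cfg N).phase = p at *
  cases p with
  | quiescent =>
    have h : x.Calm N := h
    have hf := full_succ_of_isSettled (x := x) (N := N) (by rw [hp]; trivial)
    exact ⟨hD.trans h.desc, hG ▸ hL ▸ h.stable, hL ▸ h.level_le,
      by rw [hf, hL, startLevel_of_batch hb]; exact h.unmarked, hf ▸ h.rooted⟩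
  | invoked κ B => exact ⟨h.1.succ ha hsil hG, huntouched h.2⟩
  | editing κ B todo => exact ⟨h.1.succ ha hsil hG, huntouched h.2⟩
  | rebalancing κ B ℓ task =>
    refine ⟨h.1.succ ha hsil hG, ?_⟩
    rw [startLevel_of_batch hb, startGraph_of_batch hb]
    exact ⟨hG.trans h.2.graph, hL ▸ hD ▸ h.2.round, hL ▸ hD ▸ h.2.task⟩
  | unmarkingRoots =>
    obtain ⟨κ, B, s, h⟩ := h
    exact ⟨κ, B, s, hpost h (by rw [hp]; trivial)⟩
  | unmarkingRest =>
    obtain ⟨κ, B, s, h, hroots⟩ := h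
    have hf := full_succ_of_isSettled (x := x) (N := N) (by rw [hp]; trivial)
    exact ⟨κ, B, s, hpost h (by rw [hp]; trivial), by rwa [hf, hD]⟩

lemma stable_bot_zero (prm : Params) (n : ℕ) : Stable prm (⊥ : SimpleGraph (Fin n)) fun _ => 0 := by
  refine fun v => ⟨fun _ => ?_, fun h => absurd h (lt_irrefl _)⟩
  have hdeg : degAbove (⊥ : SimpleGraph (Fin n)) (fun _ => 0) v 0 = 0 := by simp [degAbove]
  rw [hdeg, Nat.cast_zero]
  have hδ := prm.δ_pos
  exact le_trans (by positivity) (prm.pow_le_upper_bound _)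

lemma phaseInv_zero (x : Execution n P prm) : x.PhaseInv 0 := by
  have hcalm : x.Calm 0 := by
    refine ⟨by rw [x.init]; rfl, ?_, fun v => ?_, fun v _ => ?_, fun v hv => absurd ?_ hv⟩
    · rw [x.init]
      exact stable_bot_zero prm n
    · rw [x.init]
      exact Nat.zero_le _
    · rfl
    · rw [full, x.init]
      rfl
  rw [PhaseInv, x.init]
  exact hcalm

lemma PhaseInv.succ_rebalancing {ℓ ℓ' : ℕ} {T T' : Option (MarkTask n)} (h : x.PhaseInv N)
    (ha : x.ev N = some .internal) (hs : UpdateStep prm (x.cfg N) .internal (x.cfg (N + 1)))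
    (hG : (x.cfg (N + 1)).G = (x.cfg N).G)
    (hp : (x.cfg N).phase = .rebalancing κ B ℓ T)
    (hp' : (x.cfg (N + 1)).phase = .rebalancing κ B ℓ' T') : x.PhaseInv (N + 1) := by
  rw [PhaseInv, hp] at h
  rw [PhaseInv, hp']
  have hb := batch_succ ha nofun
  refine ⟨h.1.succ ha trivial hG, ?_⟩
  rw [startGraph_of_batch hb, startLevel_of_batch hb]
  exact hs.rebalancingInv hp hp' h.2

lemma PhaseInv.succ_unmarking (h : x.PhaseInv N) (ha : x.ev N = some a)
    (hs : UpdateStep prm (x.cfg N) a (x.cfg (N + 1)))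
    (hp : (x.cfg N).phase = .unmarkingRoots ∨ (x.cfg N).phase = .unmarkingRest) :
    x.PhaseInv (N + 1) := by
  unfold PhaseInv at *
  generalize hc : x.cfg (N + 1) = c' at hs
  cases hs with
  | unmarkRoot r hph hr =>
    rw [hph] at h ⊢
    obtain ⟨κ, B, s, h⟩ := h
    exact ⟨κ, B, s, h.unmarkRoot ha hr hph hc⟩
  | rootsDone hph hr =>
    rw [hph] at h
    obtain ⟨κ, B, s, h⟩ := h
    have hset : (x.cfg (N + 1)).phase.IsSettled := by rw [hc]; trivial
    refine ⟨κ, B, s, h.succ_silent ha trivial (by rw [hc]) (by rw [hc]) hset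
      (by rw [hc]; exact h.unmarking), fun r hroot => ?_⟩
    rw [full_succ_of_isSettled hset] at hroot
    rw [hc]
    by_contra hne
    refine hr r ?_
    rwa [IsRoot, h.unmarking.eq_of_ne_none hne]
  | unmarkOther v hph hv =>
    rw [hph] at h ⊢
    obtain ⟨κ, B, s, h, hroots⟩ := h
    have hset : (x.cfg (N + 1)).phase.IsSettled := by rw [hc, hph]; trivial
    refine ⟨κ, B, s, h.succ_silent ha trivial (by rw [hc]) (by rw [hc]) hset ?_, fun r hr => ?_⟩
    · rw [hc]
      exact h.unmarking.unmarkOther hroots h.round.marking.rooted hv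
    · rw [full_succ_of_isSettled hset] at hr
      rw [hc]
      exact update_none_eq_none v (hroots r hr)
  | respond hph hD =>
    rw [hph] at h
    obtain ⟨κ, B, s, h, -⟩ := h
    exact h.calm ha hD hc
  | _ => simp_all

lemma PhaseInv.succ (h : x.PhaseInv N) (ha : x.ev N = some a) : x.PhaseInv (N + 1) := by
  rcases step_cases ha with hs | ⟨p, s', hs, hc⟩
  swap
  · exact h.read ha hs.silent hc
  have hs' := hs
  generalize hc : x.cfg (N + 1) = c' at hs'
  have hsame : ∀ {p}, c'.phase = p → x.PhaseInvAt (N + 1) p → x.PhaseInv (N + 1) := by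
    rintro _ rfl h
    rwa [PhaseInv, hc]
  cases hs' with
  | invoke κ B hph hB =>
    rw [PhaseInv, hph] at h
    have h : x.Calm N := h
    have hb := batch_succ_of_batchInv ha
    refine hsame rfl ⟨⟨.start h ha hB (by rw [hc]), by rw [hb, occurrences_self]⟩, ?_,
      by rw [hc]; exact h.desc⟩
    rw [startLevel, hb, hc]
  | tick κ B hph =>
    rw [PhaseInv, hph] at h
    exact hsame rfl ⟨h.1.succ ha trivial (by rw [hc]),
      h.2.succ ha nofun (by rw [hc]) (by rw [hc])⟩
  | modify κ B todo e hph he =>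
    rw [PhaseInv, hph] at h
    exact hsame rfl ⟨h.1.modify ha he (by rw [hc]),
      h.2.succ ha nofun (by rw [hc]) (by rw [hc])⟩
  | editsDone κ B hph =>
    rw [PhaseInv, hph] at h
    have hist := h.1.succ ha trivial (by rw [hc])
    exact hsame rfl ⟨hist, (h.2.succ ha nofun (by rw [hc]) (by rw [hc])).rebalancingInv hist.1⟩
  | markNewDAG κ B ℓ v hph | markMerge κ B ℓ v hph | link κ B ℓ v _ _ _ _ hph
  | publish κ B ℓ v _ hph | nextRound κ B ℓ hph =>
    exact h.succ_rebalancing ha hs (by rw [hc]) hph (by rw [hc])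
  | move κ B ℓ task v hph => exact h.succ_rebalancing ha hs (by rw [hc]) hph (by rw [hc]; exact hph)
  | beginUnmark κ B hph =>
    rw [PhaseInv, hph] at h
    exact hsame rfl ⟨κ, B, N, h.1.settle ha (by rw [hph]; exact id) h.2 hc⟩
  | unmarkRoot _ hph | rootsDone hph => exact h.succ_unmarking ha hs (.inl hph)
  | unmarkOther _ hph | respond hph => exact h.succ_unmarking ha hs (.inr hph)

lemma phaseInv (h : x.Alive N) : x.PhaseInv N := by
  induction N with
  | zero => exact phaseInv_zero x
  | succ N ih =>
    obtain ⟨a, ha⟩ := Option.ne_none_iff_exists'.1 (h N (Nat.lt_succ_self N))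
    exact (ih (h.mono (Nat.le_succ N))).succ ha

end Execution

/-! ## Reads -/

section Events

variable {n : ℕ} {P : Type*} {prm : Params} {c c' : Config n P} {a : Event n P} {p : P}
  {s s' : Reader n}

/-- A batch is running and has incremented the batch number. -/
def Phase.Active : Phase n → Prop
  | .quiescent | .invoked _ _ => False
  | _ => True

lemma Phase.Active.ne_quiescent {q : Phase n} (h : q.Active) : q ≠ .quiescent := by
  rintro rfl
  exact h

/-- The reading process that performs the event (`none` for the update side). -/
def Event.reader? : Event n P → Option P
  | .readInv p _ | .readB1 p | .readL1 p | .readDesc p | .checkDAG p | .readL2 p | .readB2 p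
  | .returnOld p _ | .returnLive p _ => some p
  | _ => none

lemma UpdateStep.reader?_eq (h : UpdateStep prm c a c') : a.reader? = none := by
  cases h <;> rfl

lemma UpdateStep.reader_eq (h : UpdateStep prm c a c') : c'.reader = c.reader := by
  cases h <;> rfl

lemma ReadStep.reader?_eq (h : ReadStep prm p c s a s') : a.reader? = some p := by
  cases h <;> rfl

end Events

namespace Execution

variable {n : ℕ} {P : Type*} [DecidableEq P] {prm : Params}
variable {x : Execution n P prm} {N i m b₁ l₁ : ℕ} {a b : Event n P} {p : P} {v w : Fin n}
  {d cur : Option (Desc n)}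

lemma absLevel_of_mem (hv : v ∈ x.applied N) : x.absLevel N v = (x.cfg N).level v := by
  classical exact Set.piecewise_eq_of_mem _ _ _ hv

lemma absLevel_of_notMem (hv : v ∉ x.applied N) : x.absLevel N v = x.startLevel N v := by
  classical exact Set.piecewise_eq_of_notMem _ _ _ hv

lemma absLevel_of_eq (h : (x.cfg N).level v = x.startLevel N v) :
    x.absLevel N v = (x.cfg N).level v := by
  classical exact piecewise_eq_of_eq h

lemma exists_preHist (hA : x.Alive N) (hp : ¬ (x.cfg N).phase.IsSettled) : ∃ κ B todo ℓ,
    x.PreHist N κ B todo ∧ RoundInv prm κ B (x.startGraph N) (x.startLevel N) (x.cfg N).level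
      (x.full N) ℓ := by
  rw [full_eq_desc hp]
  have h := phaseInv hA
  unfold PhaseInv at h
  generalize (x.cfg N).phase = q at *
  cases q with
  | invoked κ B | editing κ B todo =>
    refine ⟨κ, B, _, 0, h.1, ?_⟩
    rw [h.2.1, h.2.2]
    exact .start κ _ _ h.1.level_le
  | rebalancing κ B ℓ task => exact ⟨κ, B, ∅, ℓ, h.1, h.2.round⟩
  | _ => exact (hp trivial).elim

lemma exists_postHist (hA : x.Alive N) (hp : (x.cfg N).phase.IsSettled)
    (hq : (x.cfg N).phase ≠ .quiescent) : ∃ κ B s, x.PostHist N κ B s := by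
  have h := phaseInv hA
  unfold PhaseInv at h
  generalize (x.cfg N).phase = q at *
  cases q with
  | unmarkingRoots => exact h
  | unmarkingRest =>
    obtain ⟨κ, B, s, h, -⟩ := h
    exact ⟨κ, B, s, h⟩
  | quiescent => exact (hq rfl).elim
  | _ => exact hp.elim

lemma exists_roundInv (hA : x.Alive N) (hq : (x.cfg N).phase ≠ .quiescent) :
    ∃ (κ : Kind) (B : Finset (Sym2 (Fin n))) (ℓ : ℕ), RoundInv prm κ B (x.startGraph N)
      (x.startLevel N) (x.cfg N).level (x.full N) ℓ := by
  by_cases hp : (x.cfg N).phase.IsSettled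
  · obtain ⟨κ, B, s, h⟩ := exists_postHist hA hp hq
    exact ⟨κ, B, _, h.round⟩
  · obtain ⟨κ, B, todo, ℓ, -, h⟩ := exists_preHist hA hp
    exact ⟨κ, B, ℓ, h⟩

lemma desc_eq_full_or (hA : x.Alive N) (hq : (x.cfg N).phase ≠ .quiescent) (v : Fin n) :
    (x.cfg N).desc v = x.full N v ∨ (x.cfg N).desc v = none ∧ v ∈ x.applied N := by
  by_cases hp : (x.cfg N).phase.IsSettled
  · obtain ⟨κ, B, s, h⟩ := exists_postHist hA hp hq
    exact h.unmarking.desc v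
  · exact .inl (congrFun (full_eq_desc hp).symm v)

lemma absLevel_of_not_active (hA : x.Alive N) (hp : ¬ (x.cfg N).phase.Active) :
    x.absLevel N = (x.cfg N).level := by
  have h := phaseInv hA
  unfold PhaseInv at h
  funext v
  generalize (x.cfg N).phase = q at *
  cases q with
  | quiescent =>
    have h : x.Calm N := h
    by_cases hv : x.full N v = none
    · exact absLevel_of_eq (h.unmarked v hv)
    · obtain ⟨r, hr⟩ := h.rooted v hv
      exact absLevel_of_mem ⟨r, hr, congrFun h.desc r⟩
  | invoked κ B => exact absLevel_of_eq (congrFun h.2.1 v)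
  | _ => exact (hp trivial).elim

lemma active_of_desc (hA : x.Alive N) (hd : (x.cfg N).desc v ≠ none) :
    (x.cfg N).phase.Active := by
  have h := phaseInv hA
  unfold PhaseInv at h
  generalize (x.cfg N).phase = q at *
  cases q with
  | quiescent => exact hd (congrFun (Calm.desc h) v)
  | invoked κ B => exact hd (congrFun h.2.2 v)
  | _ => trivial

lemma full_eq_of_desc (hA : x.Alive N) (hd : (x.cfg N).desc v ≠ none) :
    x.full N v = (x.cfg N).desc v :=
  ((desc_eq_full_or hA (active_of_desc hA hd).ne_quiescent v).resolve_right
    fun h => hd h.1).symm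

lemma oldLevel_of_desc (hA : x.Alive N) {e : Desc n} (hd : (x.cfg N).desc v = some e) :
    e.oldLevel = x.startLevel N v := by
  have hne : (x.cfg N).desc v ≠ none := by simp [hd]
  obtain ⟨κ, B, ℓ, h⟩ := exists_roundInv hA (active_of_desc hA hne).ne_quiescent
  exact h.marking.old v e ((full_eq_of_desc hA hne).trans hd)

lemma mem_applied_of_desc (hA : x.Alive N) (hact : (x.cfg N).phase.Active)
    (hd : (x.cfg N).desc v = none) (hf : x.full N v ≠ none) : v ∈ x.applied N :=
  ((desc_eq_full_or hA hact.ne_quiescent v).resolve_left fun h => hf (h ▸ hd)).2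

lemma level_of_full (hA : x.Alive N) (hact : (x.cfg N).phase.Active)
    (hf : x.full N v = none) : (x.cfg N).level v = x.startLevel N v := by
  obtain ⟨κ, B, ℓ, h⟩ := exists_roundInv hA hact.ne_quiescent
  exact h.marking.unmarked v hf

lemma parentOf_full (hA : x.Alive N) (h : ParentOf (x.cfg N).desc v w) :
    ParentOf (x.full N) v w := by
  rwa [ParentOf, full_eq_of_desc hA h.ne_none]

lemma full_ne_none_of_parentOf (hA : x.Alive N) (h : ParentOf (x.cfg N).desc v w) :
    x.full N w ≠ none := by
  obtain ⟨κ, B, ℓ, hround⟩ := exists_roundInv hA (active_of_desc hA h.ne_none).ne_quiescent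
  obtain ⟨r, hr⟩ := hround.marking.rooted v (parentOf_full hA h).ne_none
  exact (hr.parent (parentOf_full hA h)).ne_none

lemma closed_applied (x : Execution n P prm) (N : ℕ) : Closed (x.full N) (x.applied N) :=
  closed_setOf_rootOf _ _

lemma notMem_applied_of_isRoot (hA : x.Alive N) (h : IsRoot (x.cfg N).desc v) :
    v ∉ x.applied N := by
  rintro ⟨r, hr, hn⟩
  have hroot : IsRoot (x.full N) v := by rwa [IsRoot, full_eq_of_desc hA h.ne_none]
  obtain rfl := hr.eq_of_isRoot hroot
  exact h.ne_none hn

/-- Step `N` lies between the increment of the batch number and the response of a batch; such a step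
only enlarges the DAGs (with erased descriptors retained) and the set of applied vertices. -/
structure BatchStep (x : Execution n P prm) (N : ℕ) : Prop where
  active : (x.cfg N).phase.Active
  batch : x.batch (N + 1) = x.batch N
  connected : ∀ u v, Connected (x.full N) u v → Connected (x.full (N + 1)) u v
  full : ∀ v, x.full N v ≠ none → x.full (N + 1) v ≠ none
  applied : x.applied N ⊆ x.applied (N + 1)

lemma BatchStep.of_full_eq (hact : (x.cfg N).phase.Active) (hb : x.batch (N + 1) = x.batch N)
    (hf : x.full (N + 1) = x.full N)
    (hd : ∀ v, (x.cfg N).desc v = none → (x.cfg (N + 1)).desc v = none) : x.BatchStep N where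
  active := hact
  batch := hb
  connected _ _ := by rw [hf]; exact id
  full _ := by rw [hf]; exact id
  applied := by
    rintro v ⟨r, hr, hn⟩
    exact ⟨r, hf ▸ hr, hd r hn⟩

lemma BatchStep.of_desc_eq (hact : (x.cfg N).phase.Active) (hb : x.batch (N + 1) = x.batch N)
    (hp : ¬ (x.cfg N).phase.IsSettled ∨ (x.cfg (N + 1)).phase.IsSettled)
    (hd : (x.cfg (N + 1)).desc = (x.cfg N).desc) : x.BatchStep N := by
  refine .of_full_eq hact hb ?_ fun _ => by rw [hd]; exact id
  by_cases hs : (x.cfg (N + 1)).phase.IsSettled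
  · exact full_succ_of_isSettled hs
  · rw [full_eq_desc hs, full_eq_desc (hp.resolve_right hs), hd]

lemma BatchStep.of_update (hact : (x.cfg N).phase.Active) (hb : x.batch (N + 1) = x.batch N)
    (hp : ¬ (x.cfg N).phase.IsSettled) (hp' : ¬ (x.cfg (N + 1)).phase.IsSettled) {y : Fin n}
    {e : Desc n} (hy : ∀ z, ¬ ParentOf (x.cfg N).desc y z)
    (hd : (x.cfg (N + 1)).desc = Function.update (x.cfg N).desc y (some e)) : x.BatchStep N where
  active := hact
  batch := hb
  connected _ _ huv := by
    rw [full_eq_desc hp', hd]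
    rw [full_eq_desc hp] at huv
    exact huv.mono fun _ _ hab => hab.update hy _
  full u hu := by
    rw [full_eq_desc hp', hd]
    rw [full_eq_desc hp] at hu
    rcases eq_or_ne u y with rfl | huy
    · simp
    · rwa [Function.update_of_ne huy]
  applied := by
    rw [applied_eq_empty (full_eq_desc hp)]
    exact Set.empty_subset _

lemma BatchStep.of_read (ha : x.ev N = some a) (hsil : a.Silent) {f : P → Reader n}
    (hc : x.cfg (N + 1) = { x.cfg N with reader := f }) (hact : (x.cfg (N + 1)).phase.Active) :
    x.BatchStep N := by
  have hphase : (x.cfg (N + 1)).phase = (x.cfg N).phase := by rw [hc]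
  exact .of_desc_eq (hphase ▸ hact) (batch_succ ha hsil.continues.ne_batchInv)
    (by rw [hphase]; exact (em _).symm) (by rw [hc])

lemma batchNum_le_succ (ha : x.ev N = some a) :
    (x.cfg N).batchNum ≤ (x.cfg (N + 1)).batchNum := by
  rcases step_cases ha with h | ⟨p, s', -, hc⟩
  · generalize x.cfg (N + 1) = c' at h
    cases h <;> simp
  · rw [hc]

lemma BatchStep.of_updateStep (hinv : x.PhaseInv N) (ha : x.ev N = some a)
    (hs : UpdateStep prm (x.cfg N) a (x.cfg (N + 1)))
    (hnum : (x.cfg N).batchNum = (x.cfg (N + 1)).batchNum)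
    (hact : (x.cfg (N + 1)).phase.Active) : x.BatchStep N := by
  generalize hc : x.cfg (N + 1) = c' at hs
  rw [hc] at hnum hact
  cases hs with
  | invoke | respond => exact hact.elim
  | tick => exact absurd hnum (Nat.succ_ne_self _).symm
  | modify _ _ _ _ hph | editsDone _ _ hph | markNewDAG _ _ _ _ hph | markMerge _ _ _ _ hph
  | move _ _ _ _ _ hph | nextRound _ _ _ hph | beginUnmark _ _ hph =>
    exact .of_desc_eq (by rw [hph]; trivial) (batch_succ ha nofun) (.inl (by rw [hph]; exact id))
      (by rw [hc])
  | rootsDone hph =>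
    exact .of_desc_eq (by rw [hph]; trivial) (batch_succ ha nofun) (.inr (by rw [hc]; trivial))
      (by rw [hc])
  | link _ _ _ _ _ y _ _ hph hy =>
    rw [PhaseInv, hph] at hinv
    exact .of_update (by rw [hph]; trivial) (batch_succ ha nofun) (by rw [hph]; exact id)
      (by rw [hc]; exact id)
      (fun _ => ((hinv.2.task _ rfl).toLink_isRoot y hy).not_parentOf) (by rw [hc])
  | publish _ _ _ _ _ hph =>
    rw [PhaseInv, hph] at hinv
    exact .of_update (by rw [hph]; trivial) (batch_succ ha nofun) (by rw [hph]; exact id)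
      (by rw [hc]; exact id) (fun _ h => h.ne_none (hinv.2.task _ rfl).unmarked) (by rw [hc])
  | unmarkRoot r hph | unmarkOther r hph =>
    exact .of_full_eq (by rw [hph]; trivial) (batch_succ ha nofun)
      (full_succ_of_isSettled (by rw [hc, hph]; trivial))
      (fun _ hv => by rw [hc]; exact update_none_eq_none r hv)

/-- A batch is active, and its batch number is `b`. -/
def InBatch (x : Execution n P prm) (N b : ℕ) : Prop :=
  (x.cfg N).phase.Active ∧ b = (x.cfg N).batchNum

lemma InBatch.batchStep {b : ℕ} (ha : x.ev N = some a) (hb : b ≤ (x.cfg N).batchNum)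
    (h : x.InBatch (N + 1) b) : x.BatchStep N := by
  rcases step_cases ha with hs | ⟨p, s', hs, hc⟩
  · refine .of_updateStep (phaseInv ((alive_succ_of_ev ha).mono (Nat.le_succ N))) ha hs ?_ h.1
    exact le_antisymm (batchNum_le_succ ha) (h.2 ▸ hb)
  · exact .of_read ha hs.silent hc h.1

lemma InBatch.pred {b : ℕ} (ha : x.ev N = some a) (hb : b ≤ (x.cfg N).batchNum)
    (h : x.InBatch (N + 1) b) : x.InBatch N b :=
  ⟨(h.batchStep ha hb).active, le_antisymm hb (h.2 ▸ batchNum_le_succ ha)⟩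

lemma reader_succ_of_ne (ha : x.ev N = some a) (hp : a.reader? ≠ some p) :
    (x.cfg (N + 1)).reader p = (x.cfg N).reader p := by
  rcases step_cases ha with hs | ⟨q, s', hs, hc⟩
  · rw [hs.reader_eq]
  · rw [hc]
    refine Function.update_of_ne ?_ ..
    rintro rfl
    exact hp hs.reader?_eq

lemma readStep_of_reader? (ha : x.ev N = some a) (hp : a.reader? = some p) :
    ReadStep prm p (x.cfg N) ((x.cfg N).reader p) a ((x.cfg (N + 1)).reader p) := by
  rcases step_cases ha with hs | ⟨q, s', hs, hc⟩
  · cases hs.reader?_eq.symm.trans hp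
  · obtain rfl : q = p := Option.some_inj.1 (hs.reader?_eq.symm.trans hp)
    rw [hc]
    simpa only [Function.update_self] using hs

lemma LastBetween.succ (h : x.LastBetween b i N m) (ha : x.ev N = some a) (hab : a ≠ b) :
    x.LastBetween b i (N + 1) m := by
  refine ⟨h.1, h.2.1.trans (Nat.lt_succ_self N), h.2.2.1, fun k hmk hkN => ?_⟩
  rcases Nat.lt_succ_iff_lt_or_eq.1 hkN with hkN | rfl
  · exact h.2.2.2 k hmk hkN
  · simpa [ha] using hab

lemma lastBetween_self (hi : i < N) (ha : x.ev N = some a) : x.LastBetween a i (N + 1) N :=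
  ⟨hi, Nat.lt_succ_self N, ha, fun _ _ _ => by omega⟩

lemma LastBetween.unique {m' : ℕ} {j : ℕ} (h : x.LastBetween a i j m)
    (h' : x.LastBetween a i j m') : m = m' := by
  rcases lt_trichotomy m m' with hlt | heq | hlt
  · exact (h.2.2.2 m' hlt h'.2.1 h'.2.2.1).elim
  · exact heq
  · exact (h'.2.2.2 m hlt h.2.1 h.2.2.1).elim

/-- The reader's first live level `l₁` of `v` is the level of the abstract object, as long as the
DAG of `v` is not applied. -/
def LiveCorrect (x : Execution n P prm) (N b₁ l₁ : ℕ) (v : Fin n) : Prop :=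
  x.InBatch N b₁ → l₁ = x.startLevel N v ∨ v ∈ x.applied N

/-- The descriptor `d` of `v`, read at step `m`, contains the level of the abstract object at that
step, unless the batch number has changed. -/
def OldCorrect (x : Execution n P prm) (m N b₁ : ℕ) (v : Fin n) (d : Option (Desc n)) : Prop :=
  ∀ d', d = some d' → b₁ = (x.cfg N).batchNum → x.absLevel m v = d'.oldLevel

/-- The invariant of a read of `v` that is following the parents and has reached the descriptor
`cur`. If the DAG of `v` was already applied when the descriptor `d` of `v` was read, then `cur` is
not a marked root. -/
structure CheckInv (x : Execution n P prm) (m N b₁ l₁ : ℕ) (v : Fin n)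
    (d cur : Option (Desc n)) : Prop where
  live : cur = none → x.LiveCorrect N b₁ l₁ v
  parent : x.InBatch N b₁ → ∀ c q, cur = some c → c.parent = some q →
    x.full N q ≠ none ∧ Connected (x.full N) v q
  old : ∀ d', d = some d' → b₁ = (x.cfg N).batchNum → x.absLevel m v = d'.oldLevel ∨
    (∀ c, cur = some c → c.parent ≠ none) ∧ ((x.cfg N).phase.Active → v ∈ x.applied N)

/-- The invariant of the read of `v` that process `p` has invoked at step `i`, for each local
state. -/
def ReaderInvAt (x : Execution n P prm) (p : P) (i : ℕ) (v : Fin n) (N : ℕ) : Reader n → Prop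
  | .idle => False
  | .start w => w = v
  | .gotB1 w b₁ => w = v ∧ b₁ ≤ (x.cfg N).batchNum
  | .gotL1 w b₁ l₁ => w = v ∧ b₁ ≤ (x.cfg N).batchNum ∧
      (x.InBatch N b₁ → x.full N v = none → l₁ = x.startLevel N v)
  | .checking w b₁ l₁ d cur => w = v ∧ b₁ ≤ (x.cfg N).batchNum ∧
      ∃ m, x.LastBetween (.readDesc p) i N m ∧ x.CheckInv m N b₁ l₁ v d cur
  | .checked w b₁ l₁ _ false => w = v ∧ b₁ ≤ (x.cfg N).batchNum ∧ x.LiveCorrect N b₁ l₁ v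
  | .checked w b₁ _ d true => w = v ∧ b₁ ≤ (x.cfg N).batchNum ∧
      ∃ m, x.LastBetween (.readDesc p) i N m ∧ x.OldCorrect m N b₁ v d
  | .gotL2 w b₁ l₁ _ false l₂ => w = v ∧ b₁ ≤ (x.cfg N).batchNum ∧
      ∃ m, x.LastBetween (.readL2 p) i N m ∧
        (l₁ = l₂ → b₁ = (x.cfg N).batchNum → x.absLevel m v = l₂)
  | .gotL2 w b₁ _ d true _ => w = v ∧ b₁ ≤ (x.cfg N).batchNum ∧
      ∃ m, x.LastBetween (.readDesc p) i N m ∧ x.OldCorrect m N b₁ v d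
  | .returningOld l => ∃ m, x.LastBetween (.readDesc p) i N m ∧ x.absLevel m v = l
  | .returningLive l => ∃ m, x.LastBetween (.readL2 p) i N m ∧ x.absLevel m v = l

/-- The invariant of the read of `v` that process `p` has invoked at step `i`. -/
def ReaderInv (x : Execution n P prm) (p : P) (i : ℕ) (v : Fin n) (N : ℕ) : Prop :=
  x.ReaderInvAt p i v N ((x.cfg N).reader p)

lemma eq_batchNum_of_succ (ha : x.ev N = some a) (hb : b₁ ≤ (x.cfg N).batchNum)
    (h : b₁ = (x.cfg (N + 1)).batchNum) : b₁ = (x.cfg N).batchNum :=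
  le_antisymm hb (h ▸ batchNum_le_succ ha)

lemma startLevel_succ (ha : x.ev N = some a) (hb : b₁ ≤ (x.cfg N).batchNum)
    (h : x.InBatch N b₁ → x.full N v = none → l₁ = x.startLevel N v)
    (hin : x.InBatch (N + 1) b₁) (hf : x.full (N + 1) v = none) :
    l₁ = x.startLevel (N + 1) v := by
  have hstep := hin.batchStep ha hb
  rw [startLevel_of_batch hstep.batch]
  exact h (hin.pred ha hb) (not_not.1 fun hne => hstep.full v hne hf)

lemma LiveCorrect.succ (ha : x.ev N = some a) (hb : b₁ ≤ (x.cfg N).batchNum)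
    (h : x.LiveCorrect N b₁ l₁ v) : x.LiveCorrect (N + 1) b₁ l₁ v := fun hin => by
  have hstep := hin.batchStep ha hb
  rw [startLevel_of_batch hstep.batch]
  exact (h (hin.pred ha hb)).imp_right fun hv => hstep.applied hv

lemma OldCorrect.succ (ha : x.ev N = some a) (hb : b₁ ≤ (x.cfg N).batchNum)
    (h : x.OldCorrect m N b₁ v d) : x.OldCorrect m (N + 1) b₁ v d :=
  fun d' hd' hnum => h d' hd' (eq_batchNum_of_succ ha hb hnum)

lemma CheckInv.succ (ha : x.ev N = some a) (hb : b₁ ≤ (x.cfg N).batchNum)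
    (h : x.CheckInv m N b₁ l₁ v d cur) : x.CheckInv m (N + 1) b₁ l₁ v d cur where
  live hc := (h.live hc).succ ha hb
  parent hin c q hc hq := by
    have hstep := hin.batchStep ha hb
    obtain ⟨hfull, hconn⟩ := h.parent (hin.pred ha hb) c q hc hq
    exact ⟨hstep.full q hfull, hstep.connected v q hconn⟩
  old d' hd' hnum := by
    refine (h.old d' hd' (eq_batchNum_of_succ ha hb hnum)).imp_right
      fun ⟨hroot, happ⟩ => ⟨hroot, fun hact => ?_⟩
    have hin : x.InBatch (N + 1) b₁ := ⟨hact, hnum⟩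
    exact (hin.batchStep ha hb).applied (happ (hin.pred ha hb).1)

lemma ReaderInv.succ_of_ne (h : x.ReaderInv p i v N) (ha : x.ev N = some a)
    (hp : a.reader? ≠ some p) : x.ReaderInv p i v (N + 1) := by
  have hdesc : a ≠ .readDesc p := by
    rintro rfl
    exact hp rfl
  have hL2 : a ≠ .readL2 p := by
    rintro rfl
    exact hp rfl
  have hle := batchNum_le_succ ha
  unfold ReaderInv at *
  rw [reader_succ_of_ne ha hp]
  generalize (x.cfg N).reader p = s at *
  match s with
  | .start _ => exact h
  | .gotB1 _ _ => exact ⟨h.1, h.2.trans hle⟩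
  | .gotL1 _ _ _ =>
    obtain ⟨hw, hb, hl⟩ := h
    exact ⟨hw, hb.trans hle, startLevel_succ ha hb hl⟩
  | .checking _ _ _ _ _ =>
    obtain ⟨hw, hb, m, hm, hcheck⟩ := h
    exact ⟨hw, hb.trans hle, m, hm.succ ha hdesc, hcheck.succ ha hb⟩
  | .checked _ _ _ _ false =>
    obtain ⟨hw, hb, hlive⟩ := h
    exact ⟨hw, hb.trans hle, hlive.succ ha hb⟩
  | .checked _ _ _ _ true | .gotL2 _ _ _ _ true _ =>
    obtain ⟨hw, hb, m, hm, hold⟩ := h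
    exact ⟨hw, hb.trans hle, m, hm.succ ha hdesc, hold.succ ha hb⟩
  | .gotL2 _ _ _ _ false _ =>
    obtain ⟨hw, hb, m, hm, hlive⟩ := h
    exact ⟨hw, hb.trans hle, m, hm.succ ha hL2,
      fun hl hnum => hlive hl (eq_batchNum_of_succ ha hb hnum)⟩
  | .returningOld _ =>
    obtain ⟨m, hm, hl⟩ := h
    exact ⟨m, hm.succ ha hdesc, hl⟩
  | .returningLive _ =>
    obtain ⟨m, hm, hl⟩ := h
    exact ⟨m, hm.succ ha hL2, hl⟩

lemma checkInv_desc (hA : x.Alive N)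
    (h : x.InBatch N b₁ → x.full N v = none → l₁ = x.startLevel N v) :
    x.CheckInv N N b₁ l₁ v ((x.cfg N).desc v) ((x.cfg N).desc v) where
  live hd hin := by
    by_cases hf : x.full N v = none
    · exact .inl (h hin hf)
    · exact .inr (mem_applied_of_desc hA hin.1 hd hf)
  parent _ c q hc hq :=
    ⟨full_ne_none_of_parentOf hA ⟨c, hc, hq⟩, .rel _ _ (parentOf_full hA ⟨c, hc, hq⟩)⟩
  old d' hd' _ := by
    by_cases hv : v ∈ x.applied N
    · exact .inr ⟨fun c hc hroot => notMem_applied_of_isRoot hA ⟨c, hc, hroot⟩ hv, fun _ => hv⟩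
    · exact .inl ((absLevel_of_notMem hv).trans (oldLevel_of_desc hA hd').symm)

lemma CheckInv.follow (hA : x.Alive N) {old : ℕ} {q : Fin n}
    (h : x.CheckInv m N b₁ l₁ v d (some ⟨old, some q⟩)) :
    x.CheckInv m N b₁ l₁ v d ((x.cfg N).desc q) where
  live hd hin := by
    obtain ⟨hfull, hconn⟩ := h.parent hin _ q rfl rfl
    exact .inr (((closed_applied x N).mem_iff hconn).2 (mem_applied_of_desc hA hin.1 hd hfull))
  parent hin c q' hc hq := by
    obtain ⟨-, hconn⟩ := h.parent hin _ q rfl rfl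
    exact ⟨full_ne_none_of_parentOf hA ⟨c, hc, hq⟩,
      hconn.trans _ _ _ (.rel _ _ (parentOf_full hA ⟨c, hc, hq⟩))⟩
  old d' hd' hnum := by
    refine (h.old d' hd' hnum).imp_right fun ⟨_, happ⟩ => ⟨fun c hc hroot => ?_, happ⟩
    have hact := active_of_desc hA (v := q) (by simp [hc])
    obtain ⟨-, hconn⟩ := h.parent ⟨hact, hnum⟩ _ q rfl rfl
    exact notMem_applied_of_isRoot hA ⟨c, hc, hroot⟩
      (((closed_applied x N).mem_iff hconn).1 (happ hact))

lemma LiveCorrect.absLevel_eq (hA : x.Alive N) (h : x.LiveCorrect N b₁ ((x.cfg N).level v) v)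
    (hnum : b₁ = (x.cfg N).batchNum) :
    x.absLevel N v = (x.cfg N).level v := by
  by_cases hact : (x.cfg N).phase.Active
  · rcases h ⟨hact, hnum⟩ with hl | hv
    · exact absLevel_of_eq hl
    · exact absLevel_of_mem hv
  · rw [absLevel_of_not_active hA hact]

lemma ReaderInv.succ_of_eq (h : x.ReaderInv p i v N) (hi : i < N) (ha : x.ev N = some a)
    (hp : a.reader? = some p) (hret : ¬ a.IsReturnOf p) : x.ReaderInv p i v (N + 1) := by
  have hA := (alive_succ_of_ev ha).mono (Nat.le_succ N)
  have hle := batchNum_le_succ ha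
  have hs := readStep_of_reader? ha hp
  unfold ReaderInv at *
  generalize (x.cfg N).reader p = s at *
  generalize (x.cfg (N + 1)).reader p = s' at *
  cases hs with
  | invoke => exact h.elim
  | readB1 => exact ⟨h, hle⟩
  | readL1 =>
    obtain ⟨rfl, hb⟩ := h
    exact ⟨rfl, hb.trans hle, startLevel_succ ha hb fun hin hf => level_of_full hA hin.1 hf⟩
  | readDesc =>
    obtain ⟨rfl, hb, hl⟩ := h
    exact ⟨rfl, hb.trans hle, N, lastBetween_self hi ha, (checkInv_desc hA hl).succ ha hb⟩
  | checkUnmarked =>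
    obtain ⟨hw, hb, m, -, hcheck⟩ := h
    exact ⟨hw, hb.trans hle, (hcheck.live rfl).succ ha hb⟩
  | checkMarked =>
    obtain ⟨hw, hb, m, hm, hcheck⟩ := h
    refine ⟨hw, hb.trans hle, m, hm.succ ha nofun, OldCorrect.succ ha hb fun d' hd' hnum => ?_⟩
    exact (hcheck.old d' hd' hnum).resolve_right fun hcur => hcur.1 _ rfl rfl
  | checkParent =>
    obtain ⟨hw, hb, m, hm, hcheck⟩ := h
    exact ⟨hw, hb.trans hle, m, hm.succ ha nofun, (hcheck.follow hA).succ ha hb⟩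
  | readL2 _ _ _ _ marked =>
    cases marked with
    | false =>
      obtain ⟨rfl, hb, hlive⟩ := h
      refine ⟨rfl, hb.trans hle, N, lastBetween_self hi ha, ?_⟩
      rintro rfl hnum
      exact hlive.absLevel_eq hA (eq_batchNum_of_succ ha hb hnum)
    | true =>
      obtain ⟨hw, hb, m, hm, hold⟩ := h
      exact ⟨hw, hb.trans hle, m, hm.succ ha nofun, hold.succ ha hb⟩
  | retryBatch _ _ _ _ marked => cases marked <;> exact h.1
  | acceptOld _ _ _ d _ hnum =>
    obtain ⟨-, -, m, hm, hold⟩ := h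
    exact ⟨m, hm.succ ha nofun, hold d rfl hnum⟩
  | acceptLive _ _ _ _ _ hnum hl =>
    obtain ⟨-, -, m, hm, hlive⟩ := h
    exact ⟨m, hm.succ ha nofun, hlive hl hnum⟩
  | retryLevel => exact h.1
  | returnOld => exact (hret ⟨_, .inl rfl⟩).elim
  | returnLive => exact (hret ⟨_, .inr rfl⟩).elim

lemma readerInv (hinv : x.ev i = some (.readInv p v)) (hi : i < N) (hA : x.Alive N)
    (hret : ∀ k, i < k → k < N → ∀ a, x.ev k = some a → ¬ a.IsReturnOf p) :
    x.ReaderInv p i v N := by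
  induction N, hi using Nat.le_induction with
  | base =>
    have hs := readStep_of_reader? hinv rfl
    unfold ReaderInv
    generalize (x.cfg i).reader p = s, (x.cfg (i + 1)).reader p = s' at *
    cases hs
    rfl
  | succ N hi ih =>
    have hprev := ih (hA.mono (Nat.le_succ N)) fun k hik hkN => hret k hik (by omega)
    obtain ⟨a, ha⟩ := Option.ne_none_iff_exists'.1 (hA N (Nat.lt_succ_self N))
    by_cases hp : a.reader? = some p
    · exact hprev.succ_of_eq hi ha hp (hret N hi (Nat.lt_succ_self N) a ha)
    · exact hprev.succ_of_ne ha hp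

lemma readerInv_of_respondsAt {j : ℕ} {val : ℝ} (h : x.RespondsAt (.read i p v val) j) :
    x.ReaderInv p i v j := by
  obtain ⟨a, ha, -⟩ := h.2.1.2.1
  exact readerInv h.1 h.2.1.1 ((alive_succ_of_ev ha).mono (Nat.le_succ j)) h.2.1.2.2

lemma exists_lastBetween_readDesc {j : ℕ} {val : ℝ} (h : x.RespondsAt (.read i p v val) j)
    (hj : x.ev j = some (.returnOld p val)) :
    ∃ m, x.LastBetween (.readDesc p) i j m ∧ val = prm.estimate n (x.absLevel m v) := by
  have hinv := readerInv_of_respondsAt h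
  have hs := readStep_of_reader? hj rfl
  unfold ReaderInv at hinv
  generalize (x.cfg j).reader p = s, (x.cfg (j + 1)).reader p = s' at *
  cases hs
  obtain ⟨m, hm, rfl⟩ := hinv
  exact ⟨m, hm, rfl⟩

lemma exists_lastBetween_readL2 {j : ℕ} {val : ℝ} (h : x.RespondsAt (.read i p v val) j)
    (hj : x.ev j = some (.returnLive p val)) :
    ∃ m, x.LastBetween (.readL2 p) i j m ∧ val = prm.estimate n (x.absLevel m v) := by
  have hinv := readerInv_of_respondsAt h
  have hs := readStep_of_reader? hj rfl
  unfold ReaderInv at hinv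
  generalize (x.cfg j).reader p = s, (x.cfg (j + 1)).reader p = s' at *
  cases hs
  obtain ⟨m, hm, rfl⟩ := hinv
  exact ⟨m, hm, rfl⟩

end Execution

/-! ## Linearization points -/

namespace Execution

variable {n : ℕ} {P : Type*} [DecidableEq P] {prm : Params} {x : Execution n P prm}
  {N i j s t : ℕ} {κ : Kind} {B : Finset (Sym2 (Fin n))} {a b : Event n P} {v r : Fin n}
  {e : Sym2 (Fin n)}

lemma FirstAfter.unique {Q : Event n P → Prop} {j' : ℕ} (h : x.FirstAfter Q i j)
    (h' : x.FirstAfter Q i j') : j = j' := by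
  obtain ⟨hij, ⟨a, ha, hQ⟩, hfirst⟩ := h
  obtain ⟨hij', ⟨a', ha', hQ'⟩, hfirst'⟩ := h'
  exact le_antisymm (not_lt.1 fun hlt => hfirst j' hij' hlt a' ha' hQ')
    (not_lt.1 fun hlt => hfirst' j hij hlt a ha hQ)

lemma FirstAfter.ev_eq (h : x.FirstAfter (fun a => a = b) i j) : x.ev j = some b := by
  obtain ⟨-, ⟨a, ha, rfl⟩, -⟩ := h
  exact ha

lemma FirstAfter.occurrences_eq_empty (h : x.FirstAfter (fun a => a = b) i j) :
    x.occurrences b i j = ∅ :=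
  Set.eq_empty_iff_forall_notMem.2 fun k ⟨hik, hkj, hk⟩ => h.2.2 k hik hkj b hk rfl

lemma exists_firstAfter (h : (x.occurrences b i N).Nonempty) :
    ∃ j < N, x.FirstAfter (fun a => a = b) i j := by
  classical
  obtain ⟨k, hik, hkN, hk⟩ := h
  have hex : ∃ j, i < j ∧ x.ev j = some b := ⟨k, hik, hk⟩
  obtain ⟨hij, hj⟩ := Nat.find_spec hex
  refine ⟨Nat.find hex, (Nat.find_min' hex ⟨hik, hk⟩).trans_lt hkN, hij, ⟨b, hj, rfl⟩, ?_⟩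
  rintro m him hm _ hev rfl
  exact Nat.find_min hex hm ⟨him, hev⟩

lemma occurrences_mono {M : ℕ} (h : M ≤ N) : x.occurrences b i M ⊆ x.occurrences b i N :=
  fun _ ⟨hik, hkM, hk⟩ => ⟨hik, hkM.trans_le h, hk⟩

lemma updateStep_of_not_silent (ha : x.ev N = some a) (h : ¬ a.Silent) :
    UpdateStep prm (x.cfg N) a (x.cfg (N + 1)) :=
  (step_cases ha).resolve_right fun ⟨_, _, hs, _⟩ => h hs.silent

lemma phase_of_batchInv (ha : x.ev N = some (.batchInv κ B)) :
    (x.cfg N).phase = .quiescent ∧ (x.cfg (N + 1)).phase = .invoked κ B := by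
  have hs := updateStep_of_not_silent ha id
  generalize x.cfg (N + 1) = c' at hs
  cases hs with
  | invoke _ _ hph => exact ⟨hph, rfl⟩

lemma phase_of_beginUnmark (ha : x.ev N = some .beginUnmark) :
    (x.cfg (N + 1)).phase = .unmarkingRoots := by
  have hs := updateStep_of_not_silent ha id
  generalize x.cfg (N + 1) = c' at hs
  cases hs
  rfl

lemma cfg_of_batchResp (ha : x.ev N = some .batchResp) : (x.cfg N).phase = .unmarkingRest ∧
    x.cfg (N + 1) = { x.cfg N with phase := .quiescent } := by
  have hs := updateStep_of_not_silent ha id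
  generalize x.cfg (N + 1) = c' at hs
  cases hs with
  | respond hph => exact ⟨hph, rfl⟩

lemma not_isSettled_succ (ha : x.ev N = some a) (hne : a ≠ .beginUnmark)
    (hp : ¬ (x.cfg N).phase.IsSettled) : ¬ (x.cfg (N + 1)).phase.IsSettled := by
  rcases step_cases ha with hs | ⟨p, s', -, hc⟩
  · generalize x.cfg (N + 1) = c' at hs
    cases hs <;> simp_all [Phase.IsSettled]
  · rwa [hc]

lemma ne_quiescent_succ (ha : x.ev N = some a) (hne : a ≠ .batchResp)
    (hp : (x.cfg N).phase ≠ .quiescent) : (x.cfg (N + 1)).phase ≠ .quiescent := by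
  rcases step_cases ha with hs | ⟨p, s', -, hc⟩
  · generalize x.cfg (N + 1) = c' at hs
    cases hs <;> simp_all
  · rwa [hc]

lemma batch_eq_of_phase {Q : Phase n → Prop} (hquiescent : ¬ Q .quiescent)
    (hinvoked : ∀ κ B, Q (.invoked κ B))
    (hstep : ∀ k a, x.ev k = some a → a ≠ b → Q (x.cfg k).phase → Q (x.cfg (k + 1)).phase)
    (hi : x.ev i = some (.batchInv κ B)) (hN : i < N) (hA : x.Alive N)
    (hb : x.occurrences b i N = ∅) : x.batch N = i ∧ Q (x.cfg N).phase := by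
  induction N, hN using Nat.le_induction with
  | base => exact ⟨batch_succ_of_batchInv hi, (phase_of_batchInv hi).2 ▸ hinvoked κ B⟩
  | succ N hN ih =>
    obtain ⟨hbatch, hQ⟩ := ih (hA.mono (Nat.le_succ N))
      (Set.subset_empty_iff.1 (hb ▸ occurrences_mono (Nat.le_succ N)))
    obtain ⟨a, ha⟩ := Option.ne_none_iff_exists'.1 (hA N (Nat.lt_succ_self N))
    refine ⟨?_, hstep N a ha ?_ hQ⟩
    · rw [batch_succ ha, hbatch]
      rintro κ B rfl
      exact hquiescent ((phase_of_batchInv ha).1 ▸ hQ)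
    · rintro rfl
      exact hb.le ⟨hN, Nat.lt_succ_self N, ha⟩

lemma batch_eq_of_noResp (hi : x.ev i = some (.batchInv κ B)) (hN : i < N) (hA : x.Alive N)
    (hb : x.occurrences .batchResp i N = ∅) : x.batch N = i ∧ (x.cfg N).phase ≠ .quiescent :=
  batch_eq_of_phase (Q := (· ≠ .quiescent)) (fun h => h rfl) (fun _ _ => nofun)
    (fun _ _ => ne_quiescent_succ) hi hN hA hb

lemma SettlesAt.alive (hs : x.SettlesAt i s) (hNs : N ≤ s) : x.Alive N :=
  (alive_succ_of_ev (FirstAfter.ev_eq hs)).mono (hNs.trans (Nat.le_succ s))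

lemma SettlesAt.batch_eq (hs : x.SettlesAt i s) (hi : x.ev i = some (.batchInv κ B))
    (hN : i < N) (hNs : N ≤ s) : x.batch N = i ∧ ¬ (x.cfg N).phase.IsSettled :=
  batch_eq_of_phase (Q := fun q => ¬ q.IsSettled) (fun h => h trivial) (fun _ _ => id)
    (fun _ _ => not_isSettled_succ) hi hN (hs.alive hNs)
    (Set.subset_empty_iff.1 (FirstAfter.occurrences_eq_empty hs ▸ occurrences_mono hNs))

lemma PostHist.of_settlesAt {κ' : Kind} {B' : Finset (Sym2 (Fin n))} {s' : ℕ}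
    (h : x.PostHist N κ' B' s') (hb : x.batch N = i) (hi : x.ev i = some (.batchInv κ B))
    (hs : x.SettlesAt i s) : x.PostHist N κ B s := by
  subst hb
  cases hi.symm.trans h.inv
  rwa [FirstAfter.unique hs h.settles]

lemma SettlesAt.postHist (hs : x.SettlesAt i s) (hi : x.ev i = some (.batchInv κ B)) :
    x.batch (s + 1) = i ∧ x.PostHist (s + 1) κ B s := by
  have hev : x.ev s = some .beginUnmark := FirstAfter.ev_eq hs
  have hb : x.batch (s + 1) = i :=
    (batch_succ hev fun _ _ => nofun).trans (hs.batch_eq hi hs.1 le_rfl).1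
  have hph := phase_of_beginUnmark hev
  obtain ⟨κ', B', s', h⟩ := exists_postHist (alive_succ_of_ev hev) (hph ▸ trivial) (hph ▸ nofun)
  exact ⟨hb, h.of_settlesAt hb hi hs⟩

lemma SettlesAt.roundInv (hs : x.SettlesAt i s) (hi : x.ev i = some (.batchInv κ B)) :
    RoundInv prm κ B (x.cfg i).G (x.cfg i).level (x.cfg s).level (x.cfg s).desc
      (prm.topLevel n) := by
  obtain ⟨hb, h⟩ := hs.postHist hi
  have hround := h.round
  rwa [h.full, h.level, startGraph, startLevel, hb] at hround

lemma SettlesAt.not_isDiag (hs : x.SettlesAt i s) (hi : x.ev i = some (.batchInv κ B))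
    (he : e ∈ B) : ¬ e.IsDiag :=
  (hs.postHist hi).2.diag e he

lemma SettlesAt.desc_ne_none (hs : x.SettlesAt i s) (hi : x.ev i = some (.batchInv κ B))
    (hv : x.Changes i s v) : (x.cfg s).desc v ≠ none :=
  fun hn => hv ((hs.roundInv hi).marking.unmarked v hn).symm

theorem sameDAG (x : Execution n P prm) : x.SameDAG := by
  rintro i s κ u v ⟨B, hi, hB⟩ hs hu hv
  refine ⟨⟨hs.desc_ne_none hi hu, hs.desc_ne_none hi hv⟩, fun t ht hts hut hvt => ?_⟩
  obtain ⟨hb, hp⟩ := hs.batch_eq hi ht hts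
  obtain ⟨κ', B', todo, ℓ, hist, hround⟩ := exists_preHist (hs.alive hts) hp
  cases (hb ▸ hi).symm.trans hist.inv
  rw [full_eq_desc hp] at hround
  obtain ⟨r, hr⟩ := hround.marking.rooted u hut
  exact ⟨r, hr, hr.of_connected (hround.marking.joined u v hut hvt (.inl hB))⟩

lemma IsRootOfDAG.rootOf (h : x.IsRootOfDAG i s e r) (hs : x.SettlesAt i s)
    (hi : x.ev i = some (.batchInv κ B)) (he : e ∈ B) (hv : v ∈ e) (hc : x.Changes i s v) :
    RootOf (x.cfg s).desc v r := by
  obtain ⟨w, hw, hcw, hr⟩ := h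
  by_cases hwv : w = v
  · exact hwv ▸ hr
  · obtain rfl : e = s(w, v) := (Sym2.mem_and_mem_iff hwv).1 ⟨hw, hv⟩
    exact hr.of_connected ((hs.roundInv hi).marking.joined w v (hs.desc_ne_none hi hcw)
      (hs.desc_ne_none hi hc) (.inl he))

lemma IsRootOfDAG.unique {r' : Fin n} (h : x.IsRootOfDAG i s e r) (h' : x.IsRootOfDAG i s e r')
    (hs : x.SettlesAt i s) (hi : x.ev i = some (.batchInv κ B)) (he : e ∈ B) : r = r' :=
  have ⟨_, hw, hcw, hr⟩ := h
  hr.unique (h'.rootOf hs hi he hw hcw)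

lemma Visible.exists_isRootOfDAG (h : x.Visible i s e) (hs : x.SettlesAt i s)
    (hi : x.ev i = some (.batchInv κ B)) : ∃ r, x.IsRootOfDAG i s e r := by
  obtain ⟨v, hv, hc⟩ := h
  obtain ⟨r, hr⟩ := (hs.roundInv hi).marking.rooted v (hs.desc_ne_none hi hc)
  exact ⟨r, v, hv, hc, hr⟩

theorem uniqueDAG (x : Execution n P prm) : x.UniqueDAG := by
  rintro i s κ e ⟨B, hi, hB⟩ hs hvis
  obtain ⟨r, hr⟩ := hvis.exists_isRootOfDAG hs hi
  exact ⟨r, hr, fun r' hr' => hr'.unique hr hs hi hB⟩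

lemma exists_postHist_of_batchResp (hi : x.ev i = some (.batchInv κ B))
    (hj : x.FirstAfter (fun a => a = .batchResp) i j) :
    x.batch j = i ∧ ∃ s, x.PostHist j κ B s ∧ x.SettlesAt i s ∧
      ∀ r, IsRoot (x.cfg s).desc r → (x.occurrences (.unmarkRoot r) s j).Nonempty := by
  have hA := (alive_succ_of_ev hj.ev_eq).mono (Nat.le_succ j)
  obtain ⟨hb, -⟩ := batch_eq_of_noResp hi hj.1 hA hj.occurrences_eq_empty
  have h := phaseInv hA
  rw [PhaseInv, (cfg_of_batchResp hj.ev_eq).1] at h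
  obtain ⟨κ', B', s, h, hr⟩ := h
  have hs : x.SettlesAt i s := hb ▸ h.settles
  refine ⟨hb, s, h.of_settlesAt hb hi hs, hs, fun r hroot => ?_⟩
  rw [← h.full] at hroot
  exact h.unmarking.mem_of_root r hroot (hr r hroot)

lemma batch_of_unmarkRoot (hi : x.ev i = some (.batchInv κ B)) (hs : x.SettlesAt i s)
    (hr : IsRoot (x.cfg s).desc r) (ht : x.FirstAfter (fun a => a = .unmarkRoot r) s t) :
    x.batch t = i ∧ x.occurrences .batchResp i t = ∅ := by
  have hresp : x.occurrences .batchResp i t = ∅ := by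
    by_contra hne
    obtain ⟨j, hjt, hj⟩ := exists_firstAfter (Set.nonempty_iff_ne_empty.2 hne)
    obtain ⟨-, s', -, hs', hroots⟩ := exists_postHist_of_batchResp hi hj
    rw [FirstAfter.unique hs' hs] at hroots
    exact ((hroots r hr).mono (occurrences_mono hjt.le)).ne_empty ht.occurrences_eq_empty
  have hA := (alive_succ_of_ev ht.ev_eq).mono (Nat.le_succ t)
  exact ⟨(batch_eq_of_noResp hi (lt_trans hs.1 ht.1) hA hresp).1, hresp⟩

/-- The time at which the visible update of `e` is linearized, if the root of its DAG is unmarked at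
step `t`. -/
noncomputable def visTime (x : Execution n P prm) (eid : Sym2 (Fin n) → ℕ) (t : ℕ)
    (e : Sym2 (Fin n)) : ℝ :=
  x.time t + (x.time (t + 1) - x.time t) * (eid e / ((n : ℝ) * (n - 1) / 2 + 1))

/-- The operation is linearized at time `τ` by step `N`, whose event is the last argument. This
repackages `LinPoint` around the step at which, or right after which, the point falls. -/
inductive LinAt (x : Execution n P prm) (eid : Sym2 (Fin n) → ℕ) (N : ℕ) (τ : ℝ) :
    Op n P → Event n P → Prop where
  | invisible (κ : Kind) (B : Finset (Sym2 (Fin n))) (e : Sym2 (Fin n)) (s : ℕ)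
      (hi : x.ev (x.batch N) = some (.batchInv κ B)) (he : e ∈ B) (hb : x.batch N < N)
      (hs : x.SettlesAt (x.batch N) s) (hNs : N < s) (hτ : τ = x.time N) :
      LinAt x eid N τ (.update (x.batch N) κ e) (.modify e)
  | visible (κ : Kind) (B : Finset (Sym2 (Fin n))) (e : Sym2 (Fin n)) (s : ℕ) (r : Fin n)
      (hi : x.ev (x.batch N) = some (.batchInv κ B)) (he : e ∈ B)
      (hs : x.SettlesAt (x.batch N) s) (hN : s < N)
      (hresp : x.occurrences .batchResp (x.batch N) N = ∅) (hτ : τ = x.visTime eid N e) :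
      LinAt x eid N τ (.update (x.batch N) κ e) (.unmarkRoot r)
  | readOld (i j : ℕ) (p : P) (v : Fin n) (val : ℝ)
      (hop : x.RespondsAt (.read i p v val) j) (hj : x.ev j = some (.returnOld p val))
      (hm : x.LastBetween (.readDesc p) i j N) (hτ : τ = x.time N) :
      LinAt x eid N τ (.read i p v val) (.readDesc p)
  | readLive (i j : ℕ) (p : P) (v : Fin n) (val : ℝ)
      (hop : x.RespondsAt (.read i p v val) j) (hj : x.ev j = some (.returnLive p val))
      (hm : x.LastBetween (.readL2 p) i j N) (hτ : τ = x.time N) :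
      LinAt x eid N τ (.read i p v val) (.readL2 p)

section Points

variable {eid : Sym2 (Fin n) → ℕ} {o o' : Op n P} {τ τ' : ℝ}

lemma LinPoint.linAt (h : x.LinPoint eid o τ) :
    ∃ N a, x.ev N = some a ∧ x.LinAt eid N τ o a := by
  cases h with
  | invisible i s m κ e hop hs hvis him hms hm =>
    obtain ⟨B, hi, he⟩ := hop
    obtain ⟨rfl, -⟩ := hs.batch_eq hi him hms.le
    exact ⟨m, _, hm, .invisible κ B e s hi he him hs hms rfl⟩
  | visible i s t κ e r hop hs hvis hr ht =>
    obtain ⟨B, hi, he⟩ := hop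
    obtain ⟨w, -, -, hrw⟩ := hr
    obtain ⟨rfl, hresp⟩ := batch_of_unmarkRoot hi hs hrw.2 ht
    exact ⟨t, _, ht.ev_eq, .visible κ B e s r hi he hs ht.1 hresp rfl⟩
  | readOld i j m p v val hop hj hm => exact ⟨m, _, hm.2.2.1, .readOld i j p v val hop hj hm rfl⟩
  | readLive i j m p v val hop hj hm => exact ⟨m, _, hm.2.2.1, .readLive i j p v val hop hj hm rfl⟩

lemma time_lt_time_succ (x : Execution n P prm) (N : ℕ) : x.time N < x.time (N + 1) :=
  x.time_mono (Nat.lt_succ_self N)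

lemma natCast_mul_sub_one (n : ℕ) : (n : ℝ) * (n - 1) = (n * (n - 1) : ℕ) := by
  cases n <;> simp

lemma visTime_lt_visTime {e' : Sym2 (Fin n)} (x : Execution n P prm) (N : ℕ)
    (h : eid e < eid e') : x.visTime eid N e < x.visTime eid N e' := by
  have hden : (0 : ℝ) < (n : ℝ) * (n - 1) / 2 + 1 := by
    rw [natCast_mul_sub_one]
    positivity
  have hslot : 0 < x.time (N + 1) - x.time N := sub_pos.2 (x.time_lt_time_succ N)
  unfold visTime
  gcongr

lemma visTime_mem_Ioo (x : Execution n P prm) (N : ℕ) (hpos : 1 ≤ eid e)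
    (hle : eid e ≤ n * (n - 1) / 2) :
    x.visTime eid N e ∈ Set.Ioo (x.time N) (x.time (N + 1)) := by
  have hden : (eid e : ℝ) < (n : ℝ) * (n - 1) / 2 + 1 := by
    have hle' : (eid e : ℝ) * 2 ≤ (n * (n - 1) : ℕ) := by
      exact_mod_cast (Nat.le_div_iff_mul_le two_pos).1 hle
    rw [natCast_mul_sub_one]
    linarith
  have hnum : (0 : ℝ) < eid e := by exact_mod_cast hpos
  have hslot : 0 < x.time (N + 1) - x.time N := sub_pos.2 (x.time_lt_time_succ N)
  have hfrac_pos := mul_pos hslot (div_pos hnum (hnum.trans hden))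
  have hfrac_lt := mul_lt_mul_of_pos_left ((div_lt_one (hnum.trans hden)).2 hden) hslot
  unfold visTime
  constructor <;> linarith

/-- The time `τ` is in the slot of step `N`: not earlier than step `N`, and earlier than the next
step. -/
def InSlot (x : Execution n P prm) (N : ℕ) (τ : ℝ) : Prop :=
  τ ∈ Set.Ico (x.time N) (x.time (N + 1))

lemma inSlot_self (x : Execution n P prm) (N : ℕ) : x.InSlot N (x.time N) :=
  ⟨le_rfl, x.time_lt_time_succ N⟩

lemma InSlot.unique {M : ℕ} (h : x.InSlot N τ) (h' : x.InSlot M τ) : N = M := by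
  have hNM := x.time_mono.lt_iff_lt.1 (h.1.trans_lt h'.2)
  have hMN := x.time_mono.lt_iff_lt.1 (h'.1.trans_lt h.2)
  omega

lemma LinPoint.hasOp (h : x.LinPoint eid o τ) : x.HasOp o := by
  cases h with
  | invisible i s m κ e hop => exact hop
  | visible i s t κ e r hop => exact hop
  | readOld i j m p v val hop => exact ⟨j, hop⟩
  | readLive i j m p v val hop => exact ⟨j, hop⟩

lemma LinPoint.unique_update (h : x.LinPoint eid (.update i κ e) τ)
    (h' : x.LinPoint eid (.update i κ e) τ') : τ = τ' := by
  cases h with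
  | invisible _ s m _ _ hop hs hvis him hms hm =>
    cases h' with
    | invisible _ s' m' _ _ hop' hs' hvis' him' hms' hm' =>
      obtain rfl := FirstAfter.unique hs hs'
      obtain ⟨B, hi, -⟩ := hop
      obtain ⟨rfl, h⟩ := hs.postHist hi
      rw [h.modified_once e ⟨him, by omega, hm⟩ ⟨him', by omega, hm'⟩]
    | visible _ s' t _ _ r hop' hs' hvis' hr ht =>
      rw [FirstAfter.unique hs hs'] at hvis
      exact (hvis hvis').elim
  | visible _ s t _ _ r hop hs hvis hr ht =>
    cases h' with
    | invisible _ s' m' _ _ hop' hs' hvis' him' hms' hm' =>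
      rw [FirstAfter.unique hs hs'] at hvis
      exact (hvis' hvis).elim
    | visible _ s' t' _ _ r' hop' hs' hvis' hr' ht' =>
      obtain rfl := FirstAfter.unique hs hs'
      obtain ⟨B, hi, he⟩ := hop
      obtain rfl := hr.unique hr' hs hi he
      rw [FirstAfter.unique ht ht']

lemma LinPoint.unique_read {p : P} {val : ℝ} (h : x.LinPoint eid (.read i p v val) τ)
    (h' : x.LinPoint eid (.read i p v val) τ') : τ = τ' := by
  cases h with
  | readOld _ j m _ _ _ hop hj hm =>
    cases h' with
    | readOld _ j' m' _ _ _ hop' hj' hm' =>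
      obtain rfl := FirstAfter.unique hop.2.1 hop'.2.1
      rw [hm.unique hm']
    | readLive _ j' m' _ _ _ hop' hj' hm' =>
      obtain rfl := FirstAfter.unique hop.2.1 hop'.2.1
      cases hj.symm.trans hj'
  | readLive _ j m _ _ _ hop hj hm =>
    cases h' with
    | readOld _ j' m' _ _ _ hop' hj' hm' =>
      obtain rfl := FirstAfter.unique hop.2.1 hop'.2.1
      cases hj.symm.trans hj'
    | readLive _ j' m' _ _ _ hop' hj' hm' =>
      obtain rfl := FirstAfter.unique hop.2.1 hop'.2.1
      rw [hm.unique hm']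

lemma LinPoint.unique (h : x.LinPoint eid o τ) (h' : x.LinPoint eid o τ') : τ = τ' := by
  cases o with
  | update => exact h.unique_update h'
  | read => exact h.unique_read h'

lemma exists_linPoint (eid : Sym2 (Fin n) → ℕ) (h : x.RespondsAt o j) :
    ∃ τ, x.LinPoint eid o τ := by
  cases o with
  | update i κ e =>
    obtain ⟨⟨B, hi, he⟩, hj⟩ := h
    obtain ⟨-, s, -, hs, hroots⟩ := exists_postHist_of_batchResp hi hj
    by_cases hvis : x.Visible i s e
    · obtain ⟨r, hr⟩ := hvis.exists_isRootOfDAG hs hi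
      obtain ⟨v, -, -, hrv⟩ := id hr
      obtain ⟨t, -, ht⟩ := exists_firstAfter (hroots r hrv.2)
      exact ⟨_, .visible i s t κ e r ⟨B, hi, he⟩ hs hvis hr ht⟩
    · obtain ⟨rfl, hist⟩ := hs.postHist hi
      obtain ⟨m, him, hms, hm⟩ := (hist.modified e).2 (by simpa using he)
      refine ⟨_, .invisible _ s m κ e ⟨B, hi, he⟩ hs hvis him ?_ hm⟩
      refine (Nat.le_of_lt_succ hms).lt_of_ne ?_
      rintro rfl
      cases hm.symm.trans (FirstAfter.ev_eq hs)
  | read i p v val =>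
    rcases h.2.2 with hj | hj
    · exact ⟨_, .readOld i j _ p v val h hj (exists_lastBetween_readDesc h hj).choose_spec.1⟩
    · exact ⟨_, .readLive i j _ p v val h hj (exists_lastBetween_readL2 h hj).choose_spec.1⟩

lemma not_readInv_of_running {p : P} {w : Fin n} (hi : x.ev i = some (.readInv p v)) (hN : i < N)
    (hA : x.Alive N)
    (hret : ∀ k, i < k → k < N → ∀ a, x.ev k = some a → ¬ a.IsReturnOf p) :
    x.ev N ≠ some (.readInv p w) := fun ha => by
  have h := readerInv hi hN hA hret
  have hs := readStep_of_reader? ha rfl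
  unfold ReaderInv at h
  generalize (x.cfg N).reader p = q, (x.cfg (N + 1)).reader p = q' at *
  cases hs
  exact h

lemma read_unique {i' j' m : ℕ} {p : P} {v' : Fin n} {val val' : ℝ}
    (h : x.RespondsAt (.read i p v val) j) (h' : x.RespondsAt (.read i' p v' val') j')
    (hm : m ∈ Set.Ioo i j) (hm' : m ∈ Set.Ioo i' j') : i = i' ∧ j = j' ∧ v = v' := by
  obtain ⟨hi, hj, -⟩ := h
  obtain ⟨hi', hj', -⟩ := h'
  have hret := hj.2.2
  have hret' := hj'.2.2
  have hle : i' ≤ i := not_lt.1 fun hlt =>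
    not_readInv_of_running hi hlt ((alive_succ_of_ev hi').mono (Nat.le_succ i'))
      (fun k hik hk => hret k hik (hk.trans (hm'.1.trans hm.2))) hi'
  have hle' : i ≤ i' := not_lt.1 fun hlt =>
    not_readInv_of_running hi' hlt ((alive_succ_of_ev hi).mono (Nat.le_succ i))
      (fun k hik hk => hret' k hik (hk.trans (hm.1.trans hm'.2))) hi
  obtain rfl := hle'.antisymm hle
  cases hi.symm.trans hi'
  exact ⟨rfl, FirstAfter.unique hj hj', rfl⟩

variable (eid_range : ∀ e : Sym2 (Fin n), ¬ e.IsDiag → 1 ≤ eid e ∧ eid e ≤ n * (n - 1) / 2)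

include eid_range

lemma LinAt.inSlot (h : x.LinAt eid N τ o a) : x.InSlot N τ := by
  cases h with
  | visible κ B e s r hi he hs hN hresp hτ =>
    obtain ⟨hpos, hle⟩ := eid_range e (hs.not_isDiag hi he)
    exact hτ ▸ Set.Ioo_subset_Ico_self (visTime_mem_Ioo x N hpos hle)
  | _ => subst τ; exact inSlot_self x N

lemma LinPoint.linAt_of_inSlot (h : x.LinPoint eid o τ) (hN : x.InSlot N τ) :
    ∃ a, x.ev N = some a ∧ x.LinAt eid N τ o a := by
  obtain ⟨M, a, ha, hM⟩ := h.linAt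
  rw [hN.unique (hM.inSlot eid_range)]
  exact ⟨a, ha, hM⟩

lemma LinPoint.distinct
    (eid_inj : ∀ e e' : Sym2 (Fin n), ¬ e.IsDiag → ¬ e'.IsDiag → eid e = eid e' → e = e')
    (h : x.LinPoint eid o τ) (h' : x.LinPoint eid o' τ) : o = o' := by
  obtain ⟨N, a, ha, h⟩ := h.linAt
  obtain ⟨a', ha', h'⟩ := h'.linAt_of_inSlot eid_range (h.inSlot eid_range)
  cases ha.symm.trans ha'
  cases h with
  | invisible κ B e s hi he hb hs hNs hτ =>
    cases h' with
    | invisible κ' B' _ s' hi' he' hb' hs' hNs' hτ' =>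
      cases hi.symm.trans hi'
      rfl
  | visible κ B e s r hi he hs hN hresp hτ =>
    cases h' with
    | visible κ' B' e' s' _ hi' he' hs' hN' hresp' hτ' =>
      cases hi.symm.trans hi'
      have heid : eid e = eid e' := by
        by_contra hne
        rcases Nat.lt_or_gt_of_ne hne with hlt | hlt
        · exact (visTime_lt_visTime x N hlt).ne (hτ.symm.trans hτ')
        · exact (visTime_lt_visTime x N hlt).ne (hτ'.symm.trans hτ)
      rw [eid_inj e e' (hs.not_isDiag hi he) (hs.not_isDiag hi he') heid]
  | readOld i j p v val hop hj hm hτ =>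
    cases h' with
    | readOld i' j' _ v' val' hop' hj' hm' hτ' =>
      obtain ⟨rfl, rfl, rfl⟩ := read_unique hop hop' ⟨hm.1, hm.2.1⟩ ⟨hm'.1, hm'.2.1⟩
      cases hj.symm.trans hj'
      rfl
  | readLive i j p v val hop hj hm hτ =>
    cases h' with
    | readLive i' j' _ v' val' hop' hj' hm' hτ' =>
      obtain ⟨rfl, rfl, rfl⟩ := read_unique hop hop' ⟨hm.1, hm.2.1⟩ ⟨hm'.1, hm'.2.1⟩
      cases hj.symm.trans hj'
      rfl

lemma LinPoint.after_inv (h : x.LinPoint eid o τ) : x.time o.inv < τ := by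
  obtain ⟨N, a, ha, h⟩ := h.linAt
  refine (x.time_mono ?_).trans_le (h.inSlot eid_range).1
  cases h with
  | invisible κ B e s hi he hb hs hNs hτ => exact hb
  | visible κ B e s r hi he hs hN hresp hτ => exact hs.1.trans hN
  | readOld i j p v val hop hj hm hτ => exact hm.1
  | readLive i j p v val hop hj hm hτ => exact hm.1

lemma LinPoint.before_resp (h : x.LinPoint eid o τ) (hj : x.RespondsAt o j) : τ < x.time j := by
  obtain ⟨N, a, ha, h⟩ := h.linAt
  refine (h.inSlot eid_range).2.trans_le (x.time_mono.monotone (Nat.succ_le_of_lt ?_))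
  cases h with
  | invisible κ B e s hi he hb hs hNs hτ =>
    obtain ⟨-, s', hist, hs', -⟩ := exists_postHist_of_batchResp hi hj.2
    exact (hNs.trans_eq (FirstAfter.unique hs hs')).trans hist.settles_lt
  | visible κ B e s r hi he hs hN hresp hτ =>
    have hev := hj.2.ev_eq
    refine lt_of_not_ge fun hle => (hle.lt_or_eq).elim (fun hlt => hresp.le ⟨hj.2.1, hlt, hev⟩) ?_
    rintro rfl
    cases ha.symm.trans hev
  | readOld i j' p v val hop hj' hm hτ => exact FirstAfter.unique hop.2.1 hj.2.1 ▸ hm.2.1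
  | readLive i j' p v val hop hj' hm hτ => exact FirstAfter.unique hop.2.1 hj.2.1 ▸ hm.2.1

end Points

end Execution

/-! ## The sequential execution -/

section Sequential

variable {n : ℕ} {P : Type*} {prm : Params}

lemma SeqRun.append {S S' S'' : SeqState n} {l l' : List (Op n P)} (h : SeqRun prm S l S')
    (h' : SeqRun prm S' l' S'') : SeqRun prm S (l ++ l') S'' := by
  induction h with
  | nil S => exact h'
  | cons S S₁ S₂ o l hstep _ ih => exact .cons S S₁ S'' o _ hstep (ih h')

lemma exists_list_pairwise_lt {α β : Type*} [LinearOrder β] {f : α → β} {s : Finset α}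
    (hf : Set.InjOn f s) :
    ∃ l : List α, (∀ a, a ∈ l ↔ a ∈ s) ∧ l.Pairwise fun a b => f a < f b := by
  classical
  induction s using Finset.induction_on_max_value f with
  | empty => exact ⟨[], by simp, .nil⟩
  | insert a s has hmax ih =>
    rw [Finset.coe_insert] at hf
    obtain ⟨l, hmem, hsorted⟩ := ih (hf.mono (Set.subset_insert a s))
    refine ⟨l ++ [a], fun b => by simp [hmem, or_comm],
      List.pairwise_append.2 ⟨hsorted, List.pairwise_singleton _ _, ?_⟩⟩
    simp only [List.mem_singleton, forall_eq]
    intro b hb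
    have hbs := (hmem b).1 hb
    refine (hmax b hbs).lt_of_ne fun heq => has ?_
    rwa [← hf (Set.mem_insert_of_mem a hbs) (Set.mem_insert a s) heq]

lemma Kind.Settles.exists_seqRun {G : SimpleGraph (Fin n)} {L L' : Fin n → ℕ} {κ : Kind}
    {F : Set (Sym2 (Fin n))} (P : Type*) (hG : Stable prm G L)
    (h : κ.Settles prm (applyEdges G κ F) L L') (i : ℕ) (l : List (Sym2 (Fin n))) :
    ∃ L'', SeqRun prm ⟨applyEdges G κ F, L'⟩ (l.map fun e => (.update i κ e : Op n P))
        ⟨applyEdges G κ (F ∪ {e | e ∈ l}), L''⟩ ∧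
      κ.Settles prm (applyEdges G κ (F ∪ {e | e ∈ l})) L L'' := by
  induction l generalizing F L' with
  | nil => exact ⟨L', by simpa using SeqRun.nil _, by simpa using h⟩
  | cons e l ih =>
    obtain ⟨L₁, hreb, hsettles⟩ := h.exists_rebalance hG e
    obtain ⟨L'', hrun, hsettles⟩ := ih hsettles
    have hF : insert e F ∪ {e | e ∈ l} = F ∪ {e' | e' ∈ e :: l} := by
      ext e'
      simp only [Set.mem_union, Set.mem_insert_iff, Set.mem_ofPred_eq, List.mem_cons]
      tauto
    rw [hF] at hrun hsettles
    refine ⟨L'', .cons _ _ _ _ _ (.update _ i κ e L₁ hreb) ?_, hsettles⟩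
    rwa [applyEdge_applyEdges]

end Sequential

namespace Execution

variable {n : ℕ} {P : Type*} [DecidableEq P] {prm : Params} {x : Execution n P prm}
  {N i s : ℕ} {κ : Kind} {B todo : Finset (Sym2 (Fin n))} {a : Event n P} {v r : Fin n}
  {e e' : Sym2 (Fin n)} {eid : Sym2 (Fin n) → ℕ} {o o' : Op n P} {τ τ' : ℝ}

/-- The edges whose updates in the batch invoked at step `i` are linearized at times in `T`. -/
def linearizedEdges (x : Execution n P prm) (eid : Sym2 (Fin n) → ℕ) (i : ℕ) (T : Set ℝ) :
    Set (Sym2 (Fin n)) :=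
  {e | ∃ κ, ∃ τ ∈ T, x.LinPoint eid (.update i κ e) τ}

/-- The edges whose updates in the last batch are linearized before step `N`. -/
def done (x : Execution n P prm) (eid : Sym2 (Fin n) → ℕ) (N : ℕ) : Set (Sym2 (Fin n)) :=
  x.linearizedEdges eid (x.batch N) (Set.Iio (x.time N))

/-- The edges whose updates in the last batch are linearized in the slot of step `N`. -/
def fresh (x : Execution n P prm) (eid : Sym2 (Fin n) → ℕ) (N : ℕ) : Set (Sym2 (Fin n)) :=
  x.linearizedEdges eid (x.batch N) {τ | x.InSlot N τ}

/-- The graph of the sequential object that corresponds to the configuration before step `N`. If no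
batch has been invoked yet, this is the initial graph. -/
noncomputable def absGraph (x : Execution n P prm) (eid : Sym2 (Fin n) → ℕ) (N : ℕ) :
    SimpleGraph (Fin n) :=
  match x.ev (x.batch N) with
  | some (.batchInv κ _) => applyEdges (x.startGraph N) κ (x.done eid N)
  | _ => x.startGraph N

/-- The state of the sequential object that corresponds to the configuration before step `N`. -/
noncomputable def absState (x : Execution n P prm) (eid : Sym2 (Fin n) → ℕ) (N : ℕ) :
    SeqState n :=
  ⟨x.absGraph eid N, x.absLevel N⟩

lemma done_succ (hb : x.batch (N + 1) = x.batch N) :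
    x.done eid (N + 1) = x.done eid N ∪ x.fresh eid N := by
  have hslot : {τ | x.InSlot N τ} = Set.Ico (x.time N) (x.time (N + 1)) := rfl
  rw [done, done, fresh, hb, hslot, ← Set.Iio_union_Ico_eq_Iio (x.time_lt_time_succ N).le]
  ext e
  simp only [linearizedEdges, Set.mem_union, Set.mem_ofPred_eq, or_and_right, exists_or]

lemma done_subset (hi : x.ev (x.batch N) = some (.batchInv κ B)) : x.done eid N ⊆ B := by
  rintro e ⟨κ', τ, -, h⟩
  obtain ⟨B', hi', he⟩ := h.hasOp
  cases hi.symm.trans hi'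
  exact he

lemma done_eq_empty (h : ∀ s, ¬ x.SettlesAt (x.batch N) s) : x.done eid N = ∅ := by
  rw [Set.eq_empty_iff_forall_notMem]
  rintro e ⟨κ', τ, -, hlin⟩
  cases hlin with
  | invisible _ s _ _ _ _ hs => exact h s hs
  | visible _ s _ _ _ _ _ hs => exact h s hs

lemma absGraph_of_batchInv (hi : x.ev (x.batch N) = some (.batchInv κ B)) :
    x.absGraph eid N = applyEdges (x.startGraph N) κ (x.done eid N) := by
  simp only [absGraph, hi]

lemma absGraph_of_done_eq_empty (h : x.done eid N = ∅) : x.absGraph eid N = x.startGraph N := by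
  unfold absGraph
  split
  · rw [h, applyEdges_empty]
  · rfl

lemma absGraph_succ_of_fresh_eq_empty (hb : x.batch (N + 1) = x.batch N) (h : x.fresh eid N = ∅) :
    x.absGraph eid (N + 1) = x.absGraph eid N := by
  simp only [absGraph, hb, startGraph_of_batch hb, done_succ hb, h, Set.union_empty]

lemma cfg_succ_of_quiescent (ha : x.ev N = some a) (hq : (x.cfg N).phase = .quiescent) :
    (x.cfg (N + 1)).G = (x.cfg N).G ∧ (x.cfg (N + 1)).level = (x.cfg N).level ∧
      ¬ (x.cfg (N + 1)).phase.Active := by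
  rcases step_cases ha with hs | ⟨p, s', -, hc⟩
  · generalize x.cfg (N + 1) = c' at hs
    cases hs with
    | invoke => exact ⟨rfl, rfl, id⟩
    | _ => simp_all
  · rw [hc]
    exact ⟨rfl, rfl, by rw [hq]; exact id⟩

lemma exists_batchHist (hA : x.Alive N) (hq : (x.cfg N).phase ≠ .quiescent) :
    ∃ κ B todo, x.BatchHist N κ B todo := by
  by_cases hp : (x.cfg N).phase.IsSettled
  · obtain ⟨κ, B, s, h⟩ := exists_postHist hA hp hq
    exact ⟨κ, B, ∅, h.toBatchHist⟩
  · obtain ⟨κ, B, todo, ℓ, h, -⟩ := exists_preHist hA hp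
    exact ⟨κ, B, todo, h.toBatchHist⟩

lemma postHist_or_le (hA : x.Alive N) (hq : (x.cfg N).phase ≠ .quiescent)
    (hi : x.ev (x.batch N) = some (.batchInv κ B)) (hs : x.SettlesAt (x.batch N) s) :
    x.PostHist N κ B s ∨ x.applied N = ∅ ∧ N ≤ s := by
  by_cases hp : (x.cfg N).phase.IsSettled
  · obtain ⟨κ', B', s', h⟩ := exists_postHist hA hp hq
    exact .inl (h.of_settlesAt rfl hi hs)
  · obtain ⟨κ', B', todo, ℓ, h, -⟩ := exists_preHist hA hp
    exact .inr ⟨applied_eq_empty (full_eq_desc hp),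
      not_lt.1 fun hsN => h.noUnmark.le ⟨hs.1, hsN, FirstAfter.ev_eq hs⟩⟩

lemma mem_applied_iff (hA : x.Alive N) (hq : (x.cfg N).phase ≠ .quiescent)
    (hi : x.ev (x.batch N) = some (.batchInv κ B)) (hs : x.SettlesAt (x.batch N) s)
    (hr : RootOf (x.cfg s).desc v r) :
    v ∈ x.applied N ↔ (x.occurrences (.unmarkRoot r) s N).Nonempty := by
  rcases postHist_or_le hA hq hi hs with h | ⟨happ, hNs⟩
  · rw [← h.full] at hr
    constructor
    · rintro ⟨r', hr', hnone⟩
      obtain rfl := hr.unique hr'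
      exact h.unmarking.mem_of_root r hr.2 hnone
    · exact fun hocc => ⟨r, hr, h.unmarking.eq_none r hocc⟩
  · rw [happ]
    exact iff_of_false id fun ⟨t, hst, htN, _⟩ => by omega

lemma closed_applied_settled (hA : x.Alive N) (hq : (x.cfg N).phase ≠ .quiescent)
    (hi : x.ev (x.batch N) = some (.batchInv κ B)) (hs : x.SettlesAt (x.batch N) s) :
    Closed (x.cfg s).desc (x.applied N) := by
  rcases postHist_or_le hA hq hi hs with h | ⟨happ, -⟩
  · exact h.full ▸ closed_applied x N
  · rw [happ]
    exact fun _ _ _ => Iff.rfl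

open Classical in
lemma absLevel_eq_piecewise (hA : x.Alive N) (hq : (x.cfg N).phase ≠ .quiescent)
    (hi : x.ev (x.batch N) = some (.batchInv κ B)) (hs : x.SettlesAt (x.batch N) s) :
    x.absLevel N = (x.applied N).piecewise (x.cfg s).level (x.startLevel N) := by
  rcases postHist_or_le hA hq hi hs with h | ⟨happ, -⟩
  · rw [absLevel, h.level]
  · funext v
    have hv : v ∉ x.applied N := by
      rw [happ]
      exact id
    rw [absLevel_of_notMem hv, Set.piecewise_eq_of_notMem _ _ _ hv]

/-- `l` lists the operations that are linearized at times in `T`, in the order of their points, and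
leads the sequential object from `S` to `S'`. -/
structure LinRun (x : Execution n P prm) (eid : Sym2 (Fin n) → ℕ) (T : Set ℝ) (S : SeqState n)
    (l : List (Op n P)) (S' : SeqState n) : Prop where
  mem : ∀ o, o ∈ l ↔ ∃ τ, x.LinPoint eid o τ ∧ τ ∈ T
  sorted : l.Pairwise fun o o' => ∀ τ τ', x.LinPoint eid o τ → x.LinPoint eid o' τ' → τ < τ'
  run : SeqRun prm S l S'

lemma LinRun.append {T T' : Set ℝ} {S S' S'' : SeqState n} {l l' : List (Op n P)}
    (h : x.LinRun eid T S l S') (h' : x.LinRun eid T' S' l' S'')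
    (hTT' : ∀ τ ∈ T, ∀ τ' ∈ T', τ < τ') : x.LinRun eid (T ∪ T') S (l ++ l') S'' where
  mem o := by
    simp only [List.mem_append, h.mem, h'.mem, Set.mem_union, and_or_left, exists_or]
  sorted := List.pairwise_append.2 ⟨h.sorted, h'.sorted, fun o ho o' ho' τ τ' hτ hτ' => by
    obtain ⟨τ₁, hτ₁, hT⟩ := (h.mem o).1 ho
    obtain ⟨τ₂, hτ₂, hT'⟩ := (h'.mem o').1 ho'
    rw [hτ.unique hτ₁, hτ'.unique hτ₂]
    exact hTT' _ hT _ hT'⟩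
  run := h.run.append h'.run

lemma exists_kind_of_running (hA : x.Alive N) : ∃ κ, (x.cfg N).phase ≠ .quiescent →
    ∃ B, x.ev (x.batch N) = some (.batchInv κ B) := by
  by_cases hq : (x.cfg N).phase = .quiescent
  · exact ⟨.insertion, fun h => (h hq).elim⟩
  · obtain ⟨κ, B, todo, h⟩ := exists_batchHist hA hq
    exact ⟨κ, fun _ => ⟨B, h.inv⟩⟩

section Range

variable (eid_range : ∀ e : Sym2 (Fin n), ¬ e.IsDiag → 1 ≤ eid e ∧ eid e ≤ n * (n - 1) / 2)

include eid_range

lemma mem_done_iff (hi : x.ev (x.batch N) = some (.batchInv κ B))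
    (hs : x.SettlesAt (x.batch N) s) (he : e ∈ B) (hr : x.IsRootOfDAG (x.batch N) s e r) :
    e ∈ x.done eid N ↔ (x.occurrences (.unmarkRoot r) s N).Nonempty := by
  have hvis : x.Visible (x.batch N) s e := hr.imp fun _ h => ⟨h.1, h.2.1⟩
  obtain ⟨hpos, hle⟩ := eid_range e (hs.not_isDiag hi he)
  have hmem := fun t => visTime_mem_Ioo x t hpos hle
  constructor
  · rintro ⟨κ', τ, hτ, h⟩
    generalize x.batch N = i at *
    cases h with
    | invisible _ s' _ _ _ _ hs' hinvis =>
      obtain rfl := FirstAfter.unique hs hs'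
      exact (hinvis hvis).elim
    | visible _ s' t _ _ r' _ hs' _ hr' ht =>
      obtain rfl := FirstAfter.unique hs hs'
      obtain rfl := hr.unique hr' hs hi he
      exact ⟨t, ht.1, x.time_mono.lt_iff_lt.1 ((hmem t).1.trans hτ), ht.ev_eq⟩
  · intro hocc
    obtain ⟨t, htN, ht⟩ := exists_firstAfter hocc
    exact ⟨κ, x.visTime eid t e, (hmem t).2.trans_le (x.time_mono.monotone htN),
      .visible _ s t κ e r ⟨B, hi, he⟩ hs hvis hr ht⟩

lemma settles_absLevel (hA : x.Alive N) (hq : (x.cfg N).phase ≠ .quiescent)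
    (hi : x.ev (x.batch N) = some (.batchInv κ B)) :
    κ.Settles prm (applyEdges (x.startGraph N) κ (x.done eid N)) (x.startLevel N)
      (x.absLevel N) := by
  classical
  obtain ⟨κ', B', todo, hist⟩ := exists_batchHist hA hq
  by_cases hex : ∃ s, x.SettlesAt (x.batch N) s
  · obtain ⟨s, hs⟩ := hex
    rw [absLevel_eq_piecewise hA hq hi hs]
    refine (hs.roundInv hi).settles_piecewise hist.stable (closed_applied_settled hA hq hi hs)
      (done_subset hi) fun e he v hv hne => ?_
    have hc : x.Changes (x.batch N) s v := hne.symm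
    obtain ⟨r, hr⟩ := (hs.roundInv hi).marking.rooted v (hs.desc_ne_none hi hc)
    rw [mem_applied_iff hA hq hi hs hr, mem_done_iff eid_range hi hs he ⟨v, hv, hc, hr⟩]
  · have hp : ¬ (x.cfg N).phase.IsSettled := fun hp => hex <| by
      obtain ⟨_, _, s, h⟩ := exists_postHist hA hp hq
      exact ⟨s, h.settles⟩
    have hL : x.absLevel N = x.startLevel N := funext fun v => absLevel_of_notMem <| by
      rw [applied_eq_empty (full_eq_desc hp)]
      exact id
    rw [done_eq_empty (not_exists.1 hex), hL, applyEdges_empty]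
    exact ⟨.refl, ((stable_iff κ).1 hist.stable).1⟩

lemma LinPoint.running_of_inSlot (h : x.LinPoint eid (.update i κ e) τ) (hτ : x.InSlot N τ) :
    i = x.batch N ∧ (x.cfg N).phase ≠ .quiescent ∧
      ∃ B, x.ev (x.batch N) = some (.batchInv κ B) ∧ e ∈ B := by
  obtain ⟨a, ha, h⟩ := h.linAt_of_inSlot eid_range hτ
  have hA := (alive_succ_of_ev ha).mono (Nat.le_succ N)
  cases h with
  | invisible κ B e s hi he hb hs hNs hτ =>
    refine ⟨rfl, fun hq => (hs.batch_eq hi hb hNs.le).2 ?_, B, hi, he⟩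
    rw [hq]
    trivial
  | visible κ B e s r hi he hs hN hresp hτ =>
    exact ⟨rfl, (batch_eq_of_noResp hi (hs.1.trans hN) hA hresp).2, B, hi, he⟩

lemma LinPoint.lt_of_eid_lt (h : x.LinPoint eid (.update i κ e) τ)
    (h' : x.LinPoint eid (.update i κ e') τ') (hτ : x.InSlot N τ) (hτ' : x.InSlot N τ')
    (hlt : eid e < eid e') : τ < τ' := by
  obtain ⟨a, ha, h⟩ := h.linAt_of_inSlot eid_range hτ
  obtain ⟨a', ha', h'⟩ := h'.linAt_of_inSlot eid_range hτ'
  cases ha.symm.trans ha'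
  cases h with
  | invisible =>
    cases h'
    exact (lt_irrefl _ hlt).elim
  | visible κ B e s r hi he hs hN hresp hτ =>
    cases h' with
    | visible κ' B' e' s' _ hi' he' hs' hN' hresp' hτ' =>
      rw [hτ, hτ']
      exact visTime_lt_visTime x N hlt

lemma LinPoint.read_val_eq {p : P} {val : ℝ} (h : x.LinPoint eid (.read i p v val) τ)
    (hτ : x.InSlot N τ) : val = prm.estimate n (x.absLevel N v) := by
  obtain ⟨a, -, h⟩ := h.linAt_of_inSlot eid_range hτ
  cases h with
  | readOld _ _ _ _ _ hop hj hm =>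
    obtain ⟨m, hm', hval⟩ := exists_lastBetween_readDesc hop hj
    rwa [hm.unique hm']
  | readLive _ _ _ _ _ hop hj hm =>
    obtain ⟨m, hm', hval⟩ := exists_lastBetween_readL2 hop hj
    rwa [hm.unique hm']

lemma LinPoint.eq_of_read_of_inSlot
    (eid_inj : ∀ e e' : Sym2 (Fin n), ¬ e.IsDiag → ¬ e'.IsDiag → eid e = eid e' → e = e')
    {p : P} {val : ℝ} (h : x.LinPoint eid (.read i p v val) τ) (hτ : x.InSlot N τ)
    (ho : x.LinPoint eid o τ') (hτ' : x.InSlot N τ') : o = .read i p v val := by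
  obtain ⟨a, ha, hat⟩ := h.linAt_of_inSlot eid_range hτ
  obtain ⟨a', ha', hat'⟩ := ho.linAt_of_inSlot eid_range hτ'
  cases ha.symm.trans ha'
  have heq : τ' = τ := by
    cases hat <;> cases hat' <;> exact Eq.trans ‹τ' = x.time N› (Eq.symm ‹_›)
  exact (heq ▸ ho).distinct eid_range eid_inj h

lemma fresh_eq_empty (hq : (x.cfg N).phase = .quiescent) : x.fresh eid N = ∅ := by
  rw [Set.eq_empty_iff_forall_notMem]
  rintro e ⟨κ, τ, hτ, h⟩
  exact (h.running_of_inSlot eid_range hτ).2.1 hq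

lemma done_eq_empty_of_le_batch (x : Execution n P prm) (hN : N ≤ x.batch N) :
    x.done eid N = ∅ := by
  rw [Set.eq_empty_iff_forall_notMem]
  rintro e ⟨κ, τ, hτ, h⟩
  exact ((x.time_mono.monotone hN).trans_lt (h.after_inv eid_range)).not_gt hτ

lemma BatchHist.done_succ_eq (h : x.BatchHist N κ B todo) (ha : x.ev N = some .batchResp) :
    x.done eid (N + 1) = B := by
  have hb : x.batch (N + 1) = x.batch N := batch_succ ha nofun
  refine (done_subset (hb ▸ h.inv)).antisymm fun e he => ?_
  have hj : x.FirstAfter (fun a => a = .batchResp) (x.batch N) N :=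
    ⟨h.lt, ⟨_, ha, rfl⟩, fun k hk hkN a hak heq => h.noResp.le ⟨hk, hkN, heq ▸ hak⟩⟩
  have hresp : x.RespondsAt (.update (x.batch N) κ e) N := ⟨⟨B, h.inv, he⟩, hj⟩
  obtain ⟨τ, hτ⟩ := exists_linPoint eid hresp
  exact ⟨κ, τ, (hτ.before_resp eid_range hresp).trans (x.time_lt_time_succ N), hb ▸ hτ⟩

lemma absGraph_of_quiescent (hA : x.Alive N) (hq : (x.cfg N).phase = .quiescent) :
    x.absGraph eid N = (x.cfg N).G := by
  induction N with
  | zero =>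
    have hb : x.batch 0 = 0 := rfl
    have hdone := done_eq_empty_of_le_batch eid_range x (Nat.zero_le _)
    rw [absGraph_of_done_eq_empty hdone, startGraph, hb]
  | succ N ih =>
    obtain ⟨a, ha⟩ := Option.ne_none_iff_exists'.1 (hA N N.lt_succ_self)
    have hA := hA.mono N.le_succ
    have hinv : ∀ κ B, a ≠ .batchInv κ B := by
      rintro κ B rfl
      cases hq.symm.trans (phase_of_batchInv ha).2
    have hb := batch_succ ha hinv
    by_cases hqN : (x.cfg N).phase = .quiescent
    · rw [absGraph_succ_of_fresh_eq_empty hb (fresh_eq_empty eid_range hqN), ih hA hqN,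
        (cfg_succ_of_quiescent ha hqN).1]
    · obtain rfl : a = .batchResp := by_contra fun hne => ne_quiescent_succ ha hne hqN hq
      obtain ⟨hp, hc⟩ := cfg_of_batchResp ha
      obtain ⟨κ, B, s, h⟩ := exists_postHist hA (by rw [hp]; trivial) hqN
      rw [absGraph_of_batchInv (hb ▸ h.inv), h.done_succ_eq eid_range ha,
        startGraph_of_batch hb, hc, h.graph_eq]

lemma absGraph_succ_of_quiescent (ha : x.ev N = some a) (hq : (x.cfg N).phase = .quiescent) :
    x.absGraph eid (N + 1) = x.absGraph eid N := by
  by_cases hinv : ∃ κ B, a = .batchInv κ B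
  · obtain ⟨κ, B, rfl⟩ := hinv
    have hb := batch_succ_of_batchInv ha
    have hdone : x.done eid (N + 1) = ∅ := by
      rw [Set.eq_empty_iff_forall_notMem]
      rintro e ⟨κ', τ, hτ, h⟩
      rw [hb] at h
      exact (h.running_of_inSlot eid_range ⟨(h.after_inv eid_range).le, hτ⟩).2.1 hq
    have hA := (alive_succ_of_ev ha).mono N.le_succ
    rw [absGraph_of_done_eq_empty hdone, startGraph, hb, absGraph_of_quiescent eid_range hA hq]
  · have hb := batch_succ ha fun κ B h => hinv ⟨κ, B, h⟩
    exact absGraph_succ_of_fresh_eq_empty hb (fresh_eq_empty eid_range hq)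

lemma absState_succ_of_quiescent (ha : x.ev N = some a) (hq : (x.cfg N).phase = .quiescent) :
    x.absState eid (N + 1) = x.absState eid N := by
  have hA := alive_succ_of_ev ha
  obtain ⟨-, hL, hact⟩ := cfg_succ_of_quiescent ha hq
  rw [absState, absState, absGraph_succ_of_quiescent eid_range ha hq,
    absLevel_of_not_active hA hact, hL,
    absLevel_of_not_active (hA.mono N.le_succ) (by rw [hq]; exact id)]

lemma settles_succ (ha : x.ev N = some a) (hq : (x.cfg N).phase ≠ .quiescent)
    (hi : x.ev (x.batch N) = some (.batchInv κ B)) :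
    κ.Settles prm (applyEdges (x.startGraph N) κ (x.done eid (N + 1))) (x.startLevel N)
      (x.absLevel (N + 1)) := by
  have hA := alive_succ_of_ev ha
  have hb : x.batch (N + 1) = x.batch N := batch_succ ha <| by
    rintro κ B rfl
    exact hq (phase_of_batchInv ha).1
  by_cases hq' : (x.cfg (N + 1)).phase = .quiescent
  · obtain rfl : a = .batchResp := by_contra fun hne => ne_quiescent_succ ha hne hq hq'
    obtain ⟨hp, hc⟩ := cfg_of_batchResp ha
    obtain ⟨κ', B', s, h⟩ := exists_postHist (hA.mono N.le_succ) (by rw [hp]; trivial) hq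
    cases hi.symm.trans h.inv
    rw [h.done_succ_eq eid_range ha, absLevel_of_not_active hA (by rw [hq']; exact id), hc]
    exact h.round.settles h.stable
  · rw [← startGraph_of_batch hb, ← startLevel_of_batch hb]
    exact settles_absLevel eid_range hA hq' (hb ▸ hi)

lemma seqRun_absState_succ (ha : x.ev N = some a) {l : List (Sym2 (Fin n))}
    (hl : ∀ e, e ∈ l ↔ e ∈ x.fresh eid N)
    (hκ : (x.cfg N).phase ≠ .quiescent → ∃ B, x.ev (x.batch N) = some (.batchInv κ B)) :
    SeqRun prm (x.absState eid N) (l.map fun e => (.update (x.batch N) κ e : Op n P))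
      (x.absState eid (N + 1)) := by
  have hA := (alive_succ_of_ev ha).mono N.le_succ
  by_cases hq : (x.cfg N).phase = .quiescent
  · have hnil : l = [] := List.eq_nil_iff_forall_not_mem.2 fun e he => by
      rw [hl, fresh_eq_empty eid_range hq] at he
      exact he
    rw [hnil, absState_succ_of_quiescent eid_range ha hq]
    exact .nil _
  · obtain ⟨B, hi⟩ := hκ hq
    obtain ⟨κ', B', todo, hist⟩ := exists_batchHist hA hq
    have hb : x.batch (N + 1) = x.batch N := batch_succ ha <| by
      rintro κ B rfl
      exact hq (phase_of_batchInv ha).1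
    obtain ⟨L, hrun, hsettles⟩ :=
      (settles_absLevel eid_range hA hq hi).exists_seqRun P hist.stable (x.batch N) l
    have hdone : x.done eid N ∪ {e | e ∈ l} = x.done eid (N + 1) := by
      rw [done_succ hb]
      exact congrArg _ (Set.ext hl)
    rw [hdone] at hrun hsettles
    obtain rfl := hsettles.unique (settles_succ eid_range ha hq hi)
    rwa [absState, absState, absGraph_of_batchInv hi, absGraph_of_batchInv (hb ▸ hi),
      startGraph_of_batch hb]

lemma linRun_slot_of_ev_eq_none (h : x.ev N = none) (S : SeqState n) :
    x.LinRun eid {τ | x.InSlot N τ} S [] S where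
  mem o := by
    simp only [List.not_mem_nil, false_iff, not_exists, not_and]
    intro τ ho hτ
    obtain ⟨a, ha, -⟩ := ho.linAt_of_inSlot eid_range hτ
    cases h.symm.trans ha
  sorted := .nil
  run := .nil S

lemma absState_zero (x : Execution n P prm) : x.absState eid 0 = SeqState.init n := by
  have hA : x.Alive 0 := fun k hk => (Nat.not_lt_zero k hk).elim
  have hq : (x.cfg 0).phase = .quiescent := by rw [x.init]; rfl
  rw [absState, absGraph_of_quiescent eid_range hA hq,
    absLevel_of_not_active hA (by rw [hq]; exact id), x.init]
  rfl

lemma not_isDiag_of_mem_fresh (he : e ∈ x.fresh eid N) : ¬ e.IsDiag := by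
  obtain ⟨κ, τ, hτ, h⟩ := he
  obtain ⟨-, hq, B, hi, he⟩ := h.running_of_inSlot eid_range hτ
  obtain ⟨a, ha, -⟩ := h.linAt_of_inSlot eid_range hτ
  obtain ⟨κ', B', todo, hist⟩ := exists_batchHist ((alive_succ_of_ev ha).mono N.le_succ) hq
  cases hi.symm.trans hist.inv
  exact hist.diag e he

section Slot

variable (eid_inj : ∀ e e' : Sym2 (Fin n), ¬ e.IsDiag → ¬ e'.IsDiag → eid e = eid e' → e = e')

include eid_inj

lemma LinPoint.linRun_read {p : P} {val : ℝ} (h : x.LinPoint eid (.read i p v val) τ)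
    (hτ : x.InSlot N τ) : x.LinRun eid {τ | x.InSlot N τ} (x.absState eid N)
      [.read i p v val] (x.absState eid (N + 1)) where
  mem o := by
    rw [List.mem_singleton]
    refine ⟨?_, ?_⟩
    · rintro rfl
      exact ⟨τ, h, hτ⟩
    · rintro ⟨τ', ho, hτ'⟩
      exact h.eq_of_read_of_inSlot eid_range eid_inj hτ ho hτ'
  sorted := List.pairwise_singleton _ _
  run := by
    obtain ⟨a, ha, -⟩ := h.linAt_of_inSlot eid_range hτ
    obtain ⟨κ, hκ⟩ := exists_kind_of_running ((alive_succ_of_ev ha).mono N.le_succ)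
    have hfresh : x.fresh eid N = ∅ := by
      rw [Set.eq_empty_iff_forall_notMem]
      rintro e ⟨κ', τ', hτ', he⟩
      cases h.eq_of_read_of_inSlot eid_range eid_inj hτ he hτ'
    rw [h.read_val_eq eid_range hτ]
    refine .cons _ _ _ _ _ (.read _ i p v) ?_
    exact seqRun_absState_succ (l := []) eid_range ha (fun e => by rw [hfresh]; simp) hκ

lemma exists_linRun_updates (ha : x.ev N = some a)
    (hread : ∀ i p v val τ, x.InSlot N τ → ¬ x.LinPoint eid (.read i p v val) τ) :
    ∃ l, x.LinRun eid {τ | x.InSlot N τ} (x.absState eid N) l (x.absState eid (N + 1)) := by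
  obtain ⟨κ, hκ⟩ := exists_kind_of_running ((alive_succ_of_ev ha).mono N.le_succ)
  have hupdate : ∀ {o τ}, x.LinPoint eid o τ → x.InSlot N τ →
      ∃ e, e ∈ x.fresh eid N ∧ o = .update (x.batch N) κ e := by
    rintro (⟨i, κ', e⟩ | ⟨i, p, v, val⟩) τ h hτ
    · obtain ⟨rfl, hq, B, hi, -⟩ := h.running_of_inSlot eid_range hτ
      obtain ⟨B', hi'⟩ := hκ hq
      cases hi.symm.trans hi'
      exact ⟨e, ⟨κ, τ, hτ, h⟩, rfl⟩
    · exact (hread i p v val τ hτ h).elim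
  have hfresh : ∀ {e}, e ∈ x.fresh eid N →
      ∃ τ, x.LinPoint eid (.update (x.batch N) κ e) τ ∧ x.InSlot N τ := by
    rintro e ⟨κ', τ, hτ, h⟩
    obtain ⟨_, -, heq⟩ := hupdate h hτ
    cases heq
    exact ⟨τ, h, hτ⟩
  obtain ⟨l, hl, hsorted⟩ := exists_list_pairwise_lt (f := eid)
    (s := (Set.toFinite (x.fresh eid N)).toFinset) fun e he e' he' heq => by
      rw [Set.Finite.coe_toFinset] at he he'
      exact eid_inj e e' (not_isDiag_of_mem_fresh eid_range he)
        (not_isDiag_of_mem_fresh eid_range he') heq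
  simp only [Set.Finite.mem_toFinset] at hl
  refine ⟨_, ⟨fun o => ?_, ?_, seqRun_absState_succ eid_range ha hl hκ⟩⟩
  · rw [List.mem_map]
    constructor
    · rintro ⟨e, he, rfl⟩
      exact hfresh ((hl e).1 he)
    · rintro ⟨τ, h, hτ⟩
      obtain ⟨e, he, rfl⟩ := hupdate h hτ
      exact ⟨e, (hl e).2 he, rfl⟩
  · refine List.pairwise_map.2 (hsorted.imp_of_mem fun {e e'} he he' hlt τ τ' h h' => ?_)
    obtain ⟨τ₁, h₁, hτ₁⟩ := hfresh ((hl e).1 he)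
    obtain ⟨τ₂, h₂, hτ₂⟩ := hfresh ((hl e').1 he')
    rw [h.unique h₁, h'.unique h₂]
    exact h₁.lt_of_eid_lt eid_range h₂ hτ₁ hτ₂ hlt

lemma exists_linRun_slot (ha : x.ev N = some a) :
    ∃ l, x.LinRun eid {τ | x.InSlot N τ} (x.absState eid N) l (x.absState eid (N + 1)) := by
  by_cases hread : ∃ i p v val τ, x.InSlot N τ ∧ x.LinPoint eid (.read i p v val) τ
  · obtain ⟨i, p, v, val, τ, hτ, h⟩ := hread
    exact ⟨_, h.linRun_read eid_range eid_inj hτ⟩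
  · push Not at hread
    exact exists_linRun_updates eid_range eid_inj ha hread

lemma exists_linRun (x : Execution n P prm) (N : ℕ) :
    ∃ l S, x.LinRun eid (Set.Iio (x.time N)) (SeqState.init n) l S ∧
      (x.Alive N → S = x.absState eid N) := by
  induction N with
  | zero =>
    refine ⟨[], _, ⟨fun o => ?_, .nil, .nil _⟩, fun _ => (absState_zero eid_range x).symm⟩
    simp only [List.not_mem_nil, false_iff, not_exists, not_and]
    intro τ h
    exact ((x.time_mono.monotone (Nat.zero_le _)).trans_lt (h.after_inv eid_range)).not_gt
  | succ N ih =>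
    obtain ⟨l, S, hl, hS⟩ := ih
    rw [← Set.Iio_union_Ico_eq_Iio (x.time_lt_time_succ N).le]
    have hlt : ∀ τ ∈ Set.Iio (x.time N), ∀ τ' ∈ {τ | x.InSlot N τ}, τ < τ' :=
      fun _ hτ _ hτ' => hτ.trans_le hτ'.1
    cases ha : x.ev N with
    | none =>
      exact ⟨_, S, hl.append (linRun_slot_of_ev_eq_none eid_range ha S) hlt,
        fun hA => (hA N N.lt_succ_self ha).elim⟩
    | some a =>
      obtain rfl := hS ((alive_succ_of_ev ha).mono N.le_succ)
      obtain ⟨l', hl'⟩ := exists_linRun_slot eid_range eid_inj ha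
      exact ⟨_, _, hl.append hl' hlt, fun _ => rfl⟩

theorem linearizedBy (x : Execution n P prm) : x.LinearizedBy (x.LinPoint eid) where
  unique _ _ _ h h' := h.unique h'
  hasOp _ _ h := h.hasOp
  total _ _ h := exists_linPoint eid h
  after_inv _ _ h := h.after_inv eid_range
  before_resp _ _ _ h hj := h.before_resp eid_range hj
  distinct _ _ _ h h' := h.distinct eid_range eid_inj h'
  legal N := by
    obtain ⟨l, S, hl, -⟩ := exists_linRun eid_range eid_inj x N
    exact ⟨l, hl.mem, hl.sorted, S, hl.run⟩

end Slot

end Range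

end Execution

end CPLDS

theorem mainTheorem1 {n : ℕ} {P : Type*} [DecidableEq P] (prm : CPLDS.Params)
    (eid : Sym2 (Fin n) → ℕ)
    (eid_inj : ∀ e e' : Sym2 (Fin n), ¬ e.IsDiag → ¬ e'.IsDiag → eid e = eid e' → e = e')
    (eid_range : ∀ e : Sym2 (Fin n), ¬ e.IsDiag → 1 ≤ eid e ∧ eid e ≤ n * (n - 1) / 2)
    (x : CPLDS.Execution n P prm) :
    x.SameDAG ∧ x.UniqueDAG ∧ x.LinearizedBy (x.LinPoint eid) :=
  ⟨x.sameDAG, x.uniqueDAG, x.linearizedBy eid_range eid_inj⟩
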